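/- Let $T>0$, let $\alpha\in(1/2,1]$ and let $f:\mathbb R\to\mathbb R$ be continuous. For $\gamma>0$ put $${}_0D_t^{-\gamma}u(t)=\frac1{\Gamma(\gamma)}\int_0^t(t-s)^{\gamma-1}u(s)\,ds,\qquad {}_tD_T^{-\gamma}u(t)=\frac1{\Gamma(\gamma)}\int_t^T(s-t)^{\gamma-1}u(s)\,ds ,$$ let the integrals of order $0$ be the identity, and let ${}_0^cD_t^{\alpha}u={}_0D_t^{\alpha-1}u'$ and ${}_t^cD_T^{\alpha}u=-\,{}_tD_T^{\alpha-1}u'$ be the left and right Caputo derivatives of an absolutely continuous function $u$ (so they are $u'$ and $-u'$ for $\alpha=1$). Let $C_0^\infty([0,T])$ be the set of $g\in C^\infty([0,T])$ with $g(0)=g(T)=0$, and let $E_0^\alpha$ be its closure in the norm $\big(\int_0^T|{}_0^cD_t^\alpha u|^2dt+\int_0^T|u|^2dt\big)^{1/2}$, realized in $L^2(0,T)$: $u\in E_0^\alpha$ if and only if there are $\varphi_n\in C_0^\infty([0,T])$ such that $\varphi_n\to u$ in $L^2(0,T)$ and ${}_0^cD_t^\alpha\varphi_n$ converges in $L^2(0,T)$.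 Set $$\kappa_\alpha=\frac{T^{2\alpha}}{\Gamma(\alpha)^2\,|\cos(\pi\alpha)|\,(2\alpha-1)}$$ and assume that $$\sup_{\gamma>0}\ \frac{\gamma^2}{\displaystyle\max_{|\xi|\le\gamma}\int_0^\xi f(t)\,dt}>\kappa_\alpha ,$$ where a quotient with denominator $0$ is read as $+\infty$. Then the problem $$\frac{d}{dt}\Big({}_0D_t^{\alpha-1}({}_0^cD_t^\alpha u(t))-{}_tD_T^{\alpha-1}({}_t^cD_T^\alpha u(t))\Big)+f(u(t))=0\ \text{ for a.e. } t\in[0,T],\qquad u(0)=u(T)=0,$$ has at least one solution $u\in E_0^\alpha$. That is, there is $u\in E_0^\alpha$, absolutely continuous on $[0,T]$ with $u(0)=u(T)=0$, such that at almost every $t\in[0,T]$ the expression in the large parentheses is defined near $t$, is differentiable at $t$ in the classical sense, and satisfies the equation; moreover $u$ is a weak solution: $$-\int_0^T\Big({}_0^cD_t^\alpha u\cdot{}_t^cD_T^\alpha v+{}_t^cD_T^\alpha u\cdot{}_0^cD_t^\alpha v\Big)dt=\int_0^Tf(u)\,v\,dt\qquad\text{for all } v\in C_0^\infty([0,T]).$$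 -/

import Mathlib

open MeasureTheory Set Filter Topology

namespace FracBVP

noncomputable section

/-- Left Riemann-Liouville fractional integral of order `γ ≥ 0` with base point `a`;
the integral of order `0` is the identity. -/
def leftRL (a γ : ℝ) (u : ℝ → ℝ) (t : ℝ) : ℝ :=
  if γ = 0 then u t
  else 1 / Real.Gamma γ * ∫ s in a..t, (t - s) ^ (γ - 1) * u s

/-- Right Riemann-Liouville fractional integral of order `γ ≥ 0` with end point `b`;
the integral of order `0` is the identity. -/
def rightRL (b γ : ℝ) (u : ℝ → ℝ) (t : ℝ) : ℝ :=
  if γ = 0 then u t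
  else 1 / Real.Gamma γ * ∫ s in t..b, (s - t) ^ (γ - 1) * u s

/-- The integral in `leftRL a γ u t` converges (no condition in order `0`). -/
def LeftRLExists (a γ : ℝ) (u : ℝ → ℝ) (t : ℝ) : Prop :=
  γ = 0 ∨ IntervalIntegrable (fun s => (t - s) ^ (γ - 1) * u s) volume a t

/-- The integral in `rightRL b γ u t` converges (no condition in order `0`). -/
def RightRLExists (b γ : ℝ) (u : ℝ → ℝ) (t : ℝ) : Prop :=
  γ = 0 ∨ IntervalIntegrable (fun s => (s - t) ^ (γ - 1) * u s) volume t b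

/-- Left Caputo derivative of order `α ∈ (0, 1]` of an absolutely continuous function;
it is `u'` for `α = 1`. -/
def caputoLeft (a α : ℝ) (u : ℝ → ℝ) (t : ℝ) : ℝ :=
  leftRL a (1 - α) (deriv u) t

/-- Right Caputo derivative of order `α ∈ (0, 1]` of an absolutely continuous function;
it is `-u'` for `α = 1`. -/
def caputoRight (b α : ℝ) (u : ℝ → ℝ) (t : ℝ) : ℝ :=
  -rightRL b (1 - α) (deriv u) t

/-- `C_0^∞([0, T])`: smooth functions on the closed interval that vanish at both end points. -/
def IsTest (T : ℝ) (g : ℝ → ℝ) : Prop :=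
  ContDiffOn ℝ ((⊤ : ℕ∞) : WithTop ℕ∞) g (Icc 0 T) ∧ g 0 = 0 ∧ g T = 0

/-- Membership in the fractional derivative space `E_0^α`, the closure of `C_0^∞([0, T])` in the
norm `(∫ |D^α u|² + ∫ |u|²)^(1/2)`, `D^α` the left Caputo derivative: `u` is the `L²` limit of
test functions whose left Caputo derivatives converge in `L²` (to a function `w`, which is the
fractional derivative of `u`). -/
def MemE0 (T α : ℝ) (u : ℝ → ℝ) : Prop :=
  MemLp u 2 (volume.restrict (Icc 0 T)) ∧
  ∃ w : ℝ → ℝ, MemLp w 2 (volume.restrict (Icc 0 T)) ∧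
    ∃ φ : ℕ → ℝ → ℝ, (∀ n, IsTest T (φ n)) ∧
      Tendsto (fun n => eLpNorm (fun t => φ n t - u t) 2 (volume.restrict (Icc 0 T)))
        atTop (𝓝 0) ∧
      Tendsto (fun n => eLpNorm (fun t => caputoLeft 0 α (φ n) t - w t) 2
        (volume.restrict (Icc 0 T))) atTop (𝓝 0)

/-- The expression whose derivative is the principal part of the equation: the left fractional
integral of order `1 - α` of the left Caputo derivative, minus its right counterpart. -/
def flux (T α : ℝ) (u : ℝ → ℝ) (t : ℝ) : ℝ :=
  leftRL 0 (1 - α) (caputoLeft 0 α u) t - rightRL T (1 - α) (caputoRight T α u) t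

/-- `u` is a solution of the boundary value problem `(flux)' + f(u) = 0` a.e. on `[0, T]`,
`u(0) = u(T) = 0`: it is absolutely continuous, and at almost every `t` the flux is defined near
`t`, is differentiable at `t` in the classical sense, and satisfies the equation. -/
def IsSolution (T α : ℝ) (f u : ℝ → ℝ) : Prop :=
  AbsolutelyContinuousOnInterval u 0 T ∧
  (∀ᵐ t ∂(volume.restrict (Icc 0 T)),
    (∀ᶠ s in 𝓝 t, LeftRLExists 0 (1 - α) (caputoLeft 0 α u) s ∧
      RightRLExists T (1 - α) (caputoRight T α u) s) ∧
    DifferentiableAt ℝ (flux T α u) t ∧ deriv (flux T α u) t + f (u t) = 0) ∧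
  u 0 = 0 ∧ u T = 0

/-- The weak (variational) form of the equation, tested against `C_0^∞([0, T])`, which is
dense in `E_0^α` by definition. -/
def IsWeakSolution (T α : ℝ) (f u : ℝ → ℝ) : Prop :=
  ∀ v : ℝ → ℝ, IsTest T v →
    -∫ t in (0 : ℝ)..T, (caputoLeft 0 α u t * caputoRight T α v t
        + caputoRight T α u t * caputoLeft 0 α v t)
      = ∫ t in (0 : ℝ)..T, f (u t) * v t

/-- `κ_α = T^{2α} / (Γ(α)² |cos(πα)| (2α - 1))`. -/
def kappa (T α : ℝ) : ℝ :=
  T ^ (2 * α) / (Real.Gamma α ^ 2 * |Real.cos (Real.pi * α)| * (2 * α - 1))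

/-- `max_{|ξ| ≤ γ} ∫_0^ξ f`, a maximum of a continuous function over a compact interval when
`f` is continuous and `γ ≥ 0`; it is nonnegative because `ξ = 0` is allowed. -/
def maxPrimitive (f : ℝ → ℝ) (γ : ℝ) : ℝ :=
  sSup ((fun ξ : ℝ => ∫ t in (0 : ℝ)..ξ, f t) '' Icc (-γ) γ)

/-- `sup_{γ > 0} γ² / max_{|ξ| ≤ γ} ∫_0^ξ f` in `[0, ∞]`; a quotient with zero denominator
is `∞`. -/
def growthSup (f : ℝ → ℝ) : ENNReal :=
  ⨆ (γ : ℝ) (_ : 0 < γ), ENNReal.ofReal (γ ^ 2) / ENNReal.ofReal (maxPrimitive f γ)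

end

end FracBVP

/-! Put g = u'. Composing the one-sided fractional integrals of order 1 - α turns the expression in
parentheses into a Riesz potential, `Aop α g` x = Γ(2-2α)⁻¹ ∫ |x-y|^(1-2α) g(y) dy, or 2g when α =
1. The problem becomes `Aop α u'` = c - ∫_0^x f(u) with u(0) = u(T) = 0.

This potential is diagonalised explicitly. For the weight w = (t(T-t))^(α-1) the potential of w is
constant on (0,T) (`eqPotential`). Multiplication by X propagates this to all degrees: p ↦ `Aop α (w
p)` maps polynomials to polynomials and is triangular in the degree (`riesz_mul_X`,
`exists_Aop_poly`). It is also symmetric in L²(w), hence diagonal on the orthonormal polynomials,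
and so is a Sturm-Liouville operator (`exists_spectral`). One looks for u' = w p with p = Σ c_m b_m,
the constant polynomial being omitted so that u(T) = 0; after rescaling c_m to a_m, half of the
quadratic form of `Aop` is Σ a_m².

Existence is a minimisation of Σ a_m² - ∫ F(u), with F' = f and F(0) = 0, over a ball Σ a_m² ≤ r.
The constant κ enters through the pointwise bound u(t)² ≤ (κ/T) Σ a_m² (`sq_primitive_le`): u is the
integral of order α of its Caputo derivative, and Cauchy-Schwarz applies. If κ max F < γ² on |ξ| ≤ γ
and r = T γ²/κ, then |u| ≤ γ on the whole ball, and on the sphere the energy is at least r - T max F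
> 0, which exceeds the energy 0 of the zero function. So the minimiser is interior and critical
(`exists_critical`); only the values of f on [-γ, γ] are controlled. The critical equations say that
all weighted moments of `Aop α u'` + ∫ f(u) - c vanish, so this function is zero a.e.
(`exists_weighted_solution`).

A classical derivative of the flux requires the identity at every point, not just a.e. A Bessel
inequality for the derivatives of the polynomials gives Σ c_m² (m+1)^(4α-2) < ∞, and Sonin's
monotone quantity bounds the polynomials uniformly in the interior. The potentials of the dyadic
blocks then decay geometrically, locally uniformly (`riesz_regular`), so for α < 1 the flux is
continuous on (0,T) and equals the C¹ function c - ∫ f(u) there. For α = 1 this is read off from u'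
directly. Membership in E_0^α comes from approximating w p by polynomials of mean zero
(`memE0_primitive`), and the weak form from Fubini and an integration by parts (`weak_form_eq`). -/

namespace FracBVP

/-! ### One-sided power kernels and Beta integrals -/

/-- The causal kernel `x_+^(γ-1)`. -/
noncomputable def ker (γ x : ℝ) : ℝ := if 0 < x then x ^ (γ - 1) else 0

lemma ker_nonneg (γ x : ℝ) : 0 ≤ ker γ x := by
  unfold ker; split_ifs with h
  · positivity
  · exact le_rfl

lemma ker_of_pos {γ x : ℝ} (h : 0 < x) : ker γ x = x ^ (γ - 1) := if_pos h

lemma ker_of_nonpos {γ x : ℝ} (h : x ≤ 0) : ker γ x = 0 := if_neg h.not_gt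

@[fun_prop]
lemma measurable_ker (γ : ℝ) : Measurable (ker γ) :=
  Measurable.ite measurableSet_Ioi (by fun_prop) (by fun_prop)

/-- At x = 0 both sides vanish because 0 raised to a nonzero power is 0; this is where γ ≠ 1 is
needed. With γ = 2 - 2α the identity assembles the Riesz kernel from the left and right kernels. -/
lemma ker_add_ker_neg {γ : ℝ} (hγ : γ ≠ 1) (x : ℝ) : ker γ x + ker γ (-x) = |x| ^ (γ - 1) := by
  rcases lt_trichotomy x 0 with h | h | h
  · rw [ker_of_nonpos h.le, ker_of_pos (by linarith), abs_of_neg h, zero_add]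
  · subst h
    rw [neg_zero, ker_of_nonpos le_rfl, abs_zero, Real.zero_rpow (sub_ne_zero.2 hγ), zero_add]
  · rw [ker_of_pos h, ker_of_nonpos (by linarith), abs_of_pos h, add_zero]

lemma integral_rpow_mul_sub_rpow {a b c : ℝ} (ha : 0 < a) (hb : 0 < b) (hc : 0 < c) :
    ∫ x in (0 : ℝ)..c, x ^ (a - 1) * (c - x) ^ (b - 1) =
      c ^ (a + b - 1) * ProbabilityTheory.beta a b := by
  have h := Complex.betaIntegral_scaled (a : ℂ) (b : ℂ) hc
  have h1 : (∫ x in (0 : ℝ)..c, ((x : ℂ) ^ ((a : ℂ) - 1) * ((c : ℂ) - x) ^ ((b : ℂ) - 1)))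
      = ((∫ x in (0 : ℝ)..c, x ^ (a - 1) * (c - x) ^ (b - 1) : ℝ) : ℂ) := by
    rw [← intervalIntegral.integral_ofReal]
    refine intervalIntegral.integral_congr fun x hx => ?_
    rw [uIcc_of_le hc.le] at hx
    push_cast
    rw [Complex.ofReal_cpow hx.1, Complex.ofReal_cpow (sub_nonneg.2 hx.2)]
    push_cast; rfl
  rw [h1] at h
  have h2 := congrArg Complex.re h
  rw [Complex.ofReal_re] at h2
  rw [h2, ProbabilityTheory.beta_eq_betaIntegralReal a b ha hb]
  have : ((c : ℂ) ^ ((a : ℂ) + b - 1)) = ((c ^ (a + b - 1) : ℝ) : ℂ) := by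
    rw [Complex.ofReal_cpow hc.le]; push_cast; rfl
  rw [this, Complex.re_ofReal_mul]

/-- This is the semigroup law of fractional integration at the level of kernels: the integrand lives
on (s, t) and is a rescaled Beta integral. -/
lemma integral_ker_mul_ker {a b : ℝ} (ha : 0 < a) (hb : 0 < b) (s t : ℝ) :
    ∫ τ, ker a (t - τ) * ker b (τ - s) = ProbabilityTheory.beta a b * ker (a + b) (t - s) := by
  have h0 : (fun τ => ker a (t - τ) * ker b (τ - s)) =
      (Ioo s t).indicator (fun τ => (t - τ) ^ (a - 1) * (τ - s) ^ (b - 1)) := by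
    ext τ
    by_cases h : τ ∈ Ioo s t
    · rw [indicator_of_mem h, ker_of_pos (by linarith [h.2]), ker_of_pos (by linarith [h.1])]
    · rw [indicator_of_notMem h]
      by_cases h1 : s < τ
      · have : ¬ τ < t := fun h2 => h ⟨h1, h2⟩
        rw [ker_of_nonpos (by linarith), zero_mul]
      · rw [ker_of_nonpos (x := τ - s) (by linarith), mul_zero]
  rw [h0, integral_indicator measurableSet_Ioo]
  rcases le_or_gt t s with h | h
  · rw [Ioo_eq_empty (not_lt.2 h), ker_of_nonpos (by linarith)]; simp
  · rw [← integral_Ioc_eq_integral_Ioo, ← intervalIntegral.integral_of_le h.le,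
      ker_of_pos (by linarith)]
    have h1 := integral_rpow_mul_sub_rpow hb ha (sub_pos.2 h)
    have h2 := intervalIntegral.integral_comp_sub_right
      (fun x : ℝ => x ^ (b - 1) * (t - s - x) ^ (a - 1)) (a := s) (b := t) s
    rw [sub_self, h1] at h2
    calc _ = ∫ x in s..t, (x - s) ^ (b - 1) * (t - s - (x - s)) ^ (a - 1) := by
          refine intervalIntegral.integral_congr fun x _ => ?_
          rw [mul_comm]; congr 2; ring
      _ = _ := by
          rw [h2, mul_comm, ProbabilityTheory.beta, ProbabilityTheory.beta, add_comm b a,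
            mul_comm (Real.Gamma b)]

lemma integrable_ker_mul_ker {a b : ℝ} (ha : 0 < a) (hb : 0 < b) (s t : ℝ) :
    Integrable fun τ => ker a (t - τ) * ker b (τ - s) := by
  rcases le_or_gt t s with h | h
  · have : (fun τ => ker a (t - τ) * ker b (τ - s)) = 0 := by
      ext τ
      rcases le_or_gt τ s with h1 | h1
      · simp [ker_of_nonpos (x := τ - s) (γ := b) (by linarith)]
      · simp [ker_of_nonpos (x := t - τ) (γ := a) (by linarith)]
    rw [this]; exact integrable_zero _ _ _
  -- The integral of a nonintegrable function is 0 by convention, so a nonzero value already proves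
  -- integrability.
  · refine Integrable.of_integral_ne_zero ?_
    rw [integral_ker_mul_ker ha hb, ker_of_pos (by linarith)]
    exact (mul_pos (ProbabilityTheory.beta_pos ha hb)
      (Real.rpow_pos_of_pos (by linarith) _)).ne'

/-- The substitution x = d(1/y - 1) maps (0,1) onto (0,∞) and produces a Beta integral. Convergence
needs α < 1 at the origin and α > 1/2 at infinity. -/
lemma integral_rpow_mul_add_rpow {α d : ℝ} (hα : α ∈ Ioo (1 / 2 : ℝ) 1) (hd : 0 < d) :
    ∫ x in Ioi (0 : ℝ), x ^ (-α) * (x + d) ^ (-α) =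
      ProbabilityTheory.beta (2 * α - 1) (1 - α) * d ^ (1 - 2 * α) := by
  have him : (fun y : ℝ => d * (y⁻¹ - 1)) '' Ioo 0 1 = Ioi 0 := by
    ext x
    constructor
    · rintro ⟨y, hy, rfl⟩
      have := (one_lt_inv₀ hy.1).2 hy.2
      exact mul_pos hd (by linarith)
    · intro hx
      have hx : 0 < x := hx
      refine ⟨d / (x + d), ⟨by positivity, by rw [div_lt_one (by positivity)]; linarith⟩, ?_⟩
      simp only; field_simp; ring
  have hder : ∀ y ∈ Ioo (0 : ℝ) 1, HasDerivWithinAt (fun y : ℝ => d * (y⁻¹ - 1))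
      (d * (-(y ^ 2)⁻¹)) (Ioo 0 1) y := fun y hy =>
    (((hasDerivAt_inv hy.1.ne').sub_const 1).const_mul d).hasDerivWithinAt
  have hinj : InjOn (fun y : ℝ => d * (y⁻¹ - 1)) (Ioo 0 1) := by
    intro y _ z _ h
    have := mul_left_cancel₀ hd.ne' h
    exact inv_injective (by linarith)
  rw [← him, integral_image_eq_integral_abs_deriv_smul measurableSet_Ioo hder hinj]
  have h1 := integral_rpow_mul_sub_rpow (a := 2 * α - 1) (b := 1 - α) (c := 1)
    (by linarith [hα.1]) (by linarith [hα.2]) one_pos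
  rw [Real.one_rpow, one_mul, intervalIntegral.integral_of_le zero_le_one,
    integral_Ioc_eq_integral_Ioo] at h1
  rw [← h1, ← integral_mul_const]
  refine setIntegral_congr_fun measurableSet_Ioo fun y hy => ?_
  have hy0 := hy.1
  have hy1 : 0 < 1 - y := by linarith [hy.2]
  have e1 : d * (y⁻¹ - 1) = d * (1 - y) * y⁻¹ := by field_simp
  have e2 : d * (y⁻¹ - 1) + d = d * y⁻¹ := by ring
  have e3 : |d * (-(y ^ 2)⁻¹)| = d * y⁻¹ ^ 2 := by
    rw [abs_mul, abs_neg, abs_of_pos hd, abs_of_pos (by positivity), inv_pow]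
  simp only [smul_eq_mul]
  rw [e1, e3, show d * (1 - y) * y⁻¹ + d = d * y⁻¹ by field_simp; ring,
    Real.mul_rpow (by positivity) (by positivity), Real.mul_rpow hd.le hy1.le,
    Real.mul_rpow hd.le (by positivity), ← Real.rpow_natCast y⁻¹ 2, Real.inv_rpow hy0.le,
    Real.inv_rpow hy0.le, ← Real.rpow_neg hy0.le, ← Real.rpow_neg hy0.le, neg_neg]
  have e4 : d ^ (1 - 2 * α) = d * d ^ (-α) * d ^ (-α) := by
    rw [show 1 - 2 * α = 1 + -α + -α by ring, Real.rpow_add hd, Real.rpow_add hd, Real.rpow_one]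
  have e5 : y ^ (2 * α - 1 - 1) = y ^ α * y ^ α * y ^ (-((2 : ℕ) : ℝ)) := by
    rw [← Real.rpow_add hy0, ← Real.rpow_add hy0]; congr 1; push_cast; ring
  rw [e4, e5, show 1 - α - 1 = -α by ring]
  ring

/-- The autocorrelation of the one-sided kernel is the symmetric Riesz kernel; this converts L²
norms of fractional integrals into Riesz forms. On the diagonal the integral diverges, hence s ≠ s'.
-/
lemma integral_ker_sub_mul_ker_sub {α : ℝ} (hα : α ∈ Ioo (1 / 2 : ℝ) 1) {s s' : ℝ} (h : s ≠ s') :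
    ∫ t, ker (1 - α) (t - s) * ker (1 - α) (t - s') =
      ProbabilityTheory.beta (2 * α - 1) (1 - α) * |s - s'| ^ (1 - 2 * α) := by
  wlog hlt : s' < s generalizing s s'
  · have := this h.symm (lt_of_le_of_ne (not_lt.1 hlt) h)
    rw [abs_sub_comm, ← this]
    simp_rw [mul_comm]
  have h0 : (fun t => ker (1 - α) (t - s) * ker (1 - α) (t - s')) =
      fun t => (Ioi (0 : ℝ)).indicator (fun x => x ^ (-α) * (x + (s - s')) ^ (-α)) (t - s) := by
    ext t
    by_cases ht : 0 < t - s
    · rw [indicator_of_mem (show t - s ∈ Ioi (0 : ℝ) from ht), ker_of_pos ht,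
        ker_of_pos (by linarith)]
      rw [show 1 - α - 1 = -α by ring, sub_add_sub_cancel]
    · rw [indicator_of_notMem (show t - s ∉ Ioi (0 : ℝ) from ht), ker_of_nonpos (not_lt.1 ht),
        zero_mul]
  rw [h0, integral_sub_right_eq_self
    ((Ioi (0 : ℝ)).indicator (fun x => x ^ (-α) * (x + (s - s')) ^ (-α))) s,
    integral_indicator measurableSet_Ioi, integral_rpow_mul_add_rpow hα (by linarith),
    abs_of_pos (by linarith)]

lemma integrable_ker_sub_mul_ker_sub {α : ℝ} (hα : α ∈ Ioo (1 / 2 : ℝ) 1) {s s' : ℝ}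
    (h : s ≠ s') : Integrable fun t => ker (1 - α) (t - s) * ker (1 - α) (t - s') := by
  refine Integrable.of_integral_ne_zero ?_
  rw [integral_ker_sub_mul_ker_sub hα h]
  exact ne_of_gt (mul_pos (ProbabilityTheory.beta_pos (by linarith [hα.1]) (by linarith [hα.2]))
    (Real.rpow_pos_of_pos (abs_pos.2 (sub_ne_zero.2 h)) _))

/-! ### Fubini for kernels, and integrability of powers -/

/-- Fubini for a nonnegative kernel with a known partial integral. -/
lemma integrable_kernel_mul {Y : Type*} [MeasurableSpace Y] {ν : Measure Y} [SFinite ν]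
    {k : ℝ → Y → ℝ} {k₁ g : Y → ℝ} (hk : Measurable (Function.uncurry k))
    (hk0 : ∀ τ y, 0 ≤ k τ y) (hint : ∀ᵐ y ∂ν, Integrable (fun τ => k τ y))
    (hval : ∀ᵐ y ∂ν, ∫ τ, k τ y = k₁ y) (hg : AEStronglyMeasurable g ν)
    (hkg : Integrable (fun y => k₁ y * g y) ν) :
    Integrable (fun z : ℝ × Y => k z.1 z.2 * g z.2) (volume.prod ν) := by
  have hm : AEStronglyMeasurable (fun z : ℝ × Y => k z.1 z.2 * g z.2) (volume.prod ν) :=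
    (hk.aestronglyMeasurable).mul hg.comp_snd
  rw [integrable_prod_iff' hm]
  refine ⟨hint.mono fun y hy => hy.mul_const (g y), ?_⟩
  refine hkg.norm.congr ?_
  filter_upwards [hval] with y hy
  have : ∀ τ, ‖k τ y * g y‖ = k τ y * ‖g y‖ := fun τ => by
    rw [norm_mul, Real.norm_of_nonneg (hk0 τ y)]
  simp only [this]
  rw [integral_mul_const, hy, norm_mul, Real.norm_of_nonneg]
  rw [← hy]
  exact integral_nonneg fun τ => hk0 τ y

lemma integral_kernel_mul {Y : Type*} [MeasurableSpace Y] {ν : Measure Y} [SFinite ν]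
    {k : ℝ → Y → ℝ} {k₁ g : Y → ℝ} (hk : Measurable (Function.uncurry k))
    (hk0 : ∀ τ y, 0 ≤ k τ y) (hint : ∀ᵐ y ∂ν, Integrable (fun τ => k τ y))
    (hval : ∀ᵐ y ∂ν, ∫ τ, k τ y = k₁ y) (hg : AEStronglyMeasurable g ν)
    (hkg : Integrable (fun y => k₁ y * g y) ν) :
    ∫ τ, ∫ y, k τ y * g y ∂ν = ∫ y, k₁ y * g y ∂ν := by
  have h := integrable_kernel_mul hk hk0 hint hval hg hkg
  rw [integral_integral_swap h]
  refine integral_congr_ae ?_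
  filter_upwards [hval] with y hy
  rw [integral_mul_const, hy]

lemma integrableOn_ker {γ : ℝ} (hγ : 0 < γ) (R : ℝ) : IntegrableOn (ker γ) (Iio R) := by
  have h : ker γ = (Ioi (0 : ℝ)).indicator (fun x => x ^ (γ - 1)) := by
    ext x; simp [ker, indicator]
  rw [h, integrableOn_indicator_iff measurableSet_Ioi, Ioi_inter_Iio]
  rcases le_or_gt R 0 with hR | hR
  · rw [Ioo_eq_empty (not_lt.2 hR)]; exact integrableOn_empty
  · exact ((intervalIntegrable_iff_integrableOn_Ioc_of_le hR.le).1
      (intervalIntegral.intervalIntegrable_rpow' (by linarith))).mono_set Ioo_subset_Ioc_self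

lemma integrableOn_abs_rpow {r : ℝ} (hr : -1 < r) (hr0 : r ≠ 0) (R : ℝ) :
    IntegrableOn (fun x : ℝ => |x| ^ r) (Ioo (-R) R) := by
  have h : (fun x : ℝ => |x| ^ r) = fun x => ker (r + 1) x + ker (r + 1) (-x) := by
    ext x; rw [ker_add_ker_neg (by simpa using hr0), add_sub_cancel_right]
  rw [h]
  refine IntegrableOn.add ((integrableOn_ker (by linarith) R).mono_set fun x hx => hx.2) ?_
  have h1 := (integrableOn_ker (γ := r + 1) (by linarith) R)
  rw [← integrable_indicator_iff measurableSet_Iio] at h1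
  have h2 := h1.comp_neg
  have h3 : (fun t : ℝ => (Iio R).indicator (ker (r + 1)) (-t)) =
      (Ioi (-R)).indicator fun x => ker (r + 1) (-x) := by
    ext x; simp only [indicator, mem_Iio, mem_Ioi, neg_lt]
  rw [h3, integrable_indicator_iff measurableSet_Ioi] at h2
  exact h2.mono_set fun x hx => hx.1

/-! ### The equilibrium density of an interval -/

/-- The value of the potential of the equilibrium density of an interval. -/
noncomputable def eqConst (α : ℝ) : ℝ := ∫ s : ℝ, |s| ^ (1 - 2 * α) / (1 + s ^ 2)

lemma integrable_abs_rpow_div {α : ℝ} (hα : α ∈ Ioo (1 / 2 : ℝ) 1) :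
    Integrable fun s : ℝ => |s| ^ (1 - 2 * α) / (1 + s ^ 2) := by
  have h1 := (integrableOn_abs_rpow (r := 1 - 2 * α) (by linarith [hα.2])
    (by linarith [hα.1]) 1).integrable_indicator measurableSet_Ioo
  refine (h1.add integrable_inv_one_add_sq).mono'
    (Measurable.aestronglyMeasurable (by fun_prop)) (.of_forall fun s => ?_)
  rw [Real.norm_of_nonneg (by positivity)]
  have hs : 0 < 1 + s ^ 2 := by positivity
  simp only [Pi.add_apply]
  by_cases h : s ∈ Ioo (-1 : ℝ) 1
  · rw [indicator_of_mem h]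
    have : |s| ^ (1 - 2 * α) / (1 + s ^ 2) ≤ |s| ^ (1 - 2 * α) :=
      div_le_self (by positivity) (by nlinarith [sq_nonneg s])
    have := inv_pos.2 hs
    linarith
  · rw [indicator_of_notMem h, zero_add, div_eq_mul_inv]
    have h2 : 1 ≤ |s| := by
      by_contra h3
      exact h (abs_lt.1 (not_le.1 h3))
    exact mul_le_of_le_one_left (inv_pos.2 hs).le
      (Real.rpow_le_one_of_one_le_of_nonpos h2 (by linarith [hα.1]))

lemma eqConst_pos {α : ℝ} (hα : α ∈ Ioo (1 / 2 : ℝ) 1) : 0 < eqConst α := by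
  refine (integral_pos_iff_support_of_nonneg (fun s => by positivity)
    (integrable_abs_rpow_div hα)).2 ?_
  refine lt_of_lt_of_le ?_ (measure_mono (s := Ioi (0 : ℝ)) fun s hs => ?_)
  · simp
  · have hs : 0 < s := hs
    exact (div_pos (Real.rpow_pos_of_pos (abs_pos.2 hs.ne') _) (by positivity)).ne'

/-- The substitution s = (y - x)/√(1 - y²) is an increasing bijection of (-1,1) onto the line. It
carries the integrand to an even function of s that does not involve x, minus an odd one that
integrates to zero. -/
lemma eqPotential_unit {α x : ℝ} (hα : α ∈ Ioo (1 / 2 : ℝ) 1) (hx : x ∈ Ioo (-1 : ℝ) 1) :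
    IntegrableOn (fun y : ℝ => |x - y| ^ (1 - 2 * α) * (1 - y ^ 2) ^ (α - 1)) (Ioo (-1) 1) ∧
    ∫ y in Ioo (-1 : ℝ) 1, |x - y| ^ (1 - 2 * α) * (1 - y ^ 2) ^ (α - 1) = eqConst α := by
  set φ : ℝ → ℝ := fun y => (y - x) / √(1 - y ^ 2) with hφ
  set φ' : ℝ → ℝ := fun y => (1 - x * y) / √(1 - y ^ 2) ^ 3 with hφ'
  have hq : ∀ y ∈ Ioo (-1 : ℝ) 1, 0 < 1 - y ^ 2 := fun y hy => by nlinarith [hy.1, hy.2]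
  have hr : ∀ y ∈ Ioo (-1 : ℝ) 1, 0 < 1 - x * y := fun y hy => by
    nlinarith [hy.1, hy.2, hx.1, hx.2, mul_pos (sub_pos.2 hy.2) (sub_pos.2 hx.2),
      mul_pos (sub_pos.2 hy.1) (sub_pos.2 hx.1), mul_pos (sub_pos.2 hy.2) (sub_pos.2 hx.1),
      mul_pos (sub_pos.2 hy.1) (sub_pos.2 hx.2)]
  have hder : ∀ y ∈ Ioo (-1 : ℝ) 1, HasDerivAt φ (φ' y) y := by
    intro y hy
    have h0 := Real.sqrt_pos.2 (hq y hy)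
    have h1 : HasDerivAt (fun y : ℝ => 1 - y ^ 2) (-(2 * y)) y := by
      simpa using (hasDerivAt_pow 2 y).const_sub 1
    have h2 := ((hasDerivAt_id y).sub_const x).div (h1.sqrt (hq y hy).ne') h0.ne'
    refine h2.congr_deriv ?_
    have h3 := Real.sq_sqrt (hq y hy).le
    simp only [hφ', id]
    field_simp
    rw [h3]; ring
  have hmono : StrictMonoOn φ (Ioo (-1) 1) := by
    refine strictMonoOn_of_deriv_pos (convex_Ioo _ _)
      (fun y hy => (hder y hy).continuousAt.continuousWithinAt) fun y hy => ?_
    rw [interior_Ioo] at hy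
    rw [(hder y hy).deriv]
    exact div_pos (hr y hy) (pow_pos (Real.sqrt_pos.2 (hq y hy)) 3)
  have hdisc : ∀ s : ℝ, 0 < 1 + s ^ 2 - x ^ 2 := fun s => by nlinarith [hq x hx, sq_nonneg s]
  have him : φ '' Ioo (-1) 1 = univ := by
    refine eq_univ_of_forall fun s => ?_
    -- Solving φ(y) = s is a quadratic equation in y with discriminant 4s²D²; the root chosen below
    -- is the one for which y - x has the sign of s.
    set D := √(1 + s ^ 2 - x ^ 2) with hD
    have hD0 : 0 < D := Real.sqrt_pos.2 (hdisc s)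
    have hD2 : D ^ 2 = 1 + s ^ 2 - x ^ 2 := Real.sq_sqrt (hdisc s).le
    have hs : 0 < 1 + s ^ 2 := by positivity
    have hxs : 0 < D - x * s := by
      have : (x * s) ^ 2 < D ^ 2 := by
        rw [hD2]; nlinarith [mul_pos (hq x hx) hs]
      linarith [abs_lt_of_sq_lt_sq this hD0.le, le_abs_self (x * s)]
    set y := (x + s * D) / (1 + s ^ 2) with hy
    have e1 : 1 - y ^ 2 = ((D - x * s) / (1 + s ^ 2)) ^ 2 := by
      rw [hy]; field_simp
      nlinarith [hD2]
    have e2 : y - x = s * ((D - x * s) / (1 + s ^ 2)) := by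
      rw [hy]; field_simp; ring
    have hpos : 0 < (D - x * s) / (1 + s ^ 2) := div_pos hxs hs
    have hy1 : y ^ 2 < 1 := by nlinarith [pow_pos hpos 2]
    refine ⟨y, abs_lt.1 ((sq_lt_one_iff_abs_lt_one y).1 hy1), ?_⟩
    simp only [hφ]
    rw [e1, Real.sqrt_sq hpos.le, e2, mul_div_cancel_right₀ s hpos.ne']
  set F : ℝ → ℝ := fun s => |s| ^ (1 - 2 * α) / (1 + s ^ 2) with hF
  -- The odd part: all the dependence on x sits here, and its integral is 0.
  set G : ℝ → ℝ := fun s => F s * (x * s / √(1 + s ^ 2 - x ^ 2)) with hG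
  have hFi : Integrable F := integrable_abs_rpow_div hα
  have hGi : Integrable G := by
    refine hFi.mul_bdd (c := 1) (Measurable.aestronglyMeasurable (by fun_prop))
      (.of_forall fun s => ?_)
    rw [norm_div, Real.norm_of_nonneg (Real.sqrt_nonneg _), div_le_one (Real.sqrt_pos.2 (hdisc s)),
      Real.norm_eq_abs]
    refine Real.abs_le_sqrt ?_
    nlinarith [hq x hx, sq_nonneg s, mul_nonneg (hq x hx).le (sq_nonneg s)]
  have hG0 : ∫ s, G s = 0 := by
    have h1 : ∫ s, G (-s) = ∫ s, G s := integral_neg_eq_self G volume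
    have h2 : ∀ s, G (-s) = - G s := fun s => by simp only [hG, hF, abs_neg, neg_sq]; ring
    simp_rw [h2, integral_neg] at h1
    linarith
  have key : ∀ y ∈ Ioo (-1 : ℝ) 1, |φ' y| • (F - G) (φ y) =
      |x - y| ^ (1 - 2 * α) * (1 - y ^ 2) ^ (α - 1) := by
    intro y hy
    set q := √(1 - y ^ 2) with hqd
    have hq0 : 0 < q := Real.sqrt_pos.2 (hq y hy)
    have hq2 : q ^ 2 = 1 - y ^ 2 := Real.sq_sqrt (hq y hy).le
    have hr0 := hr y hy
    have e1 : 1 + (φ y) ^ 2 - x ^ 2 = ((1 - x * y) / q) ^ 2 := by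
      simp only [hφ, ← hqd]; field_simp; rw [hq2]; ring
    have e2 : √(1 + (φ y) ^ 2 - x ^ 2) = (1 - x * y) / q := by
      rw [e1, Real.sqrt_sq (by positivity)]
    have e3 : |φ y| ^ (1 - 2 * α) = |x - y| ^ (1 - 2 * α) * q ^ (2 * α - 1) := by
      simp only [hφ, ← hqd]
      rw [abs_div, abs_of_pos hq0, Real.div_rpow (abs_nonneg _) hq0.le, abs_sub_comm,
        show 1 - 2 * α = -(2 * α - 1) by ring, Real.rpow_neg hq0.le, div_inv_eq_mul]
    have e4 : (1 - y ^ 2) ^ (α - 1) = q ^ (2 * α - 1) * q⁻¹ := by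
      rw [← hq2, ← Real.rpow_natCast q 2, ← Real.rpow_mul hq0.le, ← Real.rpow_neg_one q,
        ← Real.rpow_add hq0]
      congr 1; push_cast; ring
    have e5 : |φ' y| = (1 - x * y) / q ^ 3 := by
      simp only [hφ', ← hqd]; exact abs_of_pos (by positivity)
    have e6 : 1 + (φ y) ^ 2 = (1 - 2 * x * y + x ^ 2) / q ^ 2 := by
      simp only [hφ, ← hqd]; field_simp; rw [hq2]; ring
    have hne : 0 < 1 - 2 * x * y + x ^ 2 := by nlinarith [sq_nonneg (x - y), hq y hy]
    simp only [Pi.sub_apply, hG, smul_eq_mul, hF]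
    rw [e2, e5, e3, e4, e6]
    have e7 : 1 - x * (φ y) / ((1 - x * y) / q) = (1 - 2 * x * y + x ^ 2) / (1 - x * y) := by
      simp only [hφ, ← hqd]; field_simp; ring
    generalize |x - y| ^ (1 - 2 * α) = A
    generalize q ^ (2 * α - 1) = B
    rw [← mul_one_sub, e7]
    generalize 1 - 2 * x * y + x ^ 2 = N at hne
    field_simp
  have hi := (integrableOn_image_iff_integrableOn_abs_deriv_smul measurableSet_Ioo
    (fun y hy => (hder y hy).hasDerivWithinAt) hmono.injOn (F - G)).1
    ((hFi.sub hGi).integrableOn)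
  have hv := integral_image_eq_integral_abs_deriv_smul measurableSet_Ioo
    (fun y hy => (hder y hy).hasDerivWithinAt) hmono.injOn (F - G)
  refine ⟨hi.congr_fun key measurableSet_Ioo, ?_⟩
  rw [setIntegral_congr_fun measurableSet_Ioo key, him, setIntegral_univ] at hv
  rw [← hv, integral_sub' hFi hGi, hG0, sub_zero, eqConst]

/-- The equilibrium density of an interval has constant Riesz potential on it. -/
lemma eqPotential {α a b x : ℝ} (hα : α ∈ Ioo (1 / 2 : ℝ) 1) (hx : x ∈ Ioo a b) :
    IntegrableOn (fun y : ℝ => |x - y| ^ (1 - 2 * α) * ((y - a) * (b - y)) ^ (α - 1)) (Ioo a b) ∧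
    ∫ y in Ioo a b, |x - y| ^ (1 - 2 * α) * ((y - a) * (b - y)) ^ (α - 1) = eqConst α := by
  set l := (b - a) / 2 with hl
  have hl0 : 0 < l := by rw [hl]; linarith [hx.1, hx.2]
  set m := (a + b) / 2 with hm
  have him : (fun η : ℝ => l * η + m) '' Ioo (-1) 1 = Ioo a b := by
    ext y
    constructor
    · rintro ⟨z, hz, rfl⟩
      simp only [hl, hm, mem_Ioo]
      constructor <;> nlinarith [hz.1, hz.2]
    · intro hy
      refine ⟨(y - m) / l, ?_, by field_simp; ring⟩
      rw [mem_Ioo, lt_div_iff₀ hl0, div_lt_iff₀ hl0, hl, hm]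
      constructor <;> linarith [hy.1, hy.2]
  have hder : ∀ y ∈ Ioo (-1 : ℝ) 1, HasDerivWithinAt (fun η : ℝ => l * η + m) l (Ioo (-1) 1) y :=
    fun y _ => by
      simpa using (((hasDerivAt_id y).const_mul l).add_const m).hasDerivWithinAt
  have hinj : InjOn (fun η : ℝ => l * η + m) (Ioo (-1) 1) := fun y _ z _ h =>
    mul_left_cancel₀ hl0.ne' (add_right_cancel h)
  set X := (x - m) / l with hX
  have hXx : x = l * X + m := by rw [hX]; field_simp; ring
  have hX1 : X ∈ Ioo (-1 : ℝ) 1 := by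
    rw [hX, mem_Ioo, lt_div_iff₀ hl0, div_lt_iff₀ hl0, hl, hm]
    constructor <;> linarith [hx.1, hx.2]
  have key : ∀ y ∈ Ioo (-1 : ℝ) 1, |l| • (|x - (l * y + m)| ^ (1 - 2 * α) *
      ((l * y + m - a) * (b - (l * y + m))) ^ (α - 1)) =
      |X - y| ^ (1 - 2 * α) * (1 - y ^ 2) ^ (α - 1) := by
    intro y hy
    have h1 : 0 < 1 - y ^ 2 := by nlinarith [hy.1, hy.2]
    have e1 : x - (l * y + m) = l * (X - y) := by rw [hXx]; ring
    have e2 : (l * y + m - a) * (b - (l * y + m)) = l ^ 2 * (1 - y ^ 2) := by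
      rw [hl, hm]; ring
    -- The total homogeneity 1 + (1-2α) + 2(α-1) is zero, so the constant is the same for every
    -- interval.
    have e3 : l * (l ^ (1 - 2 * α) * (l ^ 2) ^ (α - 1)) = 1 := by
      rw [← Real.rpow_natCast l 2, ← Real.rpow_mul hl0.le, ← Real.rpow_add hl0]
      nth_rewrite 1 [← Real.rpow_one l]
      rw [← Real.rpow_add hl0, ← Real.rpow_zero l]
      congr 1; push_cast; ring
    rw [e1, e2, abs_mul, Real.mul_rpow (abs_nonneg _) (abs_nonneg _),
      Real.mul_rpow (by positivity) h1.le, abs_of_pos hl0, smul_eq_mul]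
    linear_combination (|X - y| ^ (1 - 2 * α) * (1 - y ^ 2) ^ (α - 1)) * e3
  obtain ⟨h1, h2⟩ := eqPotential_unit hα hX1
  have hi := integrableOn_image_iff_integrableOn_abs_deriv_smul measurableSet_Ioo hder hinj
    (fun y : ℝ => |x - y| ^ (1 - 2 * α) * ((y - a) * (b - y)) ^ (α - 1))
  have hv := integral_image_eq_integral_abs_deriv_smul measurableSet_Ioo hder hinj
    (fun y : ℝ => |x - y| ^ (1 - 2 * α) * ((y - a) * (b - y)) ^ (α - 1))
  rw [him] at hi hv
  exact ⟨hi.2 (h1.congr_fun (fun y hy => (key y hy).symm) measurableSet_Ioo),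
    by rw [hv, setIntegral_congr_fun measurableSet_Ioo key, h2]⟩

/-! ### The weight, and the Schur test for the Riesz form -/

/-- The weight `(t (T - t))^(α-1)` on `(0, T)`. -/
noncomputable def wt (T α : ℝ) : ℝ → ℝ :=
  (Ioo 0 T).indicator fun t => (t * (T - t)) ^ (α - 1)

section Weight

variable {T α : ℝ}

lemma wt_of_mem {t : ℝ} (ht : t ∈ Ioo 0 T) : wt T α t = (t * (T - t)) ^ (α - 1) :=
  indicator_of_mem ht _

lemma wt_of_notMem {t : ℝ} (ht : t ∉ Ioo 0 T) : wt T α t = 0 := indicator_of_notMem ht _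

lemma wt_pos {t : ℝ} (ht : t ∈ Ioo 0 T) : 0 < wt T α t := by
  rw [wt_of_mem ht]
  exact Real.rpow_pos_of_pos (mul_pos ht.1 (by linarith [ht.2])) _

lemma wt_nonneg (t : ℝ) : 0 ≤ wt T α t := by
  by_cases ht : t ∈ Ioo 0 T
  · exact (wt_pos ht).le
  · rw [wt_of_notMem ht]

@[fun_prop]
lemma measurable_wt : Measurable (wt T α) :=
  Measurable.indicator (by fun_prop) measurableSet_Ioo

lemma integrable_wt (hT : 0 < T) (hα : 0 < α) : Integrable (wt T α) := by
  have h := integral_rpow_mul_sub_rpow hα hα hT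
  have e : ∫ t, wt T α t = T ^ (α + α - 1) * ProbabilityTheory.beta α α := by
    rw [← h, intervalIntegral.integral_of_le hT.le, integral_Ioc_eq_integral_Ioo, wt,
      integral_indicator measurableSet_Ioo]
    exact setIntegral_congr_fun measurableSet_Ioo fun t ht =>
      Real.mul_rpow ht.1.le (by linarith [ht.2])
  refine Integrable.of_integral_ne_zero ?_
  rw [e]
  exact (mul_pos (Real.rpow_pos_of_pos hT _) (ProbabilityTheory.beta_pos hα hα)).ne'

lemma support_wt_mul_subset (g : ℝ → ℝ) : Function.support (fun t => wt T α t * g t) ⊆ Ioo 0 T := by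
  intro t ht
  by_contra h
  exact ht (by simp [wt_of_notMem h])

lemma integrable_wt_mul (hT : 0 < T) (hα : 0 < α) {g : ℝ → ℝ} (hg : ContinuousOn g (Icc 0 T)) :
    Integrable fun t => wt T α t * g t := by
  rw [← integrableOn_iff_integrable_of_support_subset
    ((support_wt_mul_subset g).trans Ioo_subset_Icc_self)]
  exact (integrable_wt hT hα).integrableOn.mul_continuousOn hg isCompact_Icc

lemma integral_wt_mul_eq (g : ℝ → ℝ) : ∫ t, wt T α t * g t = ∫ t in Ioo 0 T, wt T α t * g t :=
  (setIntegral_eq_integral_of_forall_compl_eq_zero fun t ht => by simp [wt_of_notMem ht]).symm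

lemma riesz_wt (hα : α ∈ Ioo (1 / 2 : ℝ) 1) {x : ℝ} (hx : x ∈ Ioo 0 T) :
    Integrable (fun y => |x - y| ^ (1 - 2 * α) * wt T α y) ∧
      ∫ y, |x - y| ^ (1 - 2 * α) * wt T α y = eqConst α := by
  obtain ⟨h1, h2⟩ := eqPotential hα hx
  have e : (fun y => |x - y| ^ (1 - 2 * α) * wt T α y) =
      (Ioo 0 T).indicator fun y => |x - y| ^ (1 - 2 * α) * ((y - 0) * (T - y)) ^ (α - 1) := by
    ext y
    by_cases hy : y ∈ Ioo 0 T
    · rw [indicator_of_mem hy, wt_of_mem hy, sub_zero]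
    · rw [indicator_of_notMem hy, wt_of_notMem hy, mul_zero]
  rw [e, integrable_indicator_iff measurableSet_Ioo, integral_indicator measurableSet_Ioo]
  exact ⟨h1, h2⟩

end Weight

/-- Weighted square integrability. -/
def MemWt (T α : ℝ) (p : ℝ → ℝ) : Prop :=
  AEStronglyMeasurable p ∧ Integrable fun t => wt T α t * p t ^ 2

section Schur

variable {T α : ℝ}

/-- Integrating in the first variable gives the potential of the weight, which is constant on (0,T).
Thus the weight is an exact Schur test function for the Riesz kernel. -/
lemma integrable_riesz_schur (hα : α ∈ Ioo (1 / 2 : ℝ) 1) {p : ℝ → ℝ} (hp : MemWt T α p) :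
    Integrable (fun z : ℝ × ℝ => |z.1 - z.2| ^ (1 - 2 * α) * wt T α z.1 *
      (wt T α z.2 * p z.2 ^ 2)) := by
  -- The indicator makes the partial integral known for every y; outside (0,T) the potential of the
  -- weight is not the constant.
  set k : ℝ → ℝ → ℝ := fun τ y =>
    (Ioo 0 T).indicator (fun y => |y - τ| ^ (1 - 2 * α) * wt T α τ) y with hk
  have hmeas : Measurable (Function.uncurry k) := by
    have : Function.uncurry k = (Prod.snd ⁻¹' (Ioo 0 T)).indicator
        (fun z : ℝ × ℝ => |z.2 - z.1| ^ (1 - 2 * α) * wt T α z.1) := by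
      ext z
      simp [Function.uncurry, hk, indicator]
    rw [this]
    exact Measurable.indicator (by fun_prop) (measurable_snd measurableSet_Ioo)
  have h := integrable_kernel_mul (ν := (volume : Measure ℝ)) (k := k)
    (k₁ := (Ioo 0 T).indicator fun _ => eqConst α) (g := fun y => wt T α y * p y ^ 2) hmeas
    (fun τ y => indicator_nonneg (fun y _ => mul_nonneg (by positivity) (wt_nonneg _)) y)
    (.of_forall fun y => ?_) (.of_forall fun y => ?_) hp.2.1 ?_
  · refine h.congr (.of_forall fun z => ?_)
    simp only [hk]
    by_cases hy : z.2 ∈ Ioo 0 T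
    · rw [indicator_of_mem hy, abs_sub_comm]
    · rw [wt_of_notMem hy]; simp
  · by_cases hy : y ∈ Ioo 0 T
    · simp only [hk, indicator_of_mem hy]; exact (riesz_wt hα hy).1
    · simp only [hk, indicator_of_notMem hy]; exact integrable_zero _ _ _
  · by_cases hy : y ∈ Ioo 0 T
    · simp only [hk, indicator_of_mem hy]; exact (riesz_wt hα hy).2
    · simp only [hk, indicator_of_notMem hy]; simp
  · refine (hp.2.const_mul (eqConst α)).congr (.of_forall fun y => ?_)
    by_cases hy : y ∈ Ioo 0 T
    · simp only [indicator_of_mem hy]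
    · simp only [indicator_of_notMem hy, wt_of_notMem hy]; simp

lemma integral_riesz_schur (hα : α ∈ Ioo (1 / 2 : ℝ) 1) {p : ℝ → ℝ} (hp : MemWt T α p) :
    ∫ z : ℝ × ℝ, |z.1 - z.2| ^ (1 - 2 * α) * wt T α z.1 * (wt T α z.2 * p z.2 ^ 2) =
      eqConst α * ∫ t, wt T α t * p t ^ 2 := by
  have h := integrable_riesz_schur hα hp
  rw [Measure.volume_eq_prod] at h ⊢
  rw [integral_prod_symm _ h, ← integral_const_mul]
  refine integral_congr_ae (.of_forall fun y => ?_)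
  simp only
  rw [integral_mul_const]
  by_cases hy : y ∈ Ioo 0 T
  · rw [← (riesz_wt hα hy).2]
    simp_rw [abs_sub_comm y]
  · rw [wt_of_notMem hy]; simp

/-- The inequality 2|p q| ≤ p² + q² splits a mixed term into the two Schur integrands. -/
lemma riesz_pair_bound (p q : ℝ → ℝ) (z : ℝ × ℝ) :
    |z.1 - z.2| ^ (1 - 2 * α) * |wt T α z.1 * p z.1| * |wt T α z.2 * q z.2| ≤
      (1 / 2) * (|z.1 - z.2| ^ (1 - 2 * α) * wt T α z.1 * (wt T α z.2 * q z.2 ^ 2) +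
        |z.2 - z.1| ^ (1 - 2 * α) * wt T α z.2 * (wt T α z.1 * p z.1 ^ 2)) := by
  rw [abs_mul, abs_mul, abs_of_nonneg (wt_nonneg z.1), abs_of_nonneg (wt_nonneg z.2),
    abs_sub_comm z.2]
  have h1 : 0 ≤ |z.1 - z.2| ^ (1 - 2 * α) * wt T α z.1 * wt T α z.2 :=
    mul_nonneg (mul_nonneg (by positivity) (wt_nonneg _)) (wt_nonneg _)
  nlinarith [mul_nonneg h1 (sq_nonneg (|p z.1| - |q z.2|)), sq_abs (p z.1), sq_abs (q z.2)]

lemma integrable_riesz_pair (hα : α ∈ Ioo (1 / 2 : ℝ) 1) {p q : ℝ → ℝ} (hp : MemWt T α p)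
    (hq : MemWt T α q) :
    Integrable (fun z : ℝ × ℝ => |z.1 - z.2| ^ (1 - 2 * α) *
      ((wt T α z.1 * p z.1) * (wt T α z.2 * q z.2))) := by
  have h1 := integrable_riesz_schur hα hq
  have h2 := (integrable_riesz_schur hα hp).swap
  refine ((h1.add h2).const_mul (1 / 2)).mono' ?_ (.of_forall fun z => ?_)
  · refine (Measurable.aestronglyMeasurable (by fun_prop)).mul ?_
    refine AEStronglyMeasurable.mul ?_ ?_
    · exact (measurable_wt.aestronglyMeasurable.mul hp.1).comp_fst
    · exact (measurable_wt.aestronglyMeasurable.mul hq.1).comp_snd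
  · refine le_trans (le_of_eq ?_) (riesz_pair_bound (T := T) (α := α) p q z)
    rw [Real.norm_eq_abs, abs_mul, abs_mul (wt T α z.1 * p z.1),
      abs_of_nonneg (Real.rpow_nonneg (abs_nonneg (z.1 - z.2)) (1 - 2 * α)),
      ← mul_assoc]

/-- Both Schur integrands have the same integral, by exchanging the variables, so the Riesz form is
bounded on weighted L² with constant `eqConst α`. -/
lemma integral_riesz_abs_le (hα : α ∈ Ioo (1 / 2 : ℝ) 1) {p : ℝ → ℝ} (hp : MemWt T α p) :
    ∫ z : ℝ × ℝ, |z.1 - z.2| ^ (1 - 2 * α) * |(wt T α z.1 * p z.1) * (wt T α z.2 * p z.2)| ≤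
      eqConst α * ∫ t, wt T α t * p t ^ 2 := by
  have h1 := integrable_riesz_schur hα hp
  have h2 := h1.swap
  have h3 := integral_riesz_schur hα hp
  have h4 : ∫ z : ℝ × ℝ, |z.2 - z.1| ^ (1 - 2 * α) * wt T α z.2 * (wt T α z.1 * p z.1 ^ 2) =
      eqConst α * ∫ t, wt T α t * p t ^ 2 := by
    rw [← h3, Measure.volume_eq_prod]
    exact integral_prod_swap (μ := (volume : Measure ℝ)) (ν := (volume : Measure ℝ))
      (fun z : ℝ × ℝ => |z.1 - z.2| ^ (1 - 2 * α) * wt T α z.1 * (wt T α z.2 * p z.2 ^ 2))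
  calc _ ≤ ∫ z : ℝ × ℝ, (1 / 2) *
        (|z.1 - z.2| ^ (1 - 2 * α) * wt T α z.1 * (wt T α z.2 * p z.2 ^ 2) +
        |z.2 - z.1| ^ (1 - 2 * α) * wt T α z.2 * (wt T α z.1 * p z.1 ^ 2)) := by
        refine integral_mono ?_ ((h1.add h2).const_mul (1 / 2)) fun z => ?_
        · refine (integrable_riesz_pair hα hp hp).norm.congr (.of_forall fun z => ?_)
          simp only [norm_mul, Real.norm_eq_abs, abs_mul]
          rw [abs_of_nonneg (Real.rpow_nonneg (abs_nonneg (z.1 - z.2)) (1 - 2 * α))]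
        · rw [abs_mul (wt T α z.1 * p z.1), ← mul_assoc]
          exact riesz_pair_bound (T := T) (α := α) p p z
    _ = _ := by
        rw [integral_const_mul]
        erw [integral_add h1 h2]
        simp only [Function.comp, Prod.fst_swap, Prod.snd_swap]
        rw [h3, h4]; ring

end Schur

lemma MemWt.integrable {T α : ℝ} (hT : 0 < T) (hα : 0 < α) {p : ℝ → ℝ} (hp : MemWt T α p) :
    Integrable fun t => wt T α t * p t := by
  refine ((integrable_wt hT hα).add hp.2).mono' (measurable_wt.aestronglyMeasurable.mul hp.1)
    (.of_forall fun t => ?_)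
  rw [norm_mul, Real.norm_of_nonneg (wt_nonneg t), Real.norm_eq_abs, Pi.add_apply]
  have := wt_nonneg (T := T) (α := α) t
  nlinarith [mul_nonneg this (sq_nonneg (|p t| - 1)), sq_abs (p t),
    mul_nonneg this (sq_nonneg (p t))]

lemma MemWt.of_continuousOn {T α : ℝ} (hT : 0 < T) (hα : 0 < α) {p : ℝ → ℝ}
    (hp : Continuous p) : MemWt T α p :=
  ⟨hp.aestronglyMeasurable, integrable_wt_mul hT hα (by fun_prop)⟩

lemma MemWt.add {T α : ℝ} {p q : ℝ → ℝ} (hp : MemWt T α p) (hq : MemWt T α q) :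
    MemWt T α fun t => p t + q t := by
  refine ⟨hp.1.add hq.1, ((hp.2.add hq.2).const_mul 2).mono' (measurable_wt.aestronglyMeasurable.mul
    ((hp.1.add hq.1).pow 2)) (.of_forall fun t => ?_)⟩
  rw [Real.norm_of_nonneg (mul_nonneg (wt_nonneg t) (sq_nonneg _))]
  simp only [Pi.add_apply]
  nlinarith [mul_nonneg (wt_nonneg (T := T) (α := α) t) (sq_nonneg (p t - q t))]

lemma MemWt.const_mul {T α : ℝ} {p : ℝ → ℝ} (hp : MemWt T α p) (c : ℝ) :
    MemWt T α fun t => c * p t := by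
  refine ⟨hp.1.const_mul c, (hp.2.const_mul (c ^ 2)).congr (.of_forall fun t => ?_)⟩
  simp only; ring

/-! ### Triangular maps on polynomials -/

open Polynomial in
/-- The antiderivative of a polynomial without constant term. -/
noncomputable def polyPrim : ℝ[X] →ₗ[ℝ] ℝ[X] :=
  Polynomial.lsum fun n => (1 / ((n : ℝ) + 1)) • monomial (n + 1)

open Polynomial in
lemma polyPrim_monomial (n : ℕ) (a : ℝ) :
    polyPrim (monomial n a) = monomial (n + 1) (a / (n + 1)) := by
  simp [polyPrim, Polynomial.lsum, sum_monomial_index, smul_monomial]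
  congr 1; ring

open Polynomial in
lemma derivative_polyPrim (p : ℝ[X]) : derivative (polyPrim p) = p := by
  induction p using Polynomial.induction_on' with
  | add p q hp hq => rw [map_add, map_add, hp, hq]
  | monomial n a =>
    rw [polyPrim_monomial, derivative_monomial]
    have : (n : ℝ) + 1 ≠ 0 := by positivity
    simp [div_mul_cancel₀ _ this]

open Polynomial in
lemma monomial_mem_degreeLT {m n : ℕ} (h : m < n) (a : ℝ) : monomial m a ∈ degreeLT ℝ n := by
  rw [mem_degreeLT]
  exact lt_of_le_of_lt (degree_monomial_le m a) (by exact_mod_cast h)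

open Polynomial in
/-- Linear maps are determined on polynomials of bounded degree by monomials. -/
lemma map_mem_of_monomial {V : Submodule ℝ ℝ[X]} (S : ℝ[X] →ₗ[ℝ] ℝ[X]) {n : ℕ}
    (h : ∀ m < n, S (X ^ m) ∈ V) {p : ℝ[X]} (hp : p ∈ degreeLT ℝ n) : S p ∈ V := by
  classical
  rw [degreeLT_eq_span_X_pow] at hp
  have : Submodule.span ℝ ((Finset.range n).image fun n => X ^ n : Finset ℝ[X]) ≤ V.comap S := by
    rw [Submodule.span_le]
    intro q hq
    simp only [Finset.coe_image, Set.mem_image, Finset.mem_coe, Finset.mem_range] at hq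
    obtain ⟨m, hm, rfl⟩ := hq
    exact h m hm
  exact this hp

open Polynomial in
lemma polyPrim_mem {n : ℕ} {p : ℝ[X]} (hp : p ∈ degreeLT ℝ n) :
    polyPrim p ∈ degreeLT ℝ (n + 1) := by
  refine map_mem_of_monomial polyPrim (fun m hm => ?_) hp
  rw [← monomial_one_right_eq_X_pow, polyPrim_monomial]
  exact monomial_mem_degreeLT (by omega) _

/-- `S` acts on polynomials as an upper triangular map with diagonal `c`. -/
def IsTri (S : Polynomial ℝ →ₗ[ℝ] Polynomial ℝ) (c : ℕ → ℝ) : Prop :=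
  ∀ n, S (Polynomial.X ^ n) - c n • Polynomial.X ^ n ∈ Polynomial.degreeLT ℝ n

open Polynomial in
-- Subtracting c n cancels the diagonal entry in top degree; lower monomials already stay below
-- degree n, whatever their own diagonal entries are.
lemma IsTri.sub_mem {S : ℝ[X] →ₗ[ℝ] ℝ[X]} {c : ℕ → ℝ} (h : IsTri S c) {n : ℕ} {p : ℝ[X]}
    (hp : p ∈ degreeLT ℝ (n + 1)) : S p - c n • p ∈ degreeLT ℝ n := by
  refine map_mem_of_monomial (S - c n • LinearMap.id) (fun m hm => ?_) hp
  have hX : ∀ m < n, (X ^ m : ℝ[X]) ∈ degreeLT ℝ n := fun m hm => by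
    rw [← monomial_one_right_eq_X_pow]; exact monomial_mem_degreeLT hm _
  rcases Nat.lt_succ_iff_lt_or_eq.1 hm with hm | rfl
  · have h1 : (S - c n • LinearMap.id : ℝ[X] →ₗ[ℝ] ℝ[X]) (X ^ m) =
        (S (X ^ m) - c m • X ^ m) + (c m - c n) • X ^ m := by
      simp [sub_smul]
    rw [h1]
    exact Submodule.add_mem _ (degreeLT_mono hm.le (h m)) (Submodule.smul_mem _ _ (hX m hm))
  · exact h m

open Polynomial in
lemma IsTri.map_mem {S : ℝ[X] →ₗ[ℝ] ℝ[X]} {c : ℕ → ℝ} (h : IsTri S c) {n : ℕ} {p : ℝ[X]}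
    (hp : p ∈ degreeLT ℝ n) : S p ∈ degreeLT ℝ n := by
  rcases n with _ | n
  · have : p = 0 := by
      rw [mem_degreeLT] at hp
      by_contra h
      rw [degree_eq_natDegree h] at hp
      norm_cast at hp
    subst this; simp
  · have := Submodule.add_mem _ (degreeLT_mono (Nat.le_succ n) (h.sub_mem hp))
      (Submodule.smul_mem _ (c n) hp)
    simpa using this

/-! ### The Riesz potential of weighted polynomials -/

section Riesz

open Polynomial

variable {T α : ℝ}

lemma riesz_integrable_mul (hα : α ∈ Ioo (1 / 2 : ℝ) 1) {x : ℝ} (hx : x ∈ Ioo 0 T) {g : ℝ → ℝ}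
    (hg : Continuous g) : Integrable fun y => |x - y| ^ (1 - 2 * α) * (wt T α y * g y) := by
  have h : Integrable fun y => (|x - y| ^ (1 - 2 * α) * wt T α y) * g y := by
    rw [← integrableOn_iff_integrable_of_support_subset (s := Icc 0 T)]
    · exact (riesz_wt hα hx).1.integrableOn.mul_continuousOn hg.continuousOn isCompact_Icc
    · intro y hy
      by_contra h
      exact hy (by simp [wt_of_notMem (fun h' => h (Ioo_subset_Icc_self h'))])
  exact h.congr (.of_forall fun y => mul_assoc _ _ _)

lemma integral_abs_rpow (hα : α ∈ Ioo (1 / 2 : ℝ) 1) (a b s : ℝ) :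
    (2 - 2 * α) * ∫ x in a..b, |x - s| ^ (1 - 2 * α) =
      (b - s) * |b - s| ^ (1 - 2 * α) - (a - s) * |a - s| ^ (1 - 2 * α) := by
  have hβ : 0 < 2 - 2 * α := by linarith [hα.2]
  -- This is (x-s)|x-s|^(1-2α), written so that continuity at s is visible. It has no finite
  -- derivative at s, so the fundamental theorem is applied off one point.
  set F : ℝ → ℝ := fun x => max (x - s) 0 ^ (2 - 2 * α) - max (s - x) 0 ^ (2 - 2 * α) with hF
  have hFe : ∀ x, F x = (x - s) * |x - s| ^ (1 - 2 * α) := by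
    intro x
    simp only [hF]
    rcases lt_trichotomy x s with h | h | h
    · rw [max_eq_right (by linarith), max_eq_left (by linarith), Real.zero_rpow hβ.ne',
        abs_of_neg (by linarith), show 2 - 2 * α = 1 + (1 - 2 * α) by ring,
        Real.rpow_add (by linarith), Real.rpow_one, neg_sub]
      ring
    · subst h; simp [Real.zero_rpow hβ.ne']
    · rw [max_eq_left (by linarith), max_eq_right (by linarith), Real.zero_rpow hβ.ne',
        abs_of_pos (by linarith), show 2 - 2 * α = 1 + (1 - 2 * α) by ring,
        Real.rpow_add (by linarith), Real.rpow_one]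
      ring
  have hcont : Continuous F := by
    refine Continuous.sub ?_ ?_
    · exact (by fun_prop : Continuous fun x => max (x - s) 0).rpow_const fun x => Or.inr hβ.le
    · exact (by fun_prop : Continuous fun x => max (s - x) 0).rpow_const fun x => Or.inr hβ.le
  have hder : ∀ x ∈ Ioo (min a b) (max a b) \ {s},
      HasDerivAt F ((2 - 2 * α) * |x - s| ^ (1 - 2 * α)) x := by
    intro x hx
    have hne : x ≠ s := fun h => hx.2 h
    rcases lt_or_gt_of_ne hne with h | h
    · have h1 : HasDerivAt (fun x => -(s - x) ^ (2 - 2 * α))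
          (-(-1 * (2 - 2 * α) * (s - x) ^ (2 - 2 * α - 1))) x :=
        (((hasDerivAt_id x).const_sub s).rpow_const (Or.inl (by simp only [id]; linarith))).neg
      refine (h1.congr_deriv ?_).congr_of_eventuallyEq ?_
      · rw [abs_of_neg (by linarith), neg_sub, show 2 - 2 * α - 1 = 1 - 2 * α by ring]; ring
      · filter_upwards [gt_mem_nhds h] with y hy
        simp only [hF]
        rw [max_eq_right (by linarith), max_eq_left (by linarith), Real.zero_rpow hβ.ne', zero_sub]
    · have h1 : HasDerivAt (fun x => (x - s) ^ (2 - 2 * α))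
          (1 * (2 - 2 * α) * (x - s) ^ (2 - 2 * α - 1)) x :=
        ((hasDerivAt_id x).sub_const s).rpow_const (Or.inl (by simp only [id]; linarith))
      refine (h1.congr_deriv ?_).congr_of_eventuallyEq ?_
      · rw [abs_of_pos (by linarith), show 2 - 2 * α - 1 = 1 - 2 * α by ring]; ring
      · filter_upwards [lt_mem_nhds h] with y hy
        simp only [hF]
        rw [max_eq_right (a := s - y) (by linarith), max_eq_left (by linarith),
          Real.zero_rpow hβ.ne', sub_zero]
  have hint : IntervalIntegrable (fun x => (2 - 2 * α) * |x - s| ^ (1 - 2 * α)) volume a b := by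
    refine IntervalIntegrable.const_mul ?_ _
    set R := |a - s| + |b - s| + 1
    have h1 := (integrableOn_abs_rpow (r := 1 - 2 * α) (by linarith) (by linarith [hα.1])
      R).integrable_indicator measurableSet_Ioo
    have h2 := (h1.comp_sub_right s).intervalIntegrable (a := a) (b := b)
    refine h2.congr fun x hx => ?_
    have hx' := uIoc_subset_uIcc hx
    rw [mem_uIcc] at hx'
    rw [indicator_of_mem]
    have := le_abs_self (a - s); have := le_abs_self (b - s)
    have := neg_abs_le (a - s); have := neg_abs_le (b - s)
    have := abs_nonneg (a - s); have := abs_nonneg (b - s)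
    constructor <;> rcases hx' with hx' | hx' <;> linarith [hx'.1, hx'.2]
  have h := integral_eq_of_hasDerivAt_off_countable F _ (countable_singleton s)
    hcont.continuousOn hder hint
  rw [intervalIntegral.integral_const_mul, hFe, hFe] at h
  exact h

/-- Multiplication by `X` under the Riesz potential of weighted polynomials. -/
lemma riesz_mul_X (hα : α ∈ Ioo (1 / 2 : ℝ) 1) (hT : 0 < T) {p v : ℝ[X]}
    (hv : ∀ x ∈ Ioo 0 T, ∫ y, |x - y| ^ (1 - 2 * α) * (wt T α y * p.eval y) = v.eval x) :
    ∃ c : ℝ, ∀ x ∈ Ioo 0 T, ∫ y, |x - y| ^ (1 - 2 * α) * (wt T α y * (X * p).eval y) =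
      (X * v - (2 - 2 * α) • polyPrim v + C c).eval x := by
  set x₀ := T / 2
  have hx₀ : x₀ ∈ Ioo 0 T := ⟨by positivity, by simp only [x₀]; linarith⟩
  set N : ℝ → ℝ := fun x => ∫ y, |x - y| ^ (1 - 2 * α) * (wt T α y * ((y - x) * p.eval y)) with hN
  -- Since (y-x)|x-y|^(1-2α) has x-derivative -(2-2α)|x-y|^(1-2α), N' is -(2-2α) times the potential
  -- v. The integrated form is proved by Fubini, which avoids differentiating under a singular
  -- integral.
  have hsub : ∀ x ∈ Ioo 0 T, N x₀ - N x = (2 - 2 * α) * ∫ ξ in x₀..x, v.eval ξ := by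
    intro x hx
    have hsub : uIoc x₀ x ⊆ Ioo 0 T := uIoc_subset_uIcc.trans
      ((convex_Ioo 0 T).ordConnected.uIcc_subset hx₀ hx)
    have hprod : Integrable (Function.uncurry fun ξ y =>
        |ξ - y| ^ (1 - 2 * α) * (wt T α y * p.eval y))
        ((volume.restrict (uIoc x₀ x)).prod volume) := by
      obtain ⟨B, hB⟩ := isCompact_Icc.exists_bound_of_continuousOn
        (p.continuous.continuousOn (s := Icc 0 T))
      have hm : Measurable (Function.uncurry fun ξ y =>
          |ξ - y| ^ (1 - 2 * α) * (wt T α y * p.eval y)) := by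
        have : Measurable fun y => p.eval y := p.continuous.measurable
        simp only [Function.uncurry_def]; fun_prop
      rw [integrable_prod_iff hm.aestronglyMeasurable]
      have hmem : ∀ᵐ ξ ∂(volume.restrict (uIoc x₀ x)), ξ ∈ Ioo 0 T :=
        (ae_restrict_mem measurableSet_uIoc).mono fun ξ hξ => hsub hξ
      refine ⟨hmem.mono fun ξ hξ => riesz_integrable_mul hα hξ p.continuous, ?_⟩
      have : IsFiniteMeasure (volume.restrict (uIoc x₀ x)) :=
        ⟨by
          rw [Measure.restrict_apply_univ]
          exact (measure_mono uIoc_subset_uIcc).trans_lt isCompact_uIcc.measure_lt_top⟩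
      refine Integrable.of_bound (C := B * eqConst α)
        (hm.norm.aestronglyMeasurable.integral_prod_right' (f := fun z : ℝ × ℝ =>
          ‖Function.uncurry (fun ξ y => |ξ - y| ^ (1 - 2 * α) * (wt T α y * p.eval y)) z‖)) ?_
      refine hmem.mono fun ξ hξ => ?_
      rw [Real.norm_of_nonneg (integral_nonneg fun y => norm_nonneg _), ← (riesz_wt hα hξ).2,
        ← integral_const_mul]
      refine integral_mono (riesz_integrable_mul hα hξ p.continuous).norm
        ((riesz_wt hα hξ).1.const_mul B) fun y => ?_
      simp only [Function.uncurry]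
      rw [norm_mul, norm_mul, Real.norm_of_nonneg (wt_nonneg y),
        Real.norm_of_nonneg (by positivity)]
      by_cases hy : y ∈ Ioo 0 T
      · calc _ = (|ξ - y| ^ (1 - 2 * α) * wt T α y) * ‖p.eval y‖ := by ring
          _ ≤ (|ξ - y| ^ (1 - 2 * α) * wt T α y) * B :=
            mul_le_mul_of_nonneg_left (hB y (Ioo_subset_Icc_self hy))
              (mul_nonneg (by positivity) (wt_nonneg y))
          _ = _ := by ring
      · rw [wt_of_notMem hy]; simp
    have hsw := intervalIntegral_integral_swap hprod
    rw [show ∫ ξ in x₀..x, v.eval ξ =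
      ∫ ξ in x₀..x, ∫ y, |ξ - y| ^ (1 - 2 * α) * (wt T α y * p.eval y) from
      intervalIntegral.integral_congr_ae (.of_forall fun ξ hξ => (hv ξ (hsub hξ)).symm), hsw,
      ← integral_const_mul]
    simp only [hN]
    have i1 : Integrable fun y => |x₀ - y| ^ (1 - 2 * α) * (wt T α y * ((y - x₀) * p.eval y)) :=
      riesz_integrable_mul hα hx₀ (by have := p.continuous; fun_prop)
    have i2 : Integrable fun y => |x - y| ^ (1 - 2 * α) * (wt T α y * ((y - x) * p.eval y)) :=
      riesz_integrable_mul hα hx (by have := p.continuous; fun_prop)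
    rw [← integral_sub i1 i2]
    refine integral_congr_ae (.of_forall fun y => ?_)
    simp only
    rw [intervalIntegral.integral_mul_const]
    linear_combination -(wt T α y * p.eval y) * integral_abs_rpow hα x₀ x y
  have hprim : ∀ x, ∫ ξ in x₀..x, v.eval ξ = (polyPrim v).eval x - (polyPrim v).eval x₀ := by
    intro x
    refine intervalIntegral.integral_eq_sub_of_hasDerivAt
      (f := fun ξ => (polyPrim v).eval ξ) (fun ξ _ => ?_)
      (v.continuous.intervalIntegrable _ _)
    have := (polyPrim v).hasDerivAt ξ
    rwa [derivative_polyPrim] at this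
  refine ⟨N x₀ + (2 - 2 * α) * (polyPrim v).eval x₀, fun x hx => ?_⟩
  -- Writing y = x + (y - x) separates x v(x) from N(x).
  have e1 : ∫ y, |x - y| ^ (1 - 2 * α) * (wt T α y * (X * p).eval y) = x * v.eval x + N x := by
    rw [← hv x hx, ← integral_const_mul]
    simp only [hN]
    rw [← integral_add ((riesz_integrable_mul hα hx p.continuous).const_mul x)
      (riesz_integrable_mul hα hx (by have := p.continuous; fun_prop))]
    refine integral_congr_ae (.of_forall fun y => ?_)
    simp only [eval_mul, eval_X]; ring
  have := hsub x hx
  rw [hprim] at this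
  rw [e1]
  simp only [eval_add, eval_sub, eval_mul, eval_X, eval_smul, eval_C, smul_eq_mul]
  linarith

end Riesz

/-! ### The principal operator on weighted polynomials -/

/-- The principal operator of the boundary value problem acting on the derivative. -/
noncomputable def Aop (α : ℝ) (g : ℝ → ℝ) (x : ℝ) : ℝ :=
  if α = 1 then 2 * g x
  else 1 / Real.Gamma (2 - 2 * α) * ∫ y, |x - y| ^ (1 - 2 * α) * g y

/-- The eigenvalues of half the principal operator on weighted orthogonal polynomials. -/
noncomputable def lam (α : ℝ) : ℕ → ℝ
  | 0 => if α = 1 then 1 else eqConst α / (2 * Real.Gamma (2 - 2 * α))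
  | n + 1 => lam α n * (n + 2 * α - 1) / (n + 1)

lemma lam_pos {α : ℝ} (hα : α ∈ Ioc (1 / 2 : ℝ) 1) (n : ℕ) : 0 < lam α n := by
  induction n with
  | zero =>
    unfold lam
    split_ifs with h
    · exact one_pos
    · have h1 : α < 1 := lt_of_le_of_ne hα.2 h
      exact div_pos (eqConst_pos ⟨hα.1, h1⟩)
        (mul_pos two_pos (Real.Gamma_pos_of_pos (by linarith)))
  | succ n ih =>
    unfold lam
    have : (0 : ℝ) ≤ n := n.cast_nonneg
    exact div_pos (mul_pos ih (by linarith [hα.1])) (by positivity)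

section AopPoly

open Polynomial

variable {T α : ℝ}

/-- Induction by `riesz_mul_X`: passing from degree n to n + 1 multiplies the leading coefficient by
1 - (2-2α)/(n+1) = (n+2α-1)/(n+1), the recursion defining `lam`. -/
lemma exists_riesz_monomial (hα : α ∈ Ioo (1 / 2 : ℝ) 1) (hT : 0 < T) (n : ℕ) :
    ∃ v : ℝ[X], (v - (2 * Real.Gamma (2 - 2 * α) * lam α n) • X ^ n ∈ degreeLT ℝ n) ∧
      ∀ x ∈ Ioo 0 T, ∫ y, |x - y| ^ (1 - 2 * α) * (wt T α y * (X ^ n : ℝ[X]).eval y) =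
        v.eval x := by
  have hΓ : 0 < Real.Gamma (2 - 2 * α) := Real.Gamma_pos_of_pos (by linarith [hα.2])
  induction n with
  | zero =>
    refine ⟨C (eqConst α), ?_, fun x hx => ?_⟩
    · have : 2 * Real.Gamma (2 - 2 * α) * lam α 0 = eqConst α := by
        rw [lam, if_neg hα.2.ne]
        generalize Real.Gamma (2 - 2 * α) = Γ at hΓ ⊢
        field_simp
      rw [this, pow_zero, smul_eq_C_mul, mul_one, sub_self]
      exact Submodule.zero_mem _
    · simp only [pow_zero, eval_one, mul_one, eval_C]
      exact (riesz_wt hα hx).2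
  | succ n ih =>
    obtain ⟨v, hv1, hv2⟩ := ih
    obtain ⟨c, hc⟩ := riesz_mul_X hα hT hv2
    refine ⟨_, ?_, fun x hx => by rw [pow_succ']; exact hc x hx⟩
    set r := v - (2 * Real.Gamma (2 - 2 * α) * lam α n) • X ^ n with hr
    have hv : v = r + (2 * Real.Gamma (2 - 2 * α) * lam α n) • X ^ n := by rw [hr]; ring
    have hXn : polyPrim (X ^ n) = (1 / ((n : ℝ) + 1)) • X ^ (n + 1) := by
      rw [← monomial_one_right_eq_X_pow, polyPrim_monomial, ← monomial_one_right_eq_X_pow,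
        smul_monomial]; simp
    have e : X * v - (2 - 2 * α) • polyPrim v + C c -
        (2 * Real.Gamma (2 - 2 * α) * lam α (n + 1)) • X ^ (n + 1) =
        X * r - (2 - 2 * α) • polyPrim r + C c := by
      have h1 : (n : ℝ) + 1 ≠ 0 := by positivity
      have h2 : 2 * Real.Gamma (2 - 2 * α) * lam α (n + 1) =
          2 * Real.Gamma (2 - 2 * α) * lam α n - (2 - 2 * α) *
            (2 * Real.Gamma (2 - 2 * α) * lam α n * (1 / (n + 1))) := by
        rw [lam]; field_simp; ring
      rw [h2, hv, map_add, map_smul, hXn]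
      simp only [smul_eq_C_mul, map_sub, map_mul, pow_succ']
      ring
    rw [e]
    refine Submodule.add_mem _ (Submodule.sub_mem _ ?_ (Submodule.smul_mem _ _
      (polyPrim_mem hv1))) ?_
    · rw [mem_degreeLT] at hv1 ⊢
      by_cases h0 : r = 0
      · rw [h0, mul_zero, degree_zero]; exact WithBot.bot_lt_coe _
      · rw [degree_mul, degree_X]
        rw [degree_eq_natDegree h0] at hv1 ⊢
        norm_cast at hv1 ⊢
        omega
    · exact monomial_mem_degreeLT (Nat.succ_pos n) c

/-- Half the principal operator preserves weighted polynomials and is triangular there. -/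
lemma exists_Aop_poly (hα : α ∈ Ioc (1 / 2 : ℝ) 1) (hT : 0 < T) :
    ∃ K : ℝ[X] →ₗ[ℝ] ℝ[X], IsTri K (lam α) ∧ ∀ p : ℝ[X], ∀ x ∈ Ioo 0 T,
      Aop α (fun y => wt T α y * p.eval y) x = 2 * (K p).eval x := by
  by_cases h : α = 1
  · subst h
    have hl : ∀ n, lam 1 n = 1 := by
      intro n
      induction n with
      | zero => simp [lam]
      | succ n ih =>
        rw [lam, ih]
        have : (n : ℝ) + 1 ≠ 0 := by positivity
        field_simp; ring
    refine ⟨LinearMap.id, fun n => ?_, fun p x hx => ?_⟩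
    · rw [hl]; simp
    · rw [Aop, if_pos rfl, wt_of_mem hx]; simp
  · have hα' : α ∈ Ioo (1 / 2 : ℝ) 1 := ⟨hα.1, lt_of_le_of_ne hα.2 h⟩
    have hΓ : 0 < Real.Gamma (2 - 2 * α) := Real.Gamma_pos_of_pos (by linarith [hα'.2])
    choose v hv1 hv2 using exists_riesz_monomial (T := T) hα' hT
    set c := 1 / (2 * Real.Gamma (2 - 2 * α)) with hc
    set K : ℝ[X] →ₗ[ℝ] ℝ[X] :=
      Polynomial.lsum fun n => (LinearMap.toSpanSingleton ℝ ℝ[X] (c • v n)) with hK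
    have hKm : ∀ n a, K (monomial n a) = (a * c) • v n := by
      intro n a
      simp [hK, Polynomial.lsum, sum_monomial_index, mul_smul]
    refine ⟨K, fun n => ?_, fun p x hx => ?_⟩
    · rw [← monomial_one_right_eq_X_pow, hKm, monomial_one_right_eq_X_pow]
      have := Submodule.smul_mem _ c (hv1 n)
      rw [smul_sub, smul_smul] at this
      convert this using 3
      · rw [one_mul]
      · rw [hc]
        generalize Real.Gamma (2 - 2 * α) = Γ at hΓ ⊢
        field_simp
    · rw [Aop, if_neg h]
      induction p using Polynomial.induction_on' with
      | add p q hp hq =>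
        rw [map_add, eval_add, mul_add, ← hp, ← hq, ← mul_add,
          ← integral_add (riesz_integrable_mul hα' hx p.continuous)
            (riesz_integrable_mul hα' hx q.continuous)]
        congr 1
        refine integral_congr_ae (.of_forall fun y => ?_)
        simp only [eval_add]; ring
      | monomial n a =>
        rw [hKm, eval_smul, ← hv2 n x hx, smul_eq_mul, ← integral_const_mul, ← integral_const_mul,
          ← integral_const_mul]
        refine integral_congr_ae (.of_forall fun y => ?_)
        simp only [eval_monomial, eval_pow, eval_X, hc]
        field_simp

end AopPoly

/-! ### Orthogonal polynomials and the Sturm-Liouville operator -/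

open Polynomial in
/-- The weighted inner product of polynomials. -/
noncomputable def bil (T α : ℝ) (p q : ℝ[X]) : ℝ := ∫ t, wt T α t * (p.eval t * q.eval t)

section Bil

open Polynomial

variable {T α : ℝ}

lemma bil_integrable (hT : 0 < T) (hα : 0 < α) (p q : ℝ[X]) :
    Integrable fun t => wt T α t * (p.eval t * q.eval t) :=
  integrable_wt_mul hT hα (by have := p.continuous; have := q.continuous; fun_prop)

lemma bil_comm (p q : ℝ[X]) : bil T α p q = bil T α q p := by
  unfold bil; simp_rw [mul_comm (p.eval _)]

lemma bil_add_left (hT : 0 < T) (hα : 0 < α) (p p' q : ℝ[X]) :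
    bil T α (p + p') q = bil T α p q + bil T α p' q := by
  unfold bil
  rw [← integral_add (bil_integrable hT hα p q) (bil_integrable hT hα p' q)]
  congr 1; ext t; simp only [eval_add]; ring

lemma bil_smul_left (c : ℝ) (p q : ℝ[X]) : bil T α (c • p) q = c * bil T α p q := by
  unfold bil
  rw [← integral_const_mul]
  congr 1; ext t; simp only [eval_smul, smul_eq_mul]; ring

lemma bil_sub_left (hT : 0 < T) (hα : 0 < α) (p p' q : ℝ[X]) :
    bil T α (p - p') q = bil T α p q - bil T α p' q := by
  have := bil_add_left hT hα p ((-1 : ℝ) • p') q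
  rw [bil_smul_left] at this
  rw [sub_eq_add_neg p p', show -p' = (-1 : ℝ) • p' by simp, this]; ring

lemma bil_self_nonneg (p : ℝ[X]) : 0 ≤ bil T α p p :=
  integral_nonneg fun t => mul_nonneg (wt_nonneg t) (mul_self_nonneg _)

lemma eq_zero_of_bil_self (hT : 0 < T) (hα : 0 < α) {p : ℝ[X]} (h : bil T α p p = 0) : p = 0 := by
  unfold bil at h
  rw [integral_eq_zero_iff_of_nonneg (fun t => mul_nonneg (wt_nonneg t) (mul_self_nonneg _))
    (bil_integrable hT hα p p)] at h
  have h1 : ∀ᵐ t ∂(volume.restrict (Ioo 0 T)), p.eval t = 0 := by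
    filter_upwards [ae_restrict_of_ae h, ae_restrict_mem measurableSet_Ioo] with t ht ht'
    have := (mul_eq_zero.1 ht).resolve_left (wt_pos ht').ne'
    exact mul_self_eq_zero.1 this
  by_contra h0
  have h2 : (volume.restrict (Ioo 0 T)) {t | ¬ p.eval t = 0} = 0 := h1
  have h3 : (volume.restrict (Ioo 0 T)) {t | p.eval t = 0} = 0 := by
    refine Measure.restrict_le_self.absolutelyContinuous ?_
    exact (p.finite_setOfPred_isRoot h0).measure_zero volume
  have h4 := measure_union_null h3 h2
  have : {t | p.eval t = 0} ∪ {t | ¬ p.eval t = 0} = univ := by ext; simp [em]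
  rw [this, Measure.restrict_apply_univ, Real.volume_Ioo, ENNReal.ofReal_eq_zero] at h4
  linarith

/-- Orthonormal polynomials for the weight `(t (T - t))^(α-1)`. -/
lemma exists_orthonormal_poly (hT : 0 < T) (hα : 0 < α) :
    ∃ o : ℕ → ℝ[X], (∀ n, o n ∈ degreeLT ℝ (n + 1)) ∧ (∀ n, bil T α (o n) (o n) = 1) ∧
      (∀ n, ∀ q ∈ degreeLT ℝ n, bil T α (o n) q = 0) ∧ Submodule.span ℝ (range o) = ⊤ := by
  classical
  let core : InnerProductSpace.Core ℝ ℝ[X] :=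
    { inner := fun p q => bil T α p q
      conj_inner_symm := fun p q => by simpa using bil_comm q p
      re_inner_nonneg := fun p => by simpa using bil_self_nonneg p
      add_left := fun p q r => bil_add_left hT hα p q r
      smul_left := fun p q c => by simpa using bil_smul_left c p q
      definite := fun p hp => eq_zero_of_bil_self hT hα hp }
  let _ : NormedAddCommGroup ℝ[X] := core.toNormedAddCommGroup
  let _ : InnerProductSpace ℝ ℝ[X] := InnerProductSpace.ofCore core.toCore
  have hinner : ∀ p q : ℝ[X], inner ℝ p q = bil T α p q := fun p q => rfl
  set v : ℕ → ℝ[X] := fun n => X ^ n with hv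
  have hli : LinearIndependent ℝ v := by
    have h1 := (Polynomial.basisMonomials ℝ).linearIndependent
    have h2 : ⇑(Polynomial.basisMonomials ℝ) = v := by
      ext1 n; simp [hv, monomial_one_right_eq_X_pow]
    rwa [h2] at h1
  have ho := InnerProductSpace.gramSchmidtNormed_orthonormal hli
  have hspan : ∀ n, Submodule.span ℝ (v '' Iio n) = degreeLT ℝ n := by
    intro n
    rw [degreeLT_eq_span_X_pow]
    congr 1
    ext q
    simp [hv]
  have hspan' : ∀ n, Submodule.span ℝ (InnerProductSpace.gramSchmidtNormed ℝ v '' Iio n) =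
      degreeLT ℝ n := by
    intro n
    rw [InnerProductSpace.span_gramSchmidtNormed, InnerProductSpace.span_gramSchmidt_Iio]
    exact hspan n
  have htop : Submodule.span ℝ (range v) = ⊤ := by
    have h1 := (Polynomial.basisMonomials ℝ).span_eq
    have h2 : ⇑(Polynomial.basisMonomials ℝ) = v := by
      ext1 n; simp [hv, monomial_one_right_eq_X_pow]
    rwa [h2] at h1
  refine ⟨InnerProductSpace.gramSchmidtNormed ℝ v, fun n => ?_, fun n => ?_, fun n q hq => ?_, ?_⟩
  · rw [← hspan']
    exact Submodule.subset_span ⟨n, Nat.lt_succ_self n, rfl⟩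
  · rw [← hinner, real_inner_self_eq_norm_sq, ho.1 n, one_pow]
  · rw [← hspan' n] at hq
    rw [← hinner]
    induction hq using Submodule.span_induction with
    | mem x hx =>
      obtain ⟨m, hm, rfl⟩ := hx
      exact ho.2 (ne_of_gt hm)
    | zero => exact inner_zero_right _
    | add x y _ _ hx hy => rw [inner_add_right, hx, hy, add_zero]
    | smul a x _ hx => rw [real_inner_smul_right, hx, mul_zero]
  · rw [InnerProductSpace.span_gramSchmidtNormed_range, InnerProductSpace.span_gramSchmidt, htop]

/-- A symmetric triangular map is diagonal on orthogonal polynomials. -/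
lemma eigen_of_symm (hT : 0 < T) (hα : 0 < α) {o : ℕ → ℝ[X]}
    (ho : ∀ n, o n ∈ degreeLT ℝ (n + 1)) (ho' : ∀ n, ∀ q ∈ degreeLT ℝ n, bil T α (o n) q = 0)
    {S : ℝ[X] →ₗ[ℝ] ℝ[X]} {c : ℕ → ℝ} (hS : IsTri S c)
    (hsymm : ∀ p q, bil T α (S p) q = bil T α p (S q)) (n : ℕ) : S (o n) = c n • o n := by
  have h1 := hS.sub_mem (ho n)
  rw [← sub_eq_zero]
  refine eq_zero_of_bil_self hT hα ?_
  -- The defect d = S(o n) - c n • o n has degree below n, and so has S d. By symmetry, pairing d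
  -- with itself only involves pairings of o n with d and S d, which vanish.
  rw [bil_sub_left hT hα, hsymm, bil_smul_left, ho' n _ (hS.map_mem h1), ho' n _ h1]
  ring

/-- The Sturm-Liouville operator of the weight. -/
noncomputable def sl (T α : ℝ) : ℝ[X] →ₗ[ℝ] ℝ[X] :=
  -(LinearMap.mulLeft ℝ (X * (C T - X)) ∘ₗ derivative ∘ₗ derivative +
    α • LinearMap.mulLeft ℝ (C T - 2 * X) ∘ₗ derivative)

lemma sl_apply (p : ℝ[X]) : sl T α p =
    -(X * (C T - X) * derivative (derivative p) + C α * ((C T - 2 * X) * derivative p)) := by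
  simp [sl, smul_eq_C_mul, mul_assoc]

/-- Eigenvalues of the Sturm-Liouville operator. -/
noncomputable def ell (α : ℝ) (n : ℕ) : ℝ := n * (n + 2 * α - 1)

lemma isTri_sl : IsTri (sl T α) (ell α) := by
  intro n
  rcases n with _ | _ | n
  · simp [sl_apply, ell]
  · have : sl T α (X ^ (0 + 1)) - ell α (0 + 1) • X ^ (0 + 1) = monomial 0 (-(α * T)) := by
      rw [sl_apply, smul_eq_C_mul, ell, monomial_zero_left]
      simp
      rw [show (C (2 : ℝ) : ℝ[X]) = 2 from map_ofNat C 2]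
      ring
    rw [this]
    exact monomial_mem_degreeLT (by omega) _
  · have : sl T α (X ^ (n + 1 + 1)) - ell α (n + 1 + 1) • X ^ (n + 1 + 1) =
        monomial (n + 1) (-(T * ((n + 2) * (n + 1) + α * (n + 2)))) := by
      rw [sl_apply, smul_eq_C_mul, ell, ← C_mul_X_pow_eq_monomial]
      simp only [derivative_X_pow, derivative_mul, derivative_C, map_neg, map_mul, map_add]
      simp
      rw [show (C (2 : ℝ) : ℝ[X]) = 2 from map_ofNat C 2]
      ring
    rw [this]
    exact monomial_mem_degreeLT (by omega) _

/-- The weight of the derivatives. -/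
noncomputable def sw (T α : ℝ) (t : ℝ) : ℝ := (t * (T - t)) ^ α

lemma continuous_sw (hα : 0 < α) : Continuous (sw T α) :=
  (by fun_prop : Continuous fun t : ℝ => t * (T - t)).rpow_const fun _ => Or.inr hα.le

lemma sw_nonneg {t : ℝ} (ht : t ∈ Icc 0 T) : 0 ≤ sw T α t :=
  Real.rpow_nonneg (mul_nonneg ht.1 (by linarith [ht.2])) _

lemma sw_zero (hα : 0 < α) : sw T α 0 = 0 := by simp [sw, Real.zero_rpow hα.ne']

lemma sw_right (hα : 0 < α) : sw T α T = 0 := by simp [sw, Real.zero_rpow hα.ne']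

/-- Divergence form of the Sturm-Liouville operator; it rests on `sw` = t(T-t) · `wt` inside the
interval. -/
lemma hasDerivAt_sw_mul {t : ℝ} (ht : t ∈ Ioo 0 T) (p : ℝ[X]) :
    HasDerivAt (fun t => sw T α t * (derivative p).eval t) (-(wt T α t * (sl T α p).eval t)) t := by
  have hpos : 0 < t * (T - t) := mul_pos ht.1 (by linarith [ht.2])
  have h1 : HasDerivAt (fun t : ℝ => t * (T - t)) (T - 2 * t) t := by
    have := (hasDerivAt_id t).mul ((hasDerivAt_id t).const_sub T)
    refine this.congr_deriv ?_
    simp only [id]; ring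
  have h2 := (h1.rpow_const (p := α) (Or.inl hpos.ne')).mul ((derivative p).hasDerivAt t)
  refine h2.congr_deriv ?_
  have h3 : (t * (T - t)) ^ α = (t * (T - t)) ^ (α - 1) * (t * (T - t)) := by
    rw [← Real.rpow_add_one hpos.ne', sub_add_cancel]
  rw [wt_of_mem ht, sl_apply, h3]
  simp only [eval_neg, eval_add, eval_mul, eval_X, eval_sub, eval_C, eval_ofNat]
  ring

/-- `sw` vanishes at 0, so no boundary term remains. For an eigenpolynomial with nonzero eigenvalue
the primitive of `wt` times it is therefore explicit and vanishes at both ends. -/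
lemma integral_wt_sl (hα : 0 < α) (hT : 0 < T) (p : ℝ[X]) {t : ℝ} (ht : t ∈ Icc 0 T) :
    ∫ s in (0 : ℝ)..t, wt T α s * (sl T α p).eval s = -(sw T α t * (derivative p).eval t) := by
  have hc : Continuous fun t => sw T α t * (derivative p).eval t :=
    (continuous_sw hα).mul (derivative p).continuous
  have h := intervalIntegral.integral_eq_sub_of_hasDerivAt_of_le ht.1 hc.continuousOn
    (fun s hs => hasDerivAt_sw_mul (α := α) ⟨hs.1, hs.2.trans_le ht.2⟩ p)
    (integrable_wt_mul hT hα (sl T α p).continuous.continuousOn).neg.intervalIntegrable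
  simp only [sw_zero hα, zero_mul, sub_zero, intervalIntegral.integral_neg] at h
  linarith

lemma integral_eq_intervalIntegral_wt (hT : 0 < T) (g : ℝ → ℝ) :
    ∫ t, wt T α t * g t = ∫ t in (0 : ℝ)..T, wt T α t * g t := by
  rw [integral_wt_mul_eq, intervalIntegral.integral_of_le hT.le, integral_Ioc_eq_integral_Ioo]

/-- Integration by parts without boundary terms, since `sw` vanishes at 0 and T. The right side is
symmetric, and it makes the derivatives of eigenpolynomials orthogonal for the weight `sw`. -/
lemma bil_sl (hα : 0 < α) (hT : 0 < T) (p q : ℝ[X]) :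
    bil T α (sl T α p) q =
      ∫ t in (0 : ℝ)..T, sw T α t * ((derivative p).eval t * (derivative q).eval t) := by
  have hs := continuous_sw (T := T) hα
  have hp := (derivative p).continuous
  have hq := (derivative q).continuous
  have hq' := q.continuous
  have i1 : IntervalIntegrable (fun t => wt T α t * ((sl T α p).eval t * q.eval t)) volume 0 T :=
    (bil_integrable hT hα _ _).intervalIntegrable
  have i2 : IntervalIntegrable
      (fun t => sw T α t * ((derivative p).eval t * (derivative q).eval t)) volume 0 T :=
    (by fun_prop : Continuous fun t =>
      sw T α t * ((derivative p).eval t * (derivative q).eval t)).intervalIntegrable _ _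
  have h := intervalIntegral.integral_eq_sub_of_hasDerivAt_of_le hT.le
    (f := fun t => sw T α t * (derivative p).eval t * q.eval t)
    (f' := fun t => sw T α t * ((derivative p).eval t * (derivative q).eval t) -
      wt T α t * ((sl T α p).eval t * q.eval t))
    (by fun_prop)
    (fun s hs => ((hasDerivAt_sw_mul (α := α) hs p).mul (q.hasDerivAt s)).congr_deriv (by ring))
    (i2.sub i1)
  rw [intervalIntegral.integral_sub i2 i1, sw_zero hα, sw_right hα] at h
  rw [bil, integral_eq_intervalIntegral_wt hT (fun t => (sl T α p).eval t * q.eval t)]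
  linarith

lemma bil_sl_symm (hα : 0 < α) (hT : 0 < T) (p q : ℝ[X]) :
    bil T α (sl T α p) q = bil T α p (sl T α q) := by
  rw [bil_sl hα hT, bil_comm p, bil_sl hα hT]
  simp_rw [mul_comm ((derivative p).eval _)]

/-- The kernel is symmetric, and the Schur bound supplies the integrability that Fubini needs on the
whole weighted space. -/
lemma Aop_symm (hα : α ∈ Ioc (1 / 2 : ℝ) 1) {p q : ℝ → ℝ} (hp : MemWt T α p)
    (hq : MemWt T α q) :
    ∫ t, wt T α t * q t * Aop α (fun s => wt T α s * p s) t =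
      ∫ t, wt T α t * p t * Aop α (fun s => wt T α s * q s) t := by
  by_cases h : α = 1
  · simp only [Aop, if_pos h]
    congr 1; ext t; ring
  · have hα' : α ∈ Ioo (1 / 2 : ℝ) 1 := ⟨hα.1, lt_of_le_of_ne hα.2 h⟩
    have key : ∀ p q : ℝ → ℝ, ∫ t, wt T α t * q t * Aop α (fun s => wt T α s * p s) t =
        1 / Real.Gamma (2 - 2 * α) * ∫ t, ∫ s, |t - s| ^ (1 - 2 * α) *
          ((wt T α t * q t) * (wt T α s * p s)) := by
      intro p q
      simp only [Aop, if_neg h]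
      rw [← integral_const_mul]
      refine integral_congr_ae (.of_forall fun t => ?_)
      simp only
      rw [← integral_const_mul, ← integral_const_mul, ← integral_const_mul]
      refine integral_congr_ae (.of_forall fun s => ?_)
      simp only
      ring
    rw [key, key, integral_integral_swap (integrable_riesz_pair hα' hq hp)]
    congr 2; ext t; congr 1; ext s
    rw [abs_sub_comm]; ring

end Bil

/-! ### Minimisation over a ball of coefficients -/

section Minimisation

variable {e : ℕ → ℝ} {C r : ℝ}

/-- Duality: test the bound with a = e. If that sum is zero, C ≥ 0 is still needed and comes from a
single coefficient equal to 1. -/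
lemma sum_sq_le_of_bound
    (hC : ∀ (N : ℕ) (a : ℕ → ℝ), (∑ m ∈ Finset.range N, a m * e m) ^ 2 ≤
      C * ∑ m ∈ Finset.range N, a m ^ 2) (N : ℕ) : ∑ m ∈ Finset.range N, e m ^ 2 ≤ C := by
  have h := hC N e
  have h0 : 0 ≤ ∑ m ∈ Finset.range N, e m ^ 2 := Finset.sum_nonneg fun _ _ => sq_nonneg _
  simp only [← pow_two] at h
  rcases h0.eq_or_lt with h1 | h1
  · rw [← h1]
    have h2 := hC 1 (fun _ => 1)
    simp at h2
    nlinarith [sq_nonneg (e 0)]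
  · nlinarith

lemma summable_sq_of_bound {a : ℕ → ℝ} (ha : ∀ N, ∑ m ∈ Finset.range N, a m ^ 2 ≤ r) :
    Summable fun m => a m ^ 2 :=
  summable_of_sum_range_le (fun _ => sq_nonneg _) ha

lemma summable_mul_of_sq {a b : ℕ → ℝ} (ha : Summable fun m => a m ^ 2)
    (hb : Summable fun m => b m ^ 2) : Summable fun m => a m * b m := by
  refine Summable.of_norm_bounded (ha.add hb) fun m => ?_
  rw [Real.norm_eq_abs, abs_mul]
  nlinarith [sq_nonneg (|a m| - |b m|), sq_abs (a m), sq_abs (b m), sq_nonneg (a m),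
    sq_nonneg (b m)]

/-- Cauchy-Schwarz on the tail. The bound depends on a only through r, so the series converges
uniformly over the ball. -/
lemma tail_sq_le {a : ℕ → ℝ} (ha : ∀ N, ∑ m ∈ Finset.range N, a m ^ 2 ≤ r)
    (he : Summable fun m => e m ^ 2) (N : ℕ) :
    (∑' m, a m * e m - ∑ m ∈ Finset.range N, a m * e m) ^ 2 ≤
      r * (∑' m, e m ^ 2 - ∑ m ∈ Finset.range N, e m ^ 2) := by
  have h1 := (summable_mul_of_sq (summable_sq_of_bound ha) he).hasSum.tendsto_sum_nat
  have h2 := he.hasSum.tendsto_sum_nat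
  refine le_of_tendsto_of_tendsto ((h1.sub_const _).pow 2) ((h2.sub_const _).const_mul r) ?_
  filter_upwards [eventually_ge_atTop N] with M hM
  rw [← Finset.sum_Ico_eq_sub _ hM, ← Finset.sum_Ico_eq_sub _ hM]
  refine (Finset.sum_mul_sq_le_sq_mul_sq _ _ _).trans
    (mul_le_mul_of_nonneg_right ?_ (Finset.sum_nonneg fun _ _ => sq_nonneg _))
  refine (Finset.sum_le_sum_of_subset_of_nonneg ?_ fun _ _ _ => sq_nonneg _).trans (ha M)
  intro m hm
  exact Finset.mem_range.2 (Finset.mem_Ico.1 hm).2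

/-- The epigraph over which the energy is minimised. -/
def epiBall (r : ℝ) : Set ((ℕ → ℝ) × ℝ) :=
  {z | (∀ N, ∑ m ∈ Finset.range N, z.1 m ^ 2 ≤ z.2) ∧ z.2 ≤ r}

/-- Each constraint involves finitely many coordinates, so the set is closed for the product
topology; it lies in a product of compact intervals, and Tychonoff applies. -/
lemma isCompact_epiBall (r : ℝ) : IsCompact (epiBall r) := by
  have hK : IsCompact ((Set.pi univ fun _ : ℕ => Icc (-√r) √r) ×ˢ Icc 0 r : Set ((ℕ → ℝ) × ℝ)) :=
    (isCompact_univ_pi fun _ => isCompact_Icc).prod isCompact_Icc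
  refine hK.of_isClosed_subset ?_ ?_
  · have : epiBall r = (⋂ N, {z : (ℕ → ℝ) × ℝ | ∑ m ∈ Finset.range N, z.1 m ^ 2 ≤ z.2}) ∩
        {z | z.2 ≤ r} := by
      ext z; simp [epiBall]
    rw [this]
    exact (isClosed_iInter fun N => isClosed_le (by fun_prop) (by fun_prop)).inter
      (isClosed_le (by fun_prop) (by fun_prop))
  · rintro z ⟨h1, h2⟩
    refine ⟨fun m _ => ?_, by simpa using h1 0, h2⟩
    have h3 : z.1 m ^ 2 ≤ r := by
      refine le_trans ?_ ((h1 (m + 1)).trans h2)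
      exact Finset.single_le_sum (f := fun m => z.1 m ^ 2) (fun _ _ => sq_nonneg _)
        (Finset.mem_range.2 (Nat.lt_succ_self m))
    exact abs_le.1 (Real.abs_le_sqrt h3)

lemma continuousOn_tsum_epiBall (he : Summable fun m => e m ^ 2) :
    ContinuousOn (fun z : (ℕ → ℝ) × ℝ => ∑' m, z.1 m * e m) (epiBall r) := by
  have hr : ∀ z ∈ epiBall r, ∀ N, ∑ m ∈ Finset.range N, z.1 m ^ 2 ≤ r :=
    fun z hz N => (hz.1 N).trans hz.2
  refine TendstoUniformlyOn.continuousOn (p := atTop)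
    (F := fun N (z : (ℕ → ℝ) × ℝ) => ∑ m ∈ Finset.range N, z.1 m * e m) ?_
    (Frequently.of_forall fun N => by fun_prop)
  rw [Metric.tendstoUniformlyOn_iff]
  intro ε hε
  have h2 := ((he.hasSum.tendsto_sum_nat.const_sub (∑' m, e m ^ 2)).const_mul r)
  rw [sub_self, mul_zero] at h2
  filter_upwards [h2.eventually (gt_mem_nhds (pow_pos hε 2))] with N hN z hz
  rw [Real.dist_eq]
  refine abs_lt_of_sq_lt_sq ?_ hε.le
  exact (tail_sq_le (hr z hz) he N).trans_lt hN

end Minimisation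

/-- Existence of a critical point of `Σ a_m² - ∫ F(Σ a_m e_m)` inside a ball. -/
theorem exists_critical {T : ℝ} (hT : 0 < T) {e : ℕ → ℝ → ℝ} (he : ∀ m, Continuous (e m))
    {C r γ : ℝ} (hC : ∀ t ∈ Icc 0 T, ∀ (N : ℕ) (a : ℕ → ℝ),
      (∑ m ∈ Finset.range N, a m * e m t) ^ 2 ≤ C * ∑ m ∈ Finset.range N, a m ^ 2)
    (hr : 0 < r) (hγ : 0 < γ) (hCr : C * r ≤ γ ^ 2) {f : ℝ → ℝ} (hf : Continuous f) {M : ℝ}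
    (hM : ∀ ξ, |ξ| ≤ γ → ∫ t in (0 : ℝ)..ξ, f t ≤ M) (hMr : T * M < r) :
    ∃ (a : ℕ → ℝ) (u : ℝ → ℝ),
      (∀ t ∈ Icc 0 T, HasSum (fun m => a m * e m t) (u t)) ∧
      (∀ t ∈ Icc 0 T, |u t| ≤ γ) ∧ AEStronglyMeasurable u (volume.restrict (Ioc 0 T)) ∧
      ∀ m, 2 * a m = ∫ t in (0 : ℝ)..T, f (u t) * e m t := by
  set F : ℝ → ℝ := fun ξ => ∫ t in (0 : ℝ)..ξ, f t with hF
  have hFd : ∀ ξ, HasDerivAt F (f ξ) ξ := fun ξ => hf.integral_hasStrictDerivAt 0 ξ |>.hasDerivAt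
  have hFc : Continuous F := continuous_iff_continuousAt.2 fun ξ => (hFd ξ).continuousAt
  set U : (ℕ → ℝ) → ℝ → ℝ := fun a t => ∑' m, a m * e m t with hU
  have hes : ∀ t ∈ Icc 0 T, Summable fun m => e m t ^ 2 := fun t ht =>
    summable_sq_of_bound (sum_sq_le_of_bound (hC t ht))
  have hsq : ∀ z ∈ epiBall r, ∀ N, ∑ m ∈ Finset.range N, z.1 m ^ 2 ≤ r :=
    fun z hz N => (hz.1 N).trans hz.2
  have hUs : ∀ z ∈ epiBall r, ∀ t ∈ Icc 0 T, HasSum (fun m => z.1 m * e m t) (U z.1 t) :=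
    fun z hz t ht => (summable_mul_of_sq (summable_sq_of_bound (hsq z hz)) (hes t ht)).hasSum
  have hC0 : 0 ≤ C := by
    simpa using sum_sq_le_of_bound (hC 0 ⟨le_rfl, hT.le⟩) 0
  have hUb : ∀ z ∈ epiBall r, ∀ t ∈ Icc 0 T, |U z.1 t| ≤ γ := by
    intro z hz t ht
    refine abs_le_of_sq_le_sq ?_ hγ.le
    refine le_of_tendsto ((hUs z hz t ht).tendsto_sum_nat.pow 2) (.of_forall fun N => ?_)
    exact ((hC t ht N z.1).trans (mul_le_mul_of_nonneg_left (hsq z hz N) hC0)).trans hCr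
  set μ := volume.restrict (Ioc 0 T) with hμ
  have hmem : ∀ᵐ t ∂μ, t ∈ Icc 0 T :=
    (ae_restrict_mem measurableSet_Ioc).mono fun t ht => Ioc_subset_Icc_self ht
  have hUm : ∀ z ∈ epiBall r, AEStronglyMeasurable (U z.1) μ := fun z hz =>
    aestronglyMeasurable_of_tendsto_ae (u := atTop)
      (f := fun N t => ∑ m ∈ Finset.range N, z.1 m * e m t)
      (fun N => (continuous_finsetSum _ fun m _ => (he m).const_mul _).aestronglyMeasurable)
      (hmem.mono fun t ht => (hUs z hz t ht).tendsto_sum_nat)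
  obtain ⟨B, hB⟩ := isCompact_Icc.exists_bound_of_continuousOn
    (hFc.continuousOn (s := Icc (-γ) γ))
  -- The coordinate z.2 replaces Σ a_m², which is only lower semicontinuous for the product
  -- topology. With it the energy is continuous on a compact set.
  set J : (ℕ → ℝ) × ℝ → ℝ := fun z => z.2 - ∫ t, F (U z.1 t) ∂μ with hJ
  have hJc : ContinuousOn J (epiBall r) := by
    refine continuous_snd.continuousOn.sub ?_
    refine continuousOn_of_dominated (bound := fun _ => B)
      (fun z hz => hFc.comp_aestronglyMeasurable (hUm z hz))
      (fun z hz => hmem.mono fun t ht => hB _ (abs_le.1 (hUb z hz t ht))) (integrable_const _)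
      (hmem.mono fun t ht => hFc.comp_continuousOn (continuousOn_tsum_epiBall (hes t ht)))
  have h0 : ((0 : ℕ → ℝ), (0 : ℝ)) ∈ epiBall r := ⟨fun N => by simp, hr.le⟩
  obtain ⟨⟨a, ρ⟩, hz, hmin⟩ := (isCompact_epiBall r).exists_isMinOn ⟨_, h0⟩ hJc
  have hmin' : ∀ z ∈ epiBall r, J (a, ρ) ≤ J z := fun z hz => hmin hz
  -- Comparison with the zero sequence, of energy 0, gives ρ ≤ ∫ F(u) ≤ T M < r. This leaves room to
  -- perturb.
  have hρ : ρ < r := by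
    have h1 := hmin' _ h0
    have h2 : J ((0 : ℕ → ℝ), (0 : ℝ)) = 0 := by simp [hJ, hU, hF]
    have h3 : ∫ t, F (U a t) ∂μ ≤ ∫ _, M ∂μ := by
      refine integral_mono_ae ?_ (integrable_const _)
        (hmem.mono fun t ht => hM _ (hUb _ hz t ht))
      exact Integrable.of_bound (hFc.comp_aestronglyMeasurable (hUm _ hz)) B
        (hmem.mono fun t ht => hB _ (abs_le.1 (hUb _ hz t ht)))
    have h4 : ∫ _, M ∂μ = T * M := by
      rw [integral_const, hμ, measureReal_restrict_apply_univ, Real.volume_real_Ioc_of_le hT.le,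
        sub_zero, smul_eq_mul]
    rw [h2] at h1
    simp only [hJ] at h1
    linarith
  refine ⟨a, U a, hUs _ hz, hUb _ hz, hUm _ hz, fun m => ?_⟩
  have hadd : ∀ ε : ℝ, ∀ t ∈ Icc 0 T,
      U (fun k => a k + if k = m then ε else 0) t = U a t + ε * e m t := by
    intro ε t ht
    have h1 : HasSum (fun k => (if k = m then ε else 0) * e k t) (ε * e m t) := by
      have h2 : (fun k => (if k = m then ε else 0) * e k t) =
          fun k => if k = m then ε * e m t else 0 := by
        ext k
        split_ifs with h
        · rw [h]
        · exact zero_mul _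
      rw [h2]
      exact hasSum_ite_eq m _
    have h2 := (hUs _ hz t ht).add h1
    simp only [hU]
    rw [← h2.tsum_eq]
    congr 1; ext k; ring
  -- Adding ε to a m changes Σ a² by exactly 2εa_m + ε², and ρ is moved by the same amount. Partial
  -- sums are first extended past m because a shorter one does not see the change, which may be
  -- negative.
  have hin : ∀ ε : ℝ, ρ + (2 * ε * a m + ε ^ 2) ≤ r →
      ((fun k => a k + if k = m then ε else 0), ρ + (2 * ε * a m + ε ^ 2)) ∈ epiBall r := by
    intro ε hε
    refine ⟨fun N => ?_, hε⟩
    simp only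
    calc _ ≤ ∑ k ∈ Finset.range (N + m + 1), (a k + if k = m then ε else 0) ^ 2 := by
          refine Finset.sum_le_sum_of_subset_of_nonneg ?_ fun _ _ _ => sq_nonneg _
          exact Finset.range_mono (by omega)
      _ = ∑ k ∈ Finset.range (N + m + 1),
          (a k ^ 2 + if k = m then 2 * ε * a m + ε ^ 2 else 0) := by
          refine Finset.sum_congr rfl fun k _ => ?_
          split_ifs with h
          · subst h; ring
          · ring
      _ = ∑ k ∈ Finset.range (N + m + 1), a k ^ 2 + (2 * ε * a m + ε ^ 2) := by
          rw [Finset.sum_add_distrib, Finset.sum_ite_eq' (Finset.range (N + m + 1)) m,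
            if_pos (Finset.mem_range.2 (by omega))]
      _ ≤ _ := by
          have := hz.1 (N + m + 1)
          simp only at this
          linarith
  obtain ⟨D, hD⟩ := isCompact_Icc.exists_bound_of_continuousOn ((he m).continuousOn (s := Icc 0 T))
  have hD0 : 0 ≤ D := (norm_nonneg _).trans (hD 0 ⟨le_rfl, hT.le⟩)
  obtain ⟨B', hB'⟩ := isCompact_Icc.exists_bound_of_continuousOn
    (hf.continuousOn (s := Icc (-(γ + D)) (γ + D)))
  have hB'0 : 0 ≤ B' := (norm_nonneg _).trans (hB' 0 ⟨by linarith, by linarith⟩)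
  have hder : HasDerivAt (fun ε => ∫ t, F (U a t + ε * e m t) ∂μ)
      (∫ t, f (U a t + 0 * e m t) * e m t ∂μ) 0 := by
    have hmeas : ∀ ε : ℝ, AEStronglyMeasurable (fun t => U a t + ε * e m t) μ := fun ε =>
      (hUm _ hz).add ((he m).aestronglyMeasurable.const_mul ε)
    refine (hasDerivAt_integral_of_dominated_loc_of_deriv_le (s := Ioo (-1) 1)
      (F := fun ε t => F (U a t + ε * e m t)) (F' := fun ε t => f (U a t + ε * e m t) * e m t)
      (bound := fun _ => B' * D) (Ioo_mem_nhds (by norm_num) (by norm_num))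
      (.of_forall fun ε => hFc.comp_aestronglyMeasurable (hmeas ε)) ?_
      ((hf.comp_aestronglyMeasurable (hmeas 0)).mul (he m).aestronglyMeasurable)
      (hmem.mono fun t ht ε hε => ?_) (integrable_const _)
      (.of_forall fun t ε _ => ?_)).2
    · simp only [zero_mul, add_zero]
      exact Integrable.of_bound (hFc.comp_aestronglyMeasurable (hUm _ hz)) B
        (hmem.mono fun t ht => hB _ (abs_le.1 (hUb _ hz t ht)))
    · rw [norm_mul]
      refine mul_le_mul (hB' _ (abs_le.1 ?_)) (hD t ht) (norm_nonneg _) hB'0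
      have h1 := hUb _ hz t ht
      have h2 : |ε * e m t| ≤ D := by
        rw [abs_mul]
        have := hD t ht
        rw [Real.norm_eq_abs] at this
        have h3 : |ε| ≤ 1 := abs_le.2 ⟨hε.1.le, hε.2.le⟩
        nlinarith [abs_nonneg ε, abs_nonneg (e m t)]
      exact (abs_add_le _ _).trans (add_le_add h1 h2)
    · have h1 : HasDerivAt (fun ε => U a t + ε * e m t) (e m t) ε := by
        simpa using ((hasDerivAt_id ε).mul_const (e m t)).const_add (U a t)
      exact (hFd _).comp ε h1
  set φ : ℝ → ℝ := fun ε => ρ + (2 * ε * a m + ε ^ 2) - ∫ t, F (U a t + ε * e m t) ∂μ with hφ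
  have hφd : HasDerivAt φ (2 * a m - ∫ t, f (U a t + 0 * e m t) * e m t ∂μ) 0 := by
    have h1 : HasDerivAt (fun ε : ℝ => ρ + (2 * ε * a m + ε ^ 2)) (2 * a m) 0 := by
      have := ((((hasDerivAt_id (0 : ℝ)).const_mul 2).mul_const (a m)).add
        (hasDerivAt_pow 2 (0 : ℝ))).const_add ρ
      refine this.congr_deriv ?_
      simp
    exact h1.sub hder
  -- Near ε = 0 the perturbed pair stays admissible because ρ < r, so φ inherits the minimum and its
  -- derivative vanishes.
  have hloc : IsLocalMin φ 0 := by
    have hcont : Continuous fun ε : ℝ => ρ + (2 * ε * a m + ε ^ 2) := by fun_prop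
    have hev := (hcont.tendsto 0).eventually_lt_const (u := r) (by simpa using hρ)
    filter_upwards [hev] with ε hε
    have h1 := hmin' _ (hin ε hε.le)
    have h2 : ∫ t, F (U (fun k => a k + if k = m then ε else 0) t) ∂μ =
        ∫ t, F (U a t + ε * e m t) ∂μ :=
      integral_congr_ae (hmem.mono fun t ht => by simp only; rw [hadd ε t ht])
    simp only [hJ] at h1
    rw [h2] at h1
    simp only [hφ, zero_mul, add_zero, mul_zero]
    simpa using h1
  have h1 := hloc.hasDerivAt_eq_zero hφd
  simp only [zero_mul, add_zero] at h1
  rw [intervalIntegral.integral_of_le hT.le]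
  linarith

lemma sq_integral_mul_le {X : Type*} [MeasurableSpace X] {μ : Measure X} {f g : X → ℝ}
    (hf : Integrable (fun x => f x ^ 2) μ) (hg : Integrable (fun x => g x ^ 2) μ)
    (hfg : Integrable (fun x => f x * g x) μ) :
    (∫ x, f x * g x ∂μ) ^ 2 ≤ (∫ x, f x ^ 2 ∂μ) * ∫ x, g x ^ 2 ∂μ := by
  have h : ∀ c : ℝ, 0 ≤ (∫ x, f x ^ 2 ∂μ) * (c * c) + (2 * ∫ x, f x * g x ∂μ) * c +
      ∫ x, g x ^ 2 ∂μ := by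
    intro c
    have h1 : ∫ x, (c * f x + g x) ^ 2 ∂μ = (∫ x, f x ^ 2 ∂μ) * (c * c) +
        (2 * ∫ x, f x * g x ∂μ) * c + ∫ x, g x ^ 2 ∂μ := by
      rw [← integral_mul_const, mul_right_comm, ← integral_const_mul,
        ← integral_add (hf.mul_const _) (hfg.const_mul _), ← integral_add _ hg]
      · congr 1; ext x; ring
      · exact (hf.mul_const _).add (hfg.const_mul _)
    rw [← h1]
    exact integral_nonneg fun x => sq_nonneg _
  have := discrim_le_zero h
  rw [discrim] at this
  linarith

/-! ### Fractional integrals on the line and their Riesz forms -/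

section Causal

variable {T α : ℝ}

/-- The left fractional integral on the line, without normalisation. -/
noncomputable def causal (γ : ℝ) (g : ℝ → ℝ) (t : ℝ) : ℝ := ∫ s, ker γ (t - s) * g s

/-- The right fractional integral on the line, without normalisation. -/
noncomputable def anticausal (γ : ℝ) (g : ℝ → ℝ) (t : ℝ) : ℝ := ∫ s, ker γ (s - t) * g s

lemma aestronglyMeasurable_causal {γ : ℝ} {g : ℝ → ℝ} (hg : AEStronglyMeasurable g) :
    AEStronglyMeasurable (causal γ g) := by
  have : AEStronglyMeasurable (fun z : ℝ × ℝ => ker γ (z.1 - z.2) * g z.2)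
      ((volume : Measure ℝ).prod volume) :=
    (Measurable.aestronglyMeasurable (by fun_prop)).mul hg.comp_snd
  exact this.integral_prod_right'

lemma causal_of_nonpos {γ t : ℝ} {g : ℝ → ℝ} (hg : ∀ s ∉ Ioo 0 T, g s = 0) (ht : t ≤ 0) :
    causal γ g t = 0 := by
  refine integral_eq_zero_of_ae (.of_forall fun s => ?_)
  by_cases hs : s ∈ Ioo 0 T
  · simp [ker_of_nonpos (show t - s ≤ 0 by linarith [hs.1])]
  · simp [hg s hs]

lemma anticausal_of_le {γ t : ℝ} {g : ℝ → ℝ} (hg : ∀ s ∉ Ioo 0 T, g s = 0) (ht : T ≤ t) :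
    anticausal γ g t = 0 := by
  refine integral_eq_zero_of_ae (.of_forall fun s => ?_)
  by_cases hs : s ∈ Ioo 0 T
  · simp [ker_of_nonpos (show s - t ≤ 0 by linarith [hs.2])]
  · simp [hg s hs]

lemma ae_fst_ne_snd : ∀ᵐ z : ℝ × ℝ, z.1 ≠ z.2 := by
  have hm : MeasurableSet {z : ℝ × ℝ | ¬ z.1 ≠ z.2} :=
    (measurableSet_eq_fun measurable_fst measurable_snd).congr (by ext; simp)
  rw [ae_iff, Measure.volume_eq_prod, Measure.measure_prod_null hm]
  refine .of_forall fun x => ?_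
  have : Prod.mk x ⁻¹' {z : ℝ × ℝ | ¬ z.1 ≠ z.2} = {x} := by ext y; simp [eq_comm]
  simp only [this]; simp

/-- Pairing of the integrals of order `1 - α`. -/
lemma causal_pair {g h : ℝ → ℝ} (k₁ : ℝ × ℝ → ℝ) (κ₁ κ₂ : ℝ → ℝ → ℝ)
    (hκ₁ : Measurable (Function.uncurry κ₁)) (hκ₂ : Measurable (Function.uncurry κ₂))
    (hκ₁0 : ∀ t s, 0 ≤ κ₁ t s) (hκ₂0 : ∀ t s, 0 ≤ κ₂ t s)
    (hint : ∀ᵐ z : ℝ × ℝ, Integrable fun t => κ₁ t z.1 * κ₂ t z.2)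
    (hval : ∀ᵐ z : ℝ × ℝ, ∫ t, κ₁ t z.1 * κ₂ t z.2 = k₁ z)
    (hg : AEStronglyMeasurable g) (hh : AEStronglyMeasurable h)
    (hk : Integrable fun z : ℝ × ℝ => k₁ z * (g z.1 * h z.2)) :
    Integrable (fun t => (∫ s, κ₁ t s * g s) * ∫ s, κ₂ t s * h s) ∧
    ∫ t, (∫ s, κ₁ t s * g s) * ∫ s, κ₂ t s * h s = ∫ z, k₁ z * (g z.1 * h z.2) := by
  have hm : Measurable (Function.uncurry fun t (z : ℝ × ℝ) => κ₁ t z.1 * κ₂ t z.2) := by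
    have h1 : Measurable fun q : ℝ × (ℝ × ℝ) => Function.uncurry κ₁ (q.1, q.2.1) :=
      hκ₁.comp (by fun_prop)
    have h2 : Measurable fun q : ℝ × (ℝ × ℝ) => Function.uncurry κ₂ (q.1, q.2.2) :=
      hκ₂.comp (by fun_prop)
    exact h1.mul h2
  have hG : AEStronglyMeasurable (fun z : ℝ × ℝ => g z.1 * h z.2) (volume.prod volume) :=
    hg.comp_fst.mul hh.comp_snd
  have i := integrable_kernel_mul hm (fun t z => mul_nonneg (hκ₁0 t z.1) (hκ₂0 t z.2)) hint hval
    hG hk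
  have v := integral_kernel_mul hm (fun t z => mul_nonneg (hκ₁0 t z.1) (hκ₂0 t z.2)) hint hval
    hG hk
  have e : ∀ t, ∫ z : ℝ × ℝ, κ₁ t z.1 * κ₂ t z.2 * (g z.1 * h z.2) =
      (∫ s, κ₁ t s * g s) * ∫ s, κ₂ t s * h s := by
    intro t
    rw [← integral_prod_mul, Measure.volume_eq_prod]
    congr 1; ext z; ring
  refine ⟨?_, ?_⟩
  · exact i.integral_prod_left.congr (.of_forall fun t => e t)
  · rw [← v]; simp_rw [e]

/-- The autocorrelation identity applied under Fubini: the L² norm over the whole line, not merely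
over (0,T), is exactly a Riesz form. The diagonal, where the kernel identity fails, is a null set.
-/
lemma causal_sq (hα : α ∈ Ioo (1 / 2 : ℝ) 1) {g : ℝ → ℝ} (hg : AEStronglyMeasurable g)
    (hR : Integrable fun z : ℝ × ℝ => |z.1 - z.2| ^ (1 - 2 * α) * (g z.1 * g z.2)) :
    Integrable (fun t => causal (1 - α) g t ^ 2) ∧
    ∫ t, causal (1 - α) g t ^ 2 = ProbabilityTheory.beta (2 * α - 1) (1 - α) *
      ∫ z : ℝ × ℝ, |z.1 - z.2| ^ (1 - 2 * α) * (g z.1 * g z.2) := by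
  have h := causal_pair (g := g) (h := g)
    (fun z => ProbabilityTheory.beta (2 * α - 1) (1 - α) * |z.1 - z.2| ^ (1 - 2 * α))
    (fun t s => ker (1 - α) (t - s)) (fun t s => ker (1 - α) (t - s))
    (by simp only [Function.uncurry_def]; fun_prop)
    (by simp only [Function.uncurry_def]; fun_prop)
    (fun _ _ => ker_nonneg _ _) (fun _ _ => ker_nonneg _ _)
    (ae_fst_ne_snd.mono fun z hz => integrable_ker_sub_mul_ker_sub hα hz)
    (ae_fst_ne_snd.mono fun z hz => integral_ker_sub_mul_ker_sub hα hz) hg hg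
    ((hR.const_mul (ProbabilityTheory.beta (2 * α - 1) (1 - α))).congr
      (.of_forall fun z => (mul_assoc _ _ _).symm))
  simp only [← pow_two] at h
  refine ⟨h.1, h.2.trans ?_⟩
  rw [← integral_const_mul]
  simp only [mul_assoc]

/-- Composition of fractional integrals, from the kernel semigroup law and Fubini. Convergence of
the integral of order a + b at the single point t yields convergence of the iterated one at t. -/
lemma causal_comp {a b : ℝ} (ha : 0 < a) (hb : 0 < b) {g : ℝ → ℝ} (hg : AEStronglyMeasurable g)
    {t : ℝ} (hi : Integrable fun s => ker (a + b) (t - s) * g s) :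
    Integrable (fun τ => ker a (t - τ) * causal b g τ) ∧
    ∫ τ, ker a (t - τ) * causal b g τ =
      ProbabilityTheory.beta a b * ∫ s, ker (a + b) (t - s) * g s := by
  have hm : Measurable (Function.uncurry fun τ s => ker a (t - τ) * ker b (τ - s)) := by
    simp only [Function.uncurry_def]; fun_prop
  have hk : Integrable fun s => ProbabilityTheory.beta a b * ker (a + b) (t - s) * g s :=
    (hi.const_mul _).congr (.of_forall fun s => (mul_assoc _ _ _).symm)
  have i := integrable_kernel_mul hm (fun _ _ => mul_nonneg (ker_nonneg _ _) (ker_nonneg _ _))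
    (.of_forall fun s => integrable_ker_mul_ker ha hb s t)
    (.of_forall fun s => integral_ker_mul_ker ha hb s t) hg hk
  have v := integral_kernel_mul hm (fun _ _ => mul_nonneg (ker_nonneg _ _) (ker_nonneg _ _))
    (.of_forall fun s => integrable_ker_mul_ker ha hb s t)
    (.of_forall fun s => integral_ker_mul_ker ha hb s t) hg hk
  have e : ∀ τ, ∫ s, ker a (t - τ) * ker b (τ - s) * g s = ker a (t - τ) * causal b g τ := by
    intro τ
    rw [causal, ← integral_const_mul]; simp only [mul_assoc]
  refine ⟨i.integral_prod_left.congr (.of_forall fun τ => e τ), ?_⟩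
  simp only [e] at v
  rw [v, ← integral_const_mul]; simp only [mul_assoc]

lemma anticausal_comp {a b : ℝ} (ha : 0 < a) (hb : 0 < b) {g : ℝ → ℝ}
    (hg : AEStronglyMeasurable g) {t : ℝ} (hi : Integrable fun s => ker (a + b) (s - t) * g s) :
    Integrable (fun τ => ker a (τ - t) * anticausal b g τ) ∧
    ∫ τ, ker a (τ - t) * anticausal b g τ =
      ProbabilityTheory.beta a b * ∫ s, ker (a + b) (s - t) * g s := by
  have hm : Measurable (Function.uncurry fun τ s => ker b (s - τ) * ker a (τ - t)) := by
    simp only [Function.uncurry_def]; fun_prop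
  have hba : ProbabilityTheory.beta b a = ProbabilityTheory.beta a b := by
    rw [ProbabilityTheory.beta, ProbabilityTheory.beta, add_comm, mul_comm (Real.Gamma b)]
  have hk : Integrable fun s => ProbabilityTheory.beta b a * ker (b + a) (s - t) * g s := by
    rw [add_comm b a]
    exact (hi.const_mul _).congr (.of_forall fun s => (mul_assoc _ _ _).symm)
  have i := integrable_kernel_mul hm (fun _ _ => mul_nonneg (ker_nonneg _ _) (ker_nonneg _ _))
    (.of_forall fun s => integrable_ker_mul_ker hb ha t s)
    (.of_forall fun s => integral_ker_mul_ker hb ha t s) hg hk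
  have v := integral_kernel_mul hm (fun _ _ => mul_nonneg (ker_nonneg _ _) (ker_nonneg _ _))
    (.of_forall fun s => integrable_ker_mul_ker hb ha t s)
    (.of_forall fun s => integral_ker_mul_ker hb ha t s) hg hk
  have e : ∀ τ, ∫ s, ker b (s - τ) * ker a (τ - t) * g s = ker a (τ - t) * anticausal b g τ := by
    intro τ
    rw [anticausal, ← integral_const_mul]
    congr 1; ext s; ring
  refine ⟨i.integral_prod_left.congr (.of_forall fun τ => e τ), ?_⟩
  simp only [e] at v
  rw [v, ← integral_const_mul, hba, add_comm b a]; simp only [mul_assoc]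

/-- The weak pairing of left and right integrals of order `1 - α`. -/
lemma causal_anticausal_pair (hα : α ∈ Ioo (1 / 2 : ℝ) 1) {g h : ℝ → ℝ}
    (hg : AEStronglyMeasurable g) (hh : AEStronglyMeasurable h)
    (hR : Integrable fun z : ℝ × ℝ => |z.1 - z.2| ^ (1 - 2 * α) * (g z.1 * h z.2)) :
    Integrable (fun t => causal (1 - α) g t * anticausal (1 - α) h t) ∧
    Integrable (fun t => anticausal (1 - α) g t * causal (1 - α) h t) ∧
    (∫ t, causal (1 - α) g t * anticausal (1 - α) h t) +
      ∫ t, anticausal (1 - α) g t * causal (1 - α) h t =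
      ProbabilityTheory.beta (1 - α) (1 - α) *
        ∫ z : ℝ × ℝ, |z.1 - z.2| ^ (1 - 2 * α) * (g z.1 * h z.2) := by
  have h1α : 0 < 1 - α := by linarith [hα.2]
  have hle : ∀ x : ℝ, ker (1 - α + (1 - α)) x ≤ |x| ^ (1 - 2 * α) ∧
      ker (1 - α + (1 - α)) (-x) ≤ |x| ^ (1 - 2 * α) := by
    intro x
    have h0 := ker_add_ker_neg (γ := 1 - α + (1 - α)) (by linarith [hα.1]) x
    rw [show 1 - α + (1 - α) - 1 = 1 - 2 * α by ring] at h0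
    have := ker_nonneg (1 - α + (1 - α)) x
    have := ker_nonneg (1 - α + (1 - α)) (-x)
    constructor <;> linarith
  set B := ProbabilityTheory.beta (1 - α) (1 - α)
  have hG : AEStronglyMeasurable (fun z : ℝ × ℝ => g z.1 * h z.2) :=
    hg.comp_fst.mul hh.comp_snd
  have hi1 : Integrable fun z : ℝ × ℝ => ker (1 - α + (1 - α)) (z.2 - z.1) * (g z.1 * h z.2) := by
    refine hR.mono ((Measurable.aestronglyMeasurable (by fun_prop)).mul hG) (.of_forall fun z => ?_)
    rw [norm_mul, norm_mul (|z.1 - z.2| ^ (1 - 2 * α)), Real.norm_of_nonneg (ker_nonneg _ _),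
      Real.norm_of_nonneg (Real.rpow_nonneg (abs_nonneg _) _)]
    refine mul_le_mul_of_nonneg_right ?_ (norm_nonneg _)
    rw [← neg_sub z.1 z.2]; exact (hle _).2
  have hi2 : Integrable fun z : ℝ × ℝ => ker (1 - α + (1 - α)) (z.1 - z.2) * (g z.1 * h z.2) := by
    refine hR.mono ((Measurable.aestronglyMeasurable (by fun_prop)).mul hG) (.of_forall fun z => ?_)
    rw [norm_mul, norm_mul (|z.1 - z.2| ^ (1 - 2 * α)), Real.norm_of_nonneg (ker_nonneg _ _),
      Real.norm_of_nonneg (Real.rpow_nonneg (abs_nonneg _) _)]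
    exact mul_le_mul_of_nonneg_right (hle _).1 (norm_nonneg _)
  have p1 := causal_pair (g := g) (h := h)
    (fun z => B * ker (1 - α + (1 - α)) (z.2 - z.1))
    (fun t s => ker (1 - α) (t - s)) (fun t s => ker (1 - α) (s - t))
    (by simp only [Function.uncurry_def]; fun_prop)
    (by simp only [Function.uncurry_def]; fun_prop)
    (fun _ _ => ker_nonneg _ _) (fun _ _ => ker_nonneg _ _)
    (.of_forall fun z => (integrable_ker_mul_ker h1α h1α z.1 z.2).congr
      (.of_forall fun t => mul_comm _ _))
    (.of_forall fun z => by
      rw [← integral_ker_mul_ker h1α h1α z.1 z.2]; congr 1; ext t; ring) hg hh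
    ((hi1.const_mul B).congr (.of_forall fun z => (mul_assoc _ _ _).symm))
  have p2 := causal_pair (g := g) (h := h)
    (fun z => B * ker (1 - α + (1 - α)) (z.1 - z.2))
    (fun t s => ker (1 - α) (s - t)) (fun t s => ker (1 - α) (t - s))
    (by simp only [Function.uncurry_def]; fun_prop)
    (by simp only [Function.uncurry_def]; fun_prop)
    (fun _ _ => ker_nonneg _ _) (fun _ _ => ker_nonneg _ _)
    (.of_forall fun z => integrable_ker_mul_ker h1α h1α z.2 z.1)
    (.of_forall fun z => integral_ker_mul_ker h1α h1α z.2 z.1) hg hh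
    ((hi2.const_mul B).congr (.of_forall fun z => (mul_assoc _ _ _).symm))
  refine ⟨p1.1, p2.1, ?_⟩
  have e1 := p1.2
  have e2 := p2.2
  simp only [mul_assoc] at e1 e2
  rw [integral_const_mul] at e1 e2
  simp only [causal, anticausal]
  -- The two pairings carry the two one-sided kernels of order 2 - 2α, whose sum is the Riesz
  -- kernel.
  rw [e1, e2, ← mul_add, ← integral_add hi1 hi2]
  congr 2; ext z
  have h0 := ker_add_ker_neg (γ := 1 - α + (1 - α)) (by linarith [hα.1]) (z.1 - z.2)
  rw [show 1 - α + (1 - α) - 1 = 1 - 2 * α by ring, neg_sub] at h0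
  rw [← h0]; ring

end Causal

/-! ### The pointwise bound with the constant κ -/

section Pointwise

variable {T α : ℝ}

/-- Euler's reflection formula at α and at 2α - 1, combined with sin π(2α-1) = 2 sin(πα) |cos(πα)|.
It is the source of |cos(πα)| in κ. -/
lemma gamma_identity (hα : α ∈ Ioo (1 / 2 : ℝ) 1) :
    2 * Real.Gamma (2 * α - 1) * Real.Gamma (2 - 2 * α) * |Real.cos (Real.pi * α)| =
      Real.Gamma α * Real.Gamma (1 - α) := by
  have h1 := Real.Gamma_mul_Gamma_one_sub α
  have h2 := Real.Gamma_mul_Gamma_one_sub (2 * α - 1)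
  rw [show 1 - (2 * α - 1) = 2 - 2 * α by ring] at h2
  have hs : 0 < Real.sin (Real.pi * α) := Real.sin_pos_of_pos_of_lt_pi
    (mul_pos Real.pi_pos (by linarith [hα.1])) (by nlinarith [Real.pi_pos, hα.2])
  have hc : Real.cos (Real.pi * α) < 0 := Real.cos_neg_of_pi_div_two_lt_of_lt
    (by nlinarith [Real.pi_pos, hα.1]) (by nlinarith [Real.pi_pos, hα.2])
  have h3 : Real.sin (Real.pi * (2 * α - 1)) =
      2 * Real.sin (Real.pi * α) * |Real.cos (Real.pi * α)| := by
    rw [show Real.pi * (2 * α - 1) = 2 * (Real.pi * α) - Real.pi by ring, Real.sin_sub_pi,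
      Real.sin_two_mul, abs_of_neg hc]; ring
  rw [mul_assoc 2, h2, h1, h3]
  have := abs_pos.2 hc.ne
  field_simp

lemma integral_riesz_eq (hα : α ≠ 1) {g : ℝ → ℝ}
    (hR : Integrable fun z : ℝ × ℝ => |z.1 - z.2| ^ (1 - 2 * α) * (g z.1 * g z.2)) :
    ∫ t, g t * Aop α g t = 1 / Real.Gamma (2 - 2 * α) *
      ∫ z : ℝ × ℝ, |z.1 - z.2| ^ (1 - 2 * α) * (g z.1 * g z.2) := by
  rw [Measure.volume_eq_prod, integral_prod _ hR, ← integral_const_mul]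
  refine integral_congr_ae (.of_forall fun t => ?_)
  simp only [Aop, if_neg hα]
  rw [mul_left_comm, ← integral_const_mul]
  congr 2; ext s; ring

/-- The primitive u is, up to Γ(α)Γ(1-α), the integral of order α of the integral W of order 1 - α
of u'. Cauchy-Schwarz gives the square of the kernel, t^(2α-1)/(2α-1), times the L² norm of W over
the line, which is a Riesz form by `causal_sq`. -/
lemma sq_primitive_le_of_lt (hT : 0 < T) (hα : α ∈ Ioo (1 / 2 : ℝ) 1) {p : ℝ → ℝ}
    (hp : MemWt T α p) {t : ℝ} (ht : t ∈ Icc 0 T) :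
    (∫ s in (0 : ℝ)..t, wt T α s * p s) ^ 2 ≤
      T ^ (2 * α - 1) / (Real.Gamma α ^ 2 * |Real.cos (Real.pi * α)| * (2 * α - 1)) *
        ((1 / 2) * ∫ s, wt T α s * p s * Aop α (fun s => wt T α s * p s) s) := by
  set g : ℝ → ℝ := fun s => wt T α s * p s with hg
  have hα0 : 0 < α := by linarith [hα.1]
  have h1α : 0 < 1 - α := by linarith [hα.2]
  have hgm : AEStronglyMeasurable g := measurable_wt.aestronglyMeasurable.mul hp.1
  have hg0 : ∀ s ∉ Ioo 0 T, g s = 0 := fun s hs => by simp [hg, wt_of_notMem hs]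
  have hgi : Integrable g := hp.integrable hT hα0
  have hR : Integrable fun z : ℝ × ℝ => |z.1 - z.2| ^ (1 - 2 * α) * (g z.1 * g z.2) :=
    integrable_riesz_pair hα hp hp
  obtain ⟨hW1, hW2⟩ := causal_sq hα hgm hR
  set W := causal (1 - α) g with hW
  have hker1 : ∀ x : ℝ, ker (α + (1 - α)) x = (Ioi (0 : ℝ)).indicator 1 x := by
    intro x
    simp [ker, indicator]
  have hi : Integrable fun s => ker (α + (1 - α)) (t - s) * g s := by
    refine hgi.mono ((Measurable.aestronglyMeasurable (by fun_prop)).mul hgm)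
      (.of_forall fun s => ?_)
    rw [norm_mul]
    refine mul_le_of_le_one_left (norm_nonneg _) ?_
    rw [hker1]
    by_cases h : t - s ∈ Ioi (0 : ℝ)
    · rw [indicator_of_mem h]; simp
    · rw [indicator_of_notMem h]; simp
  obtain ⟨hu1, hu2⟩ := causal_comp hα0 h1α hgm hi
  have hu3 : ∫ s, ker (α + (1 - α)) (t - s) * g s = ∫ s in (0 : ℝ)..t, g s := by
    rw [intervalIntegral.integral_of_le ht.1, integral_Ioc_eq_integral_Ioo,
      ← integral_indicator measurableSet_Ioo]
    congr 1; ext s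
    rw [hker1]
    by_cases hs : s ∈ Ioo 0 t
    · rw [indicator_of_mem hs, indicator_of_mem (show t - s ∈ Ioi (0 : ℝ) from sub_pos.2 hs.2)]
      simp
    · rw [indicator_of_notMem hs]
      by_cases h : t - s ∈ Ioi (0 : ℝ)
      · have : s ∉ Ioo 0 T := fun h' => hs ⟨h'.1, sub_pos.1 h⟩
        rw [hg0 s this, mul_zero]
      · rw [indicator_of_notMem h, zero_mul]
  -- W vanishes to the left of 0, so the kernel may be cut to (0,t), where it is square integrable
  -- because 2α - 2 > -1.
  set k : ℝ → ℝ := (Ioo 0 t).indicator (fun τ => (t - τ) ^ (α - 1)) with hk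
  have hkW : ∀ τ, ker α (t - τ) * W τ = k τ * W τ := by
    intro τ
    by_cases hτ : τ ∈ Ioo 0 t
    · rw [hk, indicator_of_mem hτ, ker_of_pos (by linarith [hτ.2])]
    · rw [hk, indicator_of_notMem hτ, zero_mul]
      by_cases h : 0 < τ
      · rw [ker_of_nonpos (x := t - τ), zero_mul]
        by_contra h'
        exact hτ ⟨h, by linarith⟩
      · rw [hW, causal_of_nonpos hg0 (not_lt.1 h), mul_zero]
  have hksq : (fun τ => k τ ^ 2) = (Ioo 0 t).indicator (fun τ => (t - τ) ^ (2 * α - 1 - 1)) := by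
    ext τ
    by_cases hτ : τ ∈ Ioo 0 t
    · rw [hk, indicator_of_mem hτ, indicator_of_mem hτ, ← Real.rpow_natCast, ← Real.rpow_mul
        (by linarith [hτ.2])]
      congr 1; push_cast; ring
    · rw [hk, indicator_of_notMem hτ, indicator_of_notMem hτ]; simp
  have hint : IntervalIntegrable (fun τ => (t - τ) ^ (2 * α - 1 - 1)) volume 0 t := by
    have := (intervalIntegral.intervalIntegrable_rpow' (a := 0) (b := t) (r := 2 * α - 1 - 1)
      (by linarith [hα.1])).comp_sub_left t
    simpa using this.symm
  have hk1 : Integrable fun τ => k τ ^ 2 := by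
    rw [hksq, integrable_indicator_iff measurableSet_Ioo]
    exact ((intervalIntegrable_iff_integrableOn_Ioo_of_le ht.1).1 hint)
  have hk2 : ∫ τ, k τ ^ 2 = t ^ (2 * α - 1) / (2 * α - 1) := by
    rw [hksq, integral_indicator measurableSet_Ioo, ← integral_Ioc_eq_integral_Ioo,
      ← intervalIntegral.integral_of_le ht.1]
    rw [intervalIntegral.integral_comp_sub_left (fun x => x ^ (2 * α - 1 - 1)) t, sub_self,
      sub_zero, integral_rpow (Or.inl (by linarith [hα.1])), sub_add_cancel,
      Real.zero_rpow (by linarith [hα.1]), sub_zero]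
  have hu1' : Integrable fun τ => k τ * W τ := hu1.congr (.of_forall hkW)
  have hu2' : ∫ τ, k τ * W τ =
      ProbabilityTheory.beta α (1 - α) * ∫ s, ker (α + (1 - α)) (t - s) * g s := by
    rw [← hu2]; exact integral_congr_ae (.of_forall fun τ => (hkW τ).symm)
  have hcs := sq_integral_mul_le hk1 hW1 hu1'
  rw [hu2', hu3, hk2, hW2] at hcs
  have hQ := integral_riesz_eq (g := g) hα.2.ne hR
  rw [show ∫ s, wt T α s * p s * Aop α (fun s => wt T α s * p s) s = ∫ s, g s * Aop α g s from rfl,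
    hQ]
  set I := ∫ z : ℝ × ℝ, |z.1 - z.2| ^ (1 - 2 * α) * (g z.1 * g z.2)
  set u := ∫ s in (0 : ℝ)..t, g s
  have hid := gamma_identity hα
  simp only [ProbabilityTheory.beta] at hcs hW2
  rw [show 2 * α - 1 + (1 - α) = α by ring] at hcs hW2
  rw [show α + (1 - α) = 1 by ring, Real.Gamma_one, div_one] at hcs
  have g1 := Real.Gamma_pos_of_pos hα0
  have g2 := Real.Gamma_pos_of_pos h1α
  have g3 := Real.Gamma_pos_of_pos (show 0 < 2 * α - 1 by linarith [hα.1])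
  have g4 := Real.Gamma_pos_of_pos (show 0 < 2 - 2 * α by linarith [hα.2])
  have hI : 0 ≤ I := by
    have h1 : 0 ≤ ∫ t, W t ^ 2 := integral_nonneg fun t => sq_nonneg _
    rw [hW2] at h1
    exact nonneg_of_mul_nonneg_right h1 (by positivity)
  have htT : t ^ (2 * α - 1) ≤ T ^ (2 * α - 1) :=
    Real.rpow_le_rpow ht.1 ht.2 (by linarith [hα.1])
  have hc : 0 < |Real.cos (Real.pi * α)| := by
    rcases (abs_nonneg (Real.cos (Real.pi * α))).eq_or_lt with h | h
    · rw [← h, mul_zero] at hid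
      exact absurd hid (mul_pos g1 g2).ne
    · exact h
  have hd : 0 < 2 * α - 1 := by linarith [hα.1]
  generalize Real.Gamma α = G1 at *
  generalize Real.Gamma (1 - α) = G2 at *
  generalize Real.Gamma (2 * α - 1) = G3 at *
  generalize Real.Gamma (2 - 2 * α) = G4 at *
  generalize |Real.cos (Real.pi * α)| = c at *
  generalize 2 * α - 1 = d at *
  have e1 : u ^ 2 ≤ (t ^ d / d * (G3 * G2 / G1 * I)) / (G1 * G2) ^ 2 := by
    rw [le_div_iff₀ (by positivity)]; linarith
  refine e1.trans ?_
  -- The Gamma identity trades the Beta factors for |cos(πα)| and the normalisation of `Aop`.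
  have e2 : (t ^ d / d * (G3 * G2 / G1 * I)) / (G1 * G2) ^ 2 =
      t ^ d / (G1 ^ 2 * c * d) * (1 / 2 * (1 / G4 * I)) := by
    have : G1 * G2 = 2 * G3 * G4 * c := hid.symm
    field_simp
    linear_combination (-(t ^ d * I)) * this
  rw [e2]
  gcongr

/-- For α = 1 the weight is the indicator of (0,T), κ/T equals T, and the bound is ordinary
Cauchy-Schwarz. The factor 1/2 matches the eigenvalues `lam`, which belong to half of `Aop`. -/
lemma sq_primitive_le (hT : 0 < T) (hα : α ∈ Ioc (1 / 2 : ℝ) 1) {p : ℝ → ℝ}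
    (hp : MemWt T α p) {t : ℝ} (ht : t ∈ Icc 0 T) :
    (∫ s in (0 : ℝ)..t, wt T α s * p s) ^ 2 ≤ kappa T α / T *
        ((1 / 2) * ∫ s, wt T α s * p s * Aop α (fun s => wt T α s * p s) s) := by
  by_cases h : α = 1
  · subst h
    have hk : kappa T 1 / T = T := by
      rw [kappa, mul_one Real.pi, Real.cos_pi, Real.Gamma_one, mul_one,
        show (2 : ℝ) = ((2 : ℕ) : ℝ) by norm_num, Real.rpow_natCast]
      field_simp
      norm_num
    have hsq : ∀ s, wt T 1 s * wt T 1 s = wt T 1 s := fun s => by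
      by_cases hs : s ∈ Ioo 0 T
      · rw [wt_of_mem hs]; simp
      · rw [wt_of_notMem hs]; simp
    set k : ℝ → ℝ := (Ioo 0 t).indicator 1 with hk1
    have hk2 : (fun s => k s ^ 2) = k := by
      ext s
      by_cases hs : s ∈ Ioo 0 t
      · simp [hk1, hs]
      · simp [hk1, hs]
    have hki : Integrable k := by
      rw [hk1, integrable_indicator_iff measurableSet_Ioo]
      exact integrableOn_const (by simp)
    have hkv : ∫ s, k s = t := by
      rw [hk1, integral_indicator measurableSet_Ioo]
      simp [ht.1]
    have hg2 : (fun s => (wt T 1 s * p s) ^ 2) = fun s => wt T 1 s * p s ^ 2 := by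
      ext s; rw [mul_pow, pow_two (wt T 1 s), hsq]
    have hu : ∫ s, k s * (wt T 1 s * p s) = ∫ s in (0 : ℝ)..t, wt T 1 s * p s := by
      rw [intervalIntegral.integral_of_le ht.1, integral_Ioc_eq_integral_Ioo,
        ← integral_indicator measurableSet_Ioo]
      congr 1; ext s
      by_cases hs : s ∈ Ioo 0 t
      · simp [hk1, hs]
      · simp [hk1, hs]
    have hgi := hp.integrable hT one_pos
    have hcs := sq_integral_mul_le (f := k) (g := fun s => wt T 1 s * p s) (by rwa [hk2])
      (by rw [hg2]; exact hp.2) (hgi.bdd_mul (c := 1) hki.aestronglyMeasurable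
        (.of_forall fun s => by
          by_cases hs : s ∈ Ioo 0 t
          · simp [hk1, hs]
          · simp [hk1, hs]))
    rw [hk2, hkv, hg2, hu] at hcs
    have hQ : (1 / 2 : ℝ) * ∫ s, wt T 1 s * p s * Aop 1 (fun s => wt T 1 s * p s) s =
        ∫ s, wt T 1 s * p s ^ 2 := by
      rw [← integral_const_mul]
      congr 1; ext s
      simp only [Aop, if_pos]
      linear_combination (p s ^ 2) * hsq s
    rw [hk, hQ]
    exact hcs.trans (mul_le_mul_of_nonneg_right ht.2
      (integral_nonneg fun s => mul_nonneg (wt_nonneg s) (sq_nonneg _)))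
  · have hα' : α ∈ Ioo (1 / 2 : ℝ) 1 := ⟨hα.1, lt_of_le_of_ne hα.2 h⟩
    have hk : kappa T α / T =
        T ^ (2 * α - 1) / (Real.Gamma α ^ 2 * |Real.cos (Real.pi * α)| * (2 * α - 1)) := by
      rw [kappa, div_right_comm, ← Real.rpow_sub_one hT.ne']
    rw [hk]
    exact sq_primitive_le_of_lt hT hα' hp ht

lemma kappa_pos (hT : 0 < T) (hα : α ∈ Ioc (1 / 2 : ℝ) 1) : 0 < kappa T α := by
  have hc : Real.cos (Real.pi * α) < 0 := Real.cos_neg_of_pi_div_two_lt_of_lt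
    (by nlinarith [Real.pi_pos, hα.1]) (by nlinarith [Real.pi_pos, hα.2])
  have h1 := Real.Gamma_pos_of_pos (show 0 < α by linarith [hα.1])
  have h2 := abs_pos.2 hc.ne
  have h3 : 0 < 2 * α - 1 := by linarith [hα.1]
  have h4 := Real.rpow_pos_of_pos hT (2 * α)
  unfold kappa; positivity

end Pointwise

/-! ### Completeness and expansions in the weighted space -/

section WeightedL2

open Polynomial

variable {T α : ℝ}

/-- A compactly supported integrable function is determined by its moments. -/
lemma ae_eq_zero_of_moments {Z : ℝ → ℝ} (hZ : Integrable Z) (hZ0 : ∀ t ∉ Icc 0 T, Z t = 0)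
    (h : ∀ q : ℝ[X], ∫ t, Z t * q.eval t = 0) : Z =ᵐ[volume] 0 := by
  refine ae_eq_zero_of_integral_contDiff_smul_eq_zero hZ.locallyIntegrable fun g hg hgc => ?_
  simp only [smul_eq_mul]
  have hgi : Integrable fun t => g t * Z t := by
    obtain ⟨B, hB⟩ := hgc.exists_bound_of_continuous hg.continuous
    exact hZ.bdd_mul hg.continuous.aestronglyMeasurable (.of_forall hB)
  by_contra hne
  set I := ∫ t, g t * Z t
  have hN : 0 ≤ ∫ t, ‖Z t‖ := integral_nonneg fun t => norm_nonneg _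
  have hI : 0 < |I| := abs_pos.2 hne
  -- Chosen so that replacing g by a polynomial within ε on [0,T] costs at most |I|/2, while the
  -- polynomial integral is 0.
  set ε := |I| / (2 * ((∫ t, ‖Z t‖) + 1)) with hε
  have hε0 : 0 < ε := by positivity
  obtain ⟨q, hq⟩ := exists_polynomial_near_of_continuousOn 0 T g hg.continuous.continuousOn ε hε0
  have hqi : Integrable fun t => Z t * q.eval t := by
    rw [← integrableOn_iff_integrable_of_support_subset (s := Icc 0 T)]
    · exact hZ.integrableOn.mul_continuousOn q.continuous.continuousOn isCompact_Icc
    · intro t ht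
      by_contra h'
      exact ht (by simp [hZ0 t h'])
  have h1 : I = ∫ t, (g t * Z t - Z t * q.eval t) := by
    rw [integral_sub hgi hqi, h q, sub_zero]
  have h2 : |I| ≤ ∫ t, ε * ‖Z t‖ := by
    rw [h1]
    refine (norm_integral_le_integral_norm _).trans
      (integral_mono (hgi.sub hqi).norm (hZ.norm.const_mul _) fun t => ?_)
    change ‖g t * Z t - Z t * q.eval t‖ ≤ _
    by_cases ht : t ∈ Icc 0 T
    · rw [show g t * Z t - Z t * q.eval t = -(q.eval t - g t) * Z t by ring, norm_mul, norm_neg]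
      exact mul_le_mul_of_nonneg_right (hq t ht).le (norm_nonneg _)
    · simp [hZ0 t ht]
  rw [integral_const_mul, hε, div_mul_eq_mul_div, le_div_iff₀ (by positivity)] at h2
  nlinarith

lemma memLp_sqrt_wt (p : ℝ → ℝ) (hp : MemWt T α p) :
    MemLp (fun t => √(wt T α t) * p t) 2 := by
  rw [memLp_two_iff_integrable_sq]
  · refine hp.2.congr (.of_forall fun t => ?_)
    simp only
    rw [mul_pow, Real.sq_sqrt (wt_nonneg t)]
  · exact (measurable_wt.sqrt.aestronglyMeasurable).mul hp.1

/-- Multiplication by √`wt` sends the b m to an orthonormal family of unweighted L², where the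
series is summed; the limit is then divided by √`wt`. -/
lemma exists_riesz_fischer (hT : 0 < T) (hα : 0 < α) {b : ℕ → ℝ[X]}
    (hb : ∀ m n, bil T α (b m) (b n) = if m = n then 1 else 0) {c : ℕ → ℝ}
    (hc : Summable fun m => c m ^ 2) :
    ∃ p : ℝ → ℝ, MemWt T α p ∧
      Tendsto (fun N => ∫ t, wt T α t * (p t - (∑ m ∈ Finset.range N, c m • b m).eval t) ^ 2)
        atTop (𝓝 0) := by
  have hmem : ∀ q : ℝ[X], MemLp (fun t => √(wt T α t) * q.eval t) 2 := fun q =>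
    memLp_sqrt_wt _ (MemWt.of_continuousOn hT hα q.continuous)
  let V : ℝ[X] →ₗ[ℝ] Lp ℝ 2 (volume : Measure ℝ) :=
    { toFun := fun q => (hmem q).toLp _
      map_add' := fun p q => by
        rw [← MemLp.toLp_add]
        congr 1; ext t; simp only [eval_add, Pi.add_apply]; ring
      map_smul' := fun a q => by
        simp only [RingHom.id_apply]
        rw [← MemLp.toLp_const_smul]
        congr 1; ext t; simp only [eval_smul, Pi.smul_apply, smul_eq_mul]; ring }
  have hV : ∀ q, (V q : ℝ → ℝ) =ᵐ[volume] fun t => √(wt T α t) * q.eval t := fun q =>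
    (hmem q).coeFn_toLp
  have hinner : ∀ p q, inner ℝ (V p) (V q) = bil T α p q := by
    intro p q
    rw [L2.inner_def, bil]
    refine integral_congr_ae ?_
    filter_upwards [hV p, hV q] with t h1 h2
    rw [h1, h2]
    simp only [RCLike.inner_apply, conj_trivial]
    linear_combination (p.eval t * q.eval t) * (Real.mul_self_sqrt (wt_nonneg (T := T) (α := α) t))
  have hon : Orthonormal ℝ fun m => V (b m) := by
    rw [orthonormal_iff_ite]
    intro m n
    rw [hinner, hb]
  have hsum : Summable fun m => c m • V (b m) := by
    have := (hon.orthogonalFamily.summable_iff_norm_sq_summable c).2 (by simpa using hc)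
    simpa using this
  set P : Lp ℝ 2 (volume : Measure ℝ) := ∑' m, c m • V (b m)
  have hPm : AEStronglyMeasurable (P : ℝ → ℝ) volume := Lp.aestronglyMeasurable P
  have hP2 : Integrable fun t => P t ^ 2 := (memLp_two_iff_integrable_sq hPm).1 (Lp.memLp P)
  -- Outside (0,T) this is a division by zero, hence 0. The weight vanishes there too, so later
  -- comparisons with P are inequalities.
  set p : ℝ → ℝ := fun t => P t / √(wt T α t) with hp
  have hpw : ∀ t ∈ Ioo 0 T, √(wt T α t) * p t = P t := fun t ht => by
    have := (Real.sqrt_pos.2 (wt_pos (α := α) ht)).ne'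
    rw [hp]; field_simp
  have hpm : AEStronglyMeasurable p := by
    have h1 : AEStronglyMeasurable (fun t => (√(wt T α t))⁻¹) volume :=
      (measurable_wt.sqrt.inv).aestronglyMeasurable
    exact (hPm.mul h1).congr (.of_forall fun t => (div_eq_mul_inv _ _).symm)
  have hpm2 : MemWt T α p := by
    refine ⟨hpm, hP2.mono' (measurable_wt.aestronglyMeasurable.mul (hpm.pow 2))
      (.of_forall fun t => ?_)⟩
    rw [Real.norm_of_nonneg (mul_nonneg (wt_nonneg t) (sq_nonneg _))]
    by_cases ht : t ∈ Ioo 0 T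
    · rw [← hpw t ht, mul_pow, Real.sq_sqrt (wt_nonneg t)]
    · rw [wt_of_notMem ht, zero_mul]; positivity
  refine ⟨p, hpm2, ?_⟩
  have h1 : Tendsto (fun N => ‖P - V (∑ m ∈ Finset.range N, c m • b m)‖ ^ 2) atTop (𝓝 0) := by
    have h2 := (hsum.hasSum.tendsto_sum_nat.const_sub P).norm.pow 2
    rw [sub_self, norm_zero, zero_pow two_ne_zero] at h2
    refine h2.congr fun N => ?_
    rw [map_sum]
    simp_rw [map_smul]
  refine squeeze_zero (fun N => integral_nonneg fun t => mul_nonneg (wt_nonneg t) (sq_nonneg _))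
    (fun N => ?_) h1
  set q := ∑ m ∈ Finset.range N, c m • b m
  have h3 : (P - V q : Lp ℝ 2 (volume : Measure ℝ)) =ᵐ[volume]
      fun t => P t - √(wt T α t) * q.eval t := by
    filter_upwards [Lp.coeFn_sub P (V q), hV q] with t ht ht'
    rw [ht, Pi.sub_apply, ht']
  have h4 : Integrable fun t => (P t - √(wt T α t) * q.eval t) ^ 2 := by
    refine ((memLp_two_iff_integrable_sq (Lp.aestronglyMeasurable (P - V q))).1
      (Lp.memLp _)).congr ?_
    filter_upwards [h3] with t ht
    rw [ht]
  rw [← real_inner_self_eq_norm_sq, L2.inner_def]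
  have h5 : ∫ t, inner ℝ ((P - V q : Lp ℝ 2 (volume : Measure ℝ)) t)
      ((P - V q : Lp ℝ 2 (volume : Measure ℝ)) t) =
      ∫ t, (P t - √(wt T α t) * q.eval t) ^ 2 := by
    refine integral_congr_ae ?_
    filter_upwards [h3] with t ht
    rw [ht]
    simp only [RCLike.inner_apply, conj_trivial]
    ring
  rw [h5]
  refine integral_mono_of_nonneg
    (.of_forall fun t => mul_nonneg (wt_nonneg t) (sq_nonneg _)) h4 (.of_forall fun t => ?_)
  simp only
  by_cases ht : t ∈ Ioo 0 T
  · rw [← hpw t ht, ← mul_sub, mul_pow, Real.sq_sqrt (wt_nonneg t)]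
  · rw [wt_of_notMem ht, zero_mul]; positivity

/-- Weighted integrals are continuous for the weighted square norm. -/
lemma sq_integral_wt_mul_le {p q : ℝ → ℝ} (hp : MemWt T α p)
    (hq : MemWt T α q) :
    Integrable (fun t => wt T α t * (p t * q t)) ∧
    (∫ t, wt T α t * (p t * q t)) ^ 2 ≤
      (∫ t, wt T α t * p t ^ 2) * ∫ t, wt T α t * q t ^ 2 := by
  have h1 : Integrable fun t => wt T α t * (p t * q t) := by
    refine (hp.2.add hq.2).mono' (measurable_wt.aestronglyMeasurable.mul (hp.1.mul hq.1))
      (.of_forall fun t => ?_)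
    rw [norm_mul, Real.norm_of_nonneg (wt_nonneg t), norm_mul, Real.norm_eq_abs, Real.norm_eq_abs,
      Pi.add_apply]
    have := wt_nonneg (T := T) (α := α) t
    nlinarith [mul_nonneg this (sq_nonneg (|p t| - |q t|)), sq_abs (p t), sq_abs (q t),
      mul_nonneg this (sq_nonneg (p t)), mul_nonneg this (sq_nonneg (q t))]
  have e : ∀ p : ℝ → ℝ, (fun t => (√(wt T α t) * p t) ^ 2) = fun t => wt T α t * p t ^ 2 := by
    intro p; ext t; rw [mul_pow, Real.sq_sqrt (wt_nonneg t)]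
  have e2 : (fun t => √(wt T α t) * p t * (√(wt T α t) * q t)) =
      fun t => wt T α t * (p t * q t) := by
    ext t
    linear_combination (p t * q t) * Real.mul_self_sqrt (wt_nonneg (T := T) (α := α) t)
  have := sq_integral_mul_le (μ := volume) (f := fun t => √(wt T α t) * p t)
    (g := fun t => √(wt T α t) * q t) (by rw [e]; exact hp.2) (by rw [e]; exact hq.2)
    (by rw [e2]; exact h1)
  rw [e, e, e2] at this
  exact ⟨h1, this⟩

/-- The weighted inner product as a bilinear map. -/
noncomputable def bilL (hT : 0 < T) (hα : 0 < α) : ℝ[X] →ₗ[ℝ] ℝ[X] →ₗ[ℝ] ℝ :=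
  LinearMap.mk₂ ℝ (bil T α) (bil_add_left hT hα) (fun c p q => bil_smul_left c p q)
    (fun p q q' => by rw [bil_comm, bil_add_left hT hα, bil_comm q, bil_comm q'])
    (fun c p q => by rw [bil_comm, bil_smul_left, bil_comm, smul_eq_mul])

lemma bil_sum_sum (hT : 0 < T) (hα : 0 < α) {b : ℕ → ℝ[X]}
    (hb : ∀ m n, bil T α (b m) (b n) = if m = n then 1 else 0) (x y : ℕ → ℝ) (s : Finset ℕ) :
    bil T α (∑ m ∈ s, x m • b m) (∑ m ∈ s, y m • b m) =
      ∑ m ∈ s, x m * y m := by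
  change bilL hT hα _ _ = _
  rw [LinearMap.map_sum₂]
  refine Finset.sum_congr rfl fun m hm => ?_
  rw [map_sum]
  have : ∀ n, bilL hT hα (x m • b m) (y n • b n) = if m = n then x m * y m else 0 := by
    intro n
    rw [map_smul, map_smul, LinearMap.smul_apply]
    change y n * (x m * bil T α (b m) (b n)) = _
    rw [hb]
    split_ifs with h
    · subst h; ring
    · ring
  simp_rw [this]
  rw [Finset.sum_ite_eq, if_pos hm]

end WeightedL2

lemma bddAbove_primitive {f : ℝ → ℝ} (hf : Continuous f) (γ : ℝ) :
    BddAbove ((fun ξ : ℝ => ∫ t in (0 : ℝ)..ξ, f t) '' Icc (-γ) γ) := by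
  have hF : Continuous fun ξ : ℝ => ∫ t in (0 : ℝ)..ξ, f t :=
    intervalIntegral.continuous_primitive (fun a b => hf.intervalIntegrable a b) 0
  exact (isCompact_Icc.image hF).bddAbove

/-- Some γ already beats κ in the supremum. If the maximum is not positive, the inequality needs no
information from the quotient. -/
lemma exists_radius {T α : ℝ} (hT : 0 < T) (hα : α ∈ Ioc (1 / 2 : ℝ) 1) {f : ℝ → ℝ}
    (hSG : growthSup f > ENNReal.ofReal (kappa T α)) :
    ∃ γ : ℝ, 0 < γ ∧ kappa T α * maxPrimitive f γ < γ ^ 2 := by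
  unfold growthSup at hSG
  rw [gt_iff_lt, lt_iSup_iff] at hSG
  obtain ⟨γ, hγ⟩ := hSG
  rw [lt_iSup_iff] at hγ
  obtain ⟨hγ0, hγ⟩ := hγ
  refine ⟨γ, hγ0, ?_⟩
  have hκ := kappa_pos hT hα
  rcases le_or_gt (maxPrimitive f γ) 0 with h | h
  · nlinarith [pow_pos hγ0 2]
  · rw [← ENNReal.ofReal_div_of_pos h, ENNReal.ofReal_lt_ofReal_iff (by positivity),
      lt_div_iff₀ h] at hγ
    exact hγ

/-! ### The critical point and its Euler-Lagrange equation -/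

section Core

open Polynomial

variable {T α : ℝ}

/-- Simultaneous diagonalisation of the principal operator and the Sturm-Liouville operator. -/
lemma exists_spectral (hT : 0 < T) (hα : α ∈ Ioc (1 / 2 : ℝ) 1) :
    ∃ (o : ℕ → ℝ[X]) (K : ℝ[X] →ₗ[ℝ] ℝ[X]),
      (∀ m n, bil T α (o m) (o n) = if m = n then 1 else 0) ∧ Submodule.span ℝ (range o) = ⊤ ∧
      (∀ p : ℝ[X], ∀ x ∈ Ioo 0 T, Aop α (fun y => wt T α y * p.eval y) x = 2 * (K p).eval x) ∧
      (∀ n, K (o n) = lam α n • o n) ∧ (∀ n, sl T α (o n) = ell α n • o n) := by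
  have hα0 : 0 < α := by linarith [hα.1]
  obtain ⟨o, ho1, ho2, ho3, ho4⟩ := exists_orthonormal_poly hT hα0
  obtain ⟨K, hK1, hK2⟩ := exists_Aop_poly hα hT
  have hKsymm : ∀ p q, bil T α (K p) q = bil T α p (K q) := by
    have key : ∀ p q : ℝ[X], 2 * bil T α (K p) q =
        ∫ t, wt T α t * q.eval t * Aop α (fun s => wt T α s * p.eval s) t := by
      intro p q
      rw [bil, ← integral_const_mul]
      congr 1; ext t
      by_cases ht : t ∈ Ioo 0 T
      · rw [hK2 p t ht]; ring
      · rw [wt_of_notMem ht]; ring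
    intro p q
    have h1 := Aop_symm hα (MemWt.of_continuousOn hT hα0 p.continuous)
      (MemWt.of_continuousOn hT hα0 q.continuous)
    rw [← key, ← key] at h1
    rw [bil_comm p]; linarith
  refine ⟨o, K, fun m n => ?_, ho4, hK2, eigen_of_symm hT hα0 ho1 ho3 hK1 hKsymm,
    eigen_of_symm hT hα0 ho1 ho3 isTri_sl (bil_sl_symm hα0 hT)⟩
  split_ifs with h
  · rw [h, ho2]
  · rcases lt_or_gt_of_ne h with h | h
    · rw [bil_comm]; exact ho3 n _ (degreeLT_mono (Nat.succ_le_of_lt h) (ho1 m))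
    · exact ho3 m _ (degreeLT_mono (Nat.succ_le_of_lt h) (ho1 n))

/-- The quantitative bound, beyond positivity, is what the decay of the coefficients uses; it holds
because 2α - 1 ≥ 0. -/
lemma ell_pos (hα : α ∈ Ioc (1 / 2 : ℝ) 1) (n : ℕ) : ((n : ℝ) + 1) ^ 2 ≤ ell α (n + 1) := by
  rw [ell]; push_cast
  have : (0 : ℝ) ≤ n := n.cast_nonneg
  nlinarith [hα.1]

/-- The Bessel inequality for the derivatives of the orthogonal polynomials. -/
lemma bessel_derivative (hT : 0 < T) (hα : α ∈ Ioc (1 / 2 : ℝ) 1) {o : ℕ → ℝ[X]}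
    (ho : ∀ m n, bil T α (o m) (o n) = if m = n then 1 else 0)
    (hsl : ∀ n, sl T α (o n) = ell α n • o n) {h : ℝ → ℝ}
    (hm : AEStronglyMeasurable h (volume.restrict (Ioc 0 T))) {B : ℝ}
    (hB : ∀ t ∈ Icc 0 T, |h t| ≤ B) (N : ℕ) :
    ∑ m ∈ Finset.range N, (∫ t in (0 : ℝ)..T, h t *
      (sw T α t * (derivative (o (m + 1))).eval t)) ^ 2 / ell α (m + 1) ≤
      ∫ t in (0 : ℝ)..T, sw T α t * h t ^ 2 := by
  have hα0 : 0 < α := by linarith [hα.1]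
  have hℓ : ∀ m, 0 < ell α (m + 1) := fun m => lt_of_lt_of_le (by positivity) (ell_pos hα m)
  set d : ℕ → ℝ := fun m => ∫ t in (0 : ℝ)..T, h t *
    (sw T α t * (derivative (o (m + 1))).eval t) with hd
  have hmem : ∀ᵐ t ∂(volume.restrict (Ioc 0 T)), t ∈ Icc 0 T :=
    (ae_restrict_mem measurableSet_Ioc).mono fun t ht => Ioc_subset_Icc_self ht
  have hint : ∀ g : ℝ → ℝ, Continuous g → IntervalIntegrable (fun t => h t * g t) volume 0 T := by
    intro g hg
    rw [intervalIntegrable_iff_integrableOn_Ioc_of_le hT.le]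
    exact (hg.integrableOn_Icc.mono_set Ioc_subset_Icc_self).bdd_mul hm
      (hmem.mono fun t ht => hB t ht)
  have hint2 : IntervalIntegrable (fun t => sw T α t * h t ^ 2) volume 0 T := by
    rw [intervalIntegrable_iff_integrableOn_Ioc_of_le hT.le]
    refine ((continuous_sw hα0).integrableOn_Icc.mono_set Ioc_subset_Icc_self).mul_bdd
      (c := B ^ 2) (hm.pow 2) (hmem.mono fun t ht => ?_)
    rw [norm_pow]
    exact pow_le_pow_left₀ (norm_nonneg _) (hB t ht) 2
  -- The derivatives of the o (m+1) are orthogonal for `sw` with squared norms `ell`, so R' is the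
  -- projection of h onto their span. Expanding the square of h - R' gives the inequality.
  set R : ℝ[X] := ∑ m ∈ Finset.range N, (d m / ell α (m + 1)) • o (m + 1) with hR
  have hRR : ∫ t in (0 : ℝ)..T, sw T α t * ((derivative R).eval t * (derivative R).eval t) =
      ∑ m ∈ Finset.range N, d m ^ 2 / ell α (m + 1) := by
    rw [← bil_sl hα0 hT, hR, map_sum]
    have e : ∀ m, sl T α ((d m / ell α (m + 1)) • o (m + 1)) = d m • o (m + 1) := by
      intro m
      rw [map_smul, hsl, smul_smul, div_mul_cancel₀ _ (hℓ m).ne']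
    simp_rw [e]
    rw [bil_sum_sum hT hα0 (b := fun m => o (m + 1)) (fun m n => by rw [ho]; simp)]
    refine Finset.sum_congr rfl fun m _ => ?_
    ring
  have hhR : ∫ t in (0 : ℝ)..T, h t * (sw T α t * (derivative R).eval t) =
      ∑ m ∈ Finset.range N, d m ^ 2 / ell α (m + 1) := by
    have e : ∀ t, h t * (sw T α t * (derivative R).eval t) = ∑ m ∈ Finset.range N,
        (d m / ell α (m + 1)) * (h t * (sw T α t * (derivative (o (m + 1))).eval t)) := by
      intro t
      rw [hR, map_sum, eval_finsetSum, Finset.mul_sum, Finset.mul_sum]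
      refine Finset.sum_congr rfl fun m _ => ?_
      rw [derivative_smul, eval_smul, smul_eq_mul]; ring
    simp_rw [e]
    rw [intervalIntegral.integral_finsetSum]
    · refine Finset.sum_congr rfl fun m _ => ?_
      rw [intervalIntegral.integral_const_mul]
      change d m / ell α (m + 1) * d m = _
      ring
    · intro m _
      exact (hint _ ((continuous_sw hα0).mul (derivative (o (m + 1))).continuous)).const_mul _
  have hcR := (derivative R).continuous
  have hcs := continuous_sw (T := T) hα0
  have i3 : IntervalIntegrable
      (fun t => sw T α t * ((derivative R).eval t * (derivative R).eval t)) volume 0 T :=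
    (by fun_prop : Continuous fun t =>
      sw T α t * ((derivative R).eval t * (derivative R).eval t)).intervalIntegrable _ _
  have i2 : IntervalIntegrable (fun t => h t * (sw T α t * (derivative R).eval t)) volume 0 T :=
    hint _ (hcs.mul hcR)
  have hnn : 0 ≤ ∫ t in (0 : ℝ)..T, sw T α t * (h t - (derivative R).eval t) ^ 2 :=
    intervalIntegral.integral_nonneg hT.le fun t ht =>
      mul_nonneg (sw_nonneg ht) (sq_nonneg _)
  have e : ∫ t in (0 : ℝ)..T, sw T α t * (h t - (derivative R).eval t) ^ 2 =
      (∫ t in (0 : ℝ)..T, sw T α t * h t ^ 2) -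
      2 * (∫ t in (0 : ℝ)..T, h t * (sw T α t * (derivative R).eval t)) +
      ∫ t in (0 : ℝ)..T, sw T α t * ((derivative R).eval t * (derivative R).eval t) := by
    rw [← intervalIntegral.integral_const_mul, ← intervalIntegral.integral_sub hint2
      (i2.const_mul 2), ← intervalIntegral.integral_add (hint2.sub (i2.const_mul 2)) i3]
    congr 1; ext t; ring
  rw [e, hhR, hRR] at hnn
  linarith

/-- Integration by parts moves the derivative from the eigenpolynomial onto the primitive of h; `sw`
kills both boundary terms. -/
lemma integral_wt_mul_primitive (hT : 0 < T) (hα : 0 < α) {q : ℝ[X]} {l : ℝ}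
    (hsl : sl T α q = l • q) {h : ℝ → ℝ} (hh : Continuous h) :
    l * ∫ t, wt T α t * (q.eval t * ∫ s in (0 : ℝ)..t, h s) =
      ∫ t in (0 : ℝ)..T, h t * (sw T α t * (derivative q).eval t) := by
  have hH : ∀ t, HasDerivAt (fun t => ∫ s in (0 : ℝ)..t, h s) (h t) t := fun t =>
    (hh.integral_hasStrictDerivAt 0 t).hasDerivAt
  have hHc : Continuous fun t => ∫ s in (0 : ℝ)..t, h s :=
    continuous_iff_continuousAt.2 fun t => (hH t).continuousAt
  have hs := continuous_sw (T := T) hα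
  have hq := (derivative q).continuous
  have hq' := q.continuous
  have i1 : IntervalIntegrable (fun t => wt T α t * (q.eval t * ∫ s in (0 : ℝ)..t, h s))
      volume 0 T :=
    (integrable_wt_mul hT hα (hq'.mul hHc).continuousOn).intervalIntegrable
  have i2 : IntervalIntegrable (fun t => h t * (sw T α t * (derivative q).eval t)) volume 0 T :=
    (hh.mul (hs.mul hq)).intervalIntegrable _ _
  have h1 := intervalIntegral.integral_eq_sub_of_hasDerivAt_of_le hT.le
    (f := fun t => sw T α t * (derivative q).eval t * ∫ s in (0 : ℝ)..t, h s)
    (f' := fun t => h t * (sw T α t * (derivative q).eval t) -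
      l * (wt T α t * (q.eval t * ∫ s in (0 : ℝ)..t, h s)))
    (by fun_prop)
    (fun t ht => ((hasDerivAt_sw_mul (α := α) ht q).mul (hH t)).congr_deriv (by
      rw [hsl, eval_smul, smul_eq_mul]; ring))
    (i2.sub (i1.const_mul l))
  rw [intervalIntegral.integral_sub i2 (i1.const_mul l), sw_zero hα, sw_right hα,
    intervalIntegral.integral_const_mul] at h1
  rw [integral_eq_intervalIntegral_wt hT fun t => q.eval t * ∫ s in (0 : ℝ)..t, h s]
  linarith

lemma integrable_wt_Aop (hα : α ∈ Ioc (1 / 2 : ℝ) 1) {p q : ℝ → ℝ}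
    (hp : MemWt T α p) (hq : MemWt T α q) :
    Integrable fun t => wt T α t * q t * Aop α (fun s => wt T α s * p s) t := by
  by_cases h : α = 1
  · subst h
    refine ((sq_integral_wt_mul_le hp hq).1.const_mul 2).congr (.of_forall fun t => ?_)
    simp only [Aop, if_pos]
    by_cases ht : t ∈ Ioo 0 T
    · rw [wt_of_mem ht, sub_self, Real.rpow_zero]; ring
    · rw [wt_of_notMem ht]; ring
  · have hα' : α ∈ Ioo (1 / 2 : ℝ) 1 := ⟨hα.1, lt_of_le_of_ne hα.2 h⟩
    have h1 := (integrable_riesz_pair hα' hq hp).integral_prod_left.const_mul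
      (1 / Real.Gamma (2 - 2 * α))
    refine h1.congr (.of_forall fun t => ?_)
    simp only [Aop, if_neg h]
    rw [mul_left_comm, ← integral_const_mul (wt T α t * q t)]
    congr 2; ext s; ring

end Core

section Core

open Polynomial

variable {T α : ℝ}

lemma MemWt.neg {p : ℝ → ℝ} (hp : MemWt T α p) : MemWt T α fun t => -p t := by
  simpa using hp.const_mul (-1)

lemma MemWt.sub {p q : ℝ → ℝ} (hp : MemWt T α p) (hq : MemWt T α q) :
    MemWt T α fun t => p t - q t := by
  simpa [sub_eq_add_neg] using hp.add hq.neg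

lemma MemWt.abs {p : ℝ → ℝ} (hp : MemWt T α p) : MemWt T α fun t => |p t| :=
  ⟨hp.1.norm, by simpa using hp.2⟩

/-- Cauchy-Schwarz against the constant 1. The constant is crude, but the bound makes u depend
uniformly and continuously on p. -/
lemma MemWt.sq_primitive_le (hT : 0 < T) (hα : 0 < α) {p : ℝ → ℝ} (hp : MemWt T α p) {t : ℝ}
    (ht : 0 ≤ t) : (∫ s in (0 : ℝ)..t, wt T α s * p s) ^ 2 ≤
      (∫ s, wt T α s) * ∫ s, wt T α s * p s ^ 2 := by
  have h1 := (sq_integral_wt_mul_le (MemWt.of_continuousOn hT hα continuous_one) hp.abs).2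
  simp only [Pi.one_apply, one_pow, mul_one, one_mul, sq_abs] at h1
  refine le_trans ?_ h1
  rw [← sq_abs]
  refine pow_le_pow_left₀ (abs_nonneg _) ?_ 2
  rw [intervalIntegral.integral_of_le ht]
  refine (abs_integral_le_integral_abs).trans ?_
  refine (setIntegral_le_integral (hp.integrable hT hα).abs
    (.of_forall fun s => abs_nonneg _)).trans (le_of_eq ?_)
  congr 1; ext s
  rw [abs_mul, abs_of_nonneg (wt_nonneg s)]

/-- Constants lie in the kernel of the symmetric operator `sl`, so eigenpolynomials with nonzero
eigenvalue are orthogonal to 1. -/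
lemma bil_succ_one (hT : 0 < T) (hα : α ∈ Ioc (1 / 2 : ℝ) 1) {q : ℝ[X]} {n : ℕ}
    (hq : sl T α q = ell α (n + 1) • q) : bil T α q 1 = 0 := by
  have hα0 : 0 < α := by linarith [hα.1]
  have h := bil_sl_symm hα0 hT q 1
  have h1 : sl T α 1 = 0 := by rw [sl_apply]; simp
  rw [hq, bil_smul_left, h1, bil_comm q 0, bil_comm q 1] at h
  rw [bil_comm]
  have h2 : bil T α 0 q = 0 := by simp [bil]
  rw [h2] at h
  refine (mul_eq_zero.1 h).resolve_left (ne_of_gt (lt_of_lt_of_le ?_ (ell_pos hα n)))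
  positivity

lemma intervalIntegral_wt_sum (hT : 0 < T) (hα : 0 < α) (b : ℕ → ℝ[X]) (c : ℕ → ℝ) (N : ℕ)
    (t : ℝ) : ∫ s in (0 : ℝ)..t, wt T α s * (∑ m ∈ Finset.range N, c m • b m).eval s =
      ∑ m ∈ Finset.range N, c m * ∫ s in (0 : ℝ)..t, wt T α s * (b m).eval s := by
  simp_rw [← intervalIntegral.integral_const_mul]
  rw [← intervalIntegral.integral_finsetSum]
  · congr 1; ext s
    rw [eval_finsetSum, Finset.mul_sum]
    refine Finset.sum_congr rfl fun m _ => ?_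
    rw [eval_smul, smul_eq_mul]; ring
  · intro m _
    exact ((integrable_wt_mul hT hα (b m).continuous.continuousOn).const_mul _).intervalIntegrable

/-- The eigenvalues decay no faster than n^(-(2-2α)). Each step is Bernoulli's inequality for the
exponent 2 - 2α in [0,1]. -/
lemma lam_one_le (hα : α ∈ Ioc (1 / 2 : ℝ) 1) (n : ℕ) :
    lam α 1 ≤ lam α (n + 1) * ((n : ℝ) + 1) ^ (2 - 2 * α) := by
  induction n with
  | zero => simp
  | succ n ih =>
    refine ih.trans ?_
    have hn : (0 : ℝ) < (n : ℝ) + 1 + 1 := by positivity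
    have h1 := rpow_one_add_le_one_add_mul_self (s := -(1 / ((n : ℝ) + 1 + 1)))
      (by rw [neg_le_neg_iff, div_le_one hn]; linarith [n.cast_nonneg (α := ℝ)])
      (p := 2 - 2 * α) (by linarith [hα.2]) (by linarith [hα.1])
    have h2 : 1 + -(1 / ((n : ℝ) + 1 + 1)) = ((n : ℝ) + 1) / ((n : ℝ) + 1 + 1) := by
      field_simp; ring
    rw [h2, Real.div_rpow (by positivity) hn.le, div_le_iff₀ (by positivity)] at h1
    have h3 : lam α (n + 1 + 1) = lam α (n + 1) *
        (1 + (2 - 2 * α) * -(1 / ((n : ℝ) + 1 + 1))) := by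
      rw [lam]; push_cast; field_simp; ring
    rw [h3, mul_assoc]
    push_cast
    exact mul_le_mul_of_nonneg_left h1 (lam_pos hα _).le

/-- The equation in weighted coordinates: the critical point of the action has a derivative
`wt * p` with `p` in the weighted `L²` space. -/
theorem exists_weighted_solution (hT : 0 < T) (hα : α ∈ Ioc (1 / 2 : ℝ) 1) {f : ℝ → ℝ}
    (hf : Continuous f) (hSG : growthSup f > ENNReal.ofReal (kappa T α)) :
    ∃ (p : ℝ → ℝ) (b : ℕ → ℝ[X]) (c : ℕ → ℝ), MemWt T α p ∧
      (∀ m n, bil T α (b m) (b n) = if m = n then 1 else 0) ∧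
      (∀ m, sl T α (b m) = ell α (m + 1) • b m) ∧
      (Summable fun m => c m ^ 2 * ((m : ℝ) + 1) ^ (4 * α - 2)) ∧
      Tendsto (fun N => ∫ t, wt T α t * (p t - (∑ m ∈ Finset.range N, c m • b m).eval t) ^ 2)
        atTop (𝓝 0) ∧
      ∫ t, wt T α t * p t = 0 ∧
      ∃ c : ℝ, ∀ᵐ x, x ∈ Ioo 0 T → Aop α (fun t => wt T α t * p t) x =
        c - ∫ s in (0 : ℝ)..x, f (∫ τ in (0 : ℝ)..s, wt T α τ * p τ) := by
  have hα0 : 0 < α := by linarith [hα.1]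
  obtain ⟨o, K, horth, hspan, hAop, hK, hsl⟩ := exists_spectral hT hα
  have hlam : ∀ n, 0 < lam α n := lam_pos hα
  have hell : ∀ m, 0 < ell α (m + 1) := fun m => lt_of_lt_of_le (by positivity) (ell_pos hα m)
  -- With c_m = a_m / s_m, half of the quadratic form of `Aop` becomes Σ a_m².
  set s : ℕ → ℝ := fun m => √(lam α (m + 1)) with hs
  have hs0 : ∀ m, 0 < s m := fun m => Real.sqrt_pos.2 (hlam _)
  have hss : ∀ m, s m * s m = lam α (m + 1) := fun m => Real.mul_self_sqrt (hlam _).le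
  -- The index shift drops the constant polynomial: every remaining `wt` · b m has mean zero, which
  -- forces u(T) = 0.
  set b : ℕ → ℝ[X] := fun m => o (m + 1) with hb
  have hborth : ∀ m n, bil T α (b m) (b n) = if m = n then 1 else 0 := fun m n => by
    simp [hb, horth]
  set e : ℕ → ℝ → ℝ := fun m t =>
    -(sw T α t * (derivative (b m)).eval t) / (ell α (m + 1) * s m) with he
  have hecont : ∀ m, Continuous (e m) := fun m => by
    have := continuous_sw (T := T) hα0
    have h2 := (derivative (b m)).continuous
    simp only [he]
    fun_prop
  have hint : ∀ m, ∀ t ∈ Icc 0 T, ∫ τ in (0 : ℝ)..t, wt T α τ * (b m).eval τ = s m * e m t := by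
    intro m t ht
    have h := integral_wt_sl hα0 hT (b m) ht
    have h2 : ∫ τ in (0 : ℝ)..t, wt T α τ * (sl T α (b m)).eval τ =
        ell α (m + 1) * ∫ τ in (0 : ℝ)..t, wt T α τ * (b m).eval τ := by
      rw [← intervalIntegral.integral_const_mul]
      congr 1; ext τ
      rw [hb, hsl, eval_smul, smul_eq_mul]; ring
    rw [h2] at h
    simp only [he]
    have := (hell m).ne'; have := (hs0 m).ne'
    field_simp
    linarith
  obtain ⟨γ, hγ, hγM⟩ := exists_radius hT hα hSG
  have hκ := kappa_pos hT hα
  have hC : ∀ t ∈ Icc 0 T, ∀ (N : ℕ) (a : ℕ → ℝ),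
      (∑ m ∈ Finset.range N, a m * e m t) ^ 2 ≤
        kappa T α / T * ∑ m ∈ Finset.range N, a m ^ 2 := by
    intro t ht N a
    set q : ℝ[X] := ∑ m ∈ Finset.range N, (a m / s m) • b m with hq
    have h := sq_primitive_le hT hα (MemWt.of_continuousOn hT hα0 q.continuous) ht
    have h1 : ∫ τ in (0 : ℝ)..t, wt T α τ * q.eval τ = ∑ m ∈ Finset.range N, a m * e m t := by
      rw [hq, intervalIntegral_wt_sum hT hα0]
      refine Finset.sum_congr rfl fun m _ => ?_
      rw [hint m t ht]
      have := (hs0 m).ne'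
      field_simp
    have h2 : (1 / 2) * ∫ τ, wt T α τ * q.eval τ * Aop α (fun s => wt T α s * q.eval s) τ =
        ∑ m ∈ Finset.range N, a m ^ 2 := by
      have h3 : K q = ∑ m ∈ Finset.range N, (a m * s m) • b m := by
        rw [hq, map_sum]
        refine Finset.sum_congr rfl fun m _ => ?_
        rw [map_smul, hb, hK, smul_smul, ← hss]
        congr 1
        have := (hs0 m).ne'
        field_simp
      have h4 : bil T α q (K q) = ∑ m ∈ Finset.range N, a m ^ 2 := by
        rw [h3, hq, bil_sum_sum hT hα0 hborth]
        refine Finset.sum_congr rfl fun m _ => ?_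
        have := (hs0 m).ne'
        field_simp
      rw [← h4, bil, ← integral_const_mul]
      congr 1; ext τ
      by_cases hτ : τ ∈ Ioo 0 T
      · rw [hAop q τ hτ]; ring
      · rw [wt_of_notMem hτ]; ring
    rwa [h1, h2] at h
  -- The radius r = γ²T/κ is the largest for which the pointwise bound keeps |u| ≤ γ, and T M < r is
  -- the hypothesis on γ.
  obtain ⟨a, u, hu, hub, hum, hcrit⟩ := exists_critical hT hecont hC
    (r := γ ^ 2 / (kappa T α / T)) (by positivity) hγ (le_of_eq (by field_simp)) hf
    (M := maxPrimitive f γ)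
    (fun ξ hξ => le_csSup (bddAbove_primitive hf γ) ⟨ξ, abs_le.1 hξ, rfl⟩)
    (by rw [lt_div_iff₀ (by positivity)]; field_simp; rwa [mul_comm])
  obtain ⟨B, hB⟩ := (isCompact_Icc (a := -γ) (b := γ)).exists_bound_of_continuousOn
    hf.continuousOn
  set d : ℕ → ℝ := fun m => ∫ t in (0 : ℝ)..T, f (u t) *
    (sw T α t * (derivative (b m)).eval t) with hd
  have had : ∀ m, 2 * a m = -d m / (ell α (m + 1) * s m) := by
    intro m
    rw [hcrit, hd, neg_div, ← neg_one_mul, ← mul_div_assoc, ← intervalIntegral.integral_const_mul,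
      ← intervalIntegral.integral_div]
    congr 1; ext t; simp only [he]; ring
  have hbes := bessel_derivative hT hα horth hsl (h := fun t => f (u t))
    (hf.comp_aestronglyMeasurable hum) (B := B) (fun t ht => hB _ (abs_le.1 (hub t ht)))
  -- Here c_m = -d_m/(2 `ell` `lam`) and Bessel makes Σ d_m²/`ell` finite. The bounds `ell` ≥ (m+1)²
  -- and `lam` ≥ `lam α 1` (m+1)^(2α-2) leave the factor (m+1)^(4α-2) to spare.
  have hcsum : Summable fun m => (a m / s m) ^ 2 * ((m : ℝ) + 1) ^ (4 * α - 2) := by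
    refine Summable.of_nonneg_of_le (fun m => by positivity)
      (f := fun m => 1 / (4 * lam α 1 ^ 2) * (d m ^ 2 / ell α (m + 1))) (fun m => ?_)
      ((summable_of_sum_range_le (fun m => ?_) hbes).mul_left _)
    · have h1 : a m / s m = -d m / (2 * ell α (m + 1) * lam α (m + 1)) := by
        rw [← hss m]
        have := (hs0 m).ne'; have := (hell m).ne'
        have h := had m
        field_simp at h ⊢
        linarith
      rw [h1, div_pow, neg_sq, one_div_mul_eq_div, div_div, div_mul_eq_mul_div]
      have hm : (0 : ℝ) < (m : ℝ) + 1 := by positivity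
      have h2 : lam α 1 ^ 2 * ((m : ℝ) + 1) ^ (4 * α - 2) ≤ lam α (m + 1) ^ 2 * ell α (m + 1) := by
        refine (mul_le_mul_of_nonneg_right (pow_le_pow_left₀ (hlam 1).le (lam_one_le hα m) 2)
          (by positivity)).trans ?_
        have h5 : (((m : ℝ) + 1) ^ (2 - 2 * α)) ^ 2 * ((m : ℝ) + 1) ^ (4 * α - 2) =
            ((m : ℝ) + 1) ^ 2 := by
          rw [← Real.rpow_natCast, ← Real.rpow_natCast, ← Real.rpow_mul hm.le, ← Real.rpow_add hm]
          congr 1; push_cast; ring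
        rw [mul_pow, mul_assoc, h5]
        exact mul_le_mul_of_nonneg_left (ell_pos hα m) (sq_nonneg _)
      have := hlam 1
      have := hlam (m + 1)
      have := hell m
      rw [div_le_div_iff₀ (by positivity) (by positivity)]
      nlinarith [mul_le_mul_of_nonneg_left h2 (by positivity : 0 ≤ 4 * d m ^ 2 * ell α (m + 1))]
    · exact div_nonneg (sq_nonneg _) (hell m).le
  have hcsum' : Summable fun m => (a m / s m) ^ 2 :=
    hcsum.of_nonneg_of_le (fun m => sq_nonneg _) fun m =>
      le_mul_of_one_le_right (sq_nonneg _) (Real.one_le_rpow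
        (by linarith [m.cast_nonneg (α := ℝ)]) (by linarith [hα.1]))
  obtain ⟨p, hp, hpt⟩ := exists_riesz_fischer hT hα0 hborth hcsum'
  set P : ℕ → ℝ[X] := fun N => ∑ m ∈ Finset.range N, (a m / s m) • b m with hP
  have hPm : ∀ q : ℝ[X], MemWt T α fun t => q.eval t := fun q =>
    MemWt.of_continuousOn hT hα0 q.continuous
  have hpi := hp.integrable hT hα0
  set U : ℝ → ℝ := fun t => ∫ τ in (0 : ℝ)..t, wt T α τ * p τ with hU
  have hUcont : Continuous U := intervalIntegral.continuous_primitive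
    (fun _ _ => hpi.intervalIntegrable) 0
  have hUu : ∀ t ∈ Icc 0 T, U t = u t := by
    intro t ht
    refine tendsto_nhds_unique (f := fun N => ∫ τ in (0 : ℝ)..t, wt T α τ * (P N).eval τ)
      (l := atTop) ?_ ?_
    · rw [tendsto_iff_norm_sub_tendsto_zero]
      have h0 : Tendsto (fun N => √((∫ τ, wt T α τ) *
          ∫ τ, wt T α τ * (p τ - (P N).eval τ) ^ 2)) atTop (𝓝 0) := by
        simpa using (hpt.const_mul (∫ τ, wt T α τ)).sqrt
      refine squeeze_zero (fun _ => norm_nonneg _) (fun N => ?_) h0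
      refine Real.le_sqrt_of_sq_le ?_
      refine le_trans (le_of_eq ?_) ((hp.sub (hPm (P N))).sq_primitive_le hT hα0 ht.1)
      rw [Real.norm_eq_abs, sq_abs, hU]
      dsimp only
      rw [sub_sq_comm, ← intervalIntegral.integral_sub hpi.intervalIntegrable
        ((hPm (P N)).integrable hT hα0).intervalIntegrable]
      simp_rw [mul_sub]
    · have h := (hu t ht).tendsto_sum_nat
      refine h.congr fun N => ?_
      rw [hP]; dsimp only
      rw [intervalIntegral_wt_sum hT hα0]
      refine Finset.sum_congr rfl fun m _ => ?_
      rw [hint m t ht]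
      have := (hs0 m).ne'
      field_simp
  have hUT : U T = 0 := by
    rw [hUu T ⟨hT.le, le_rfl⟩]
    refine (hu T ⟨hT.le, le_rfl⟩).unique ?_
    have : ∀ m, a m * e m T = 0 := fun m => by simp [he, sw_right hα0]
    simp_rw [this]
    exact hasSum_zero
  have hcoef : ∀ m, ∫ t, wt T α t * (p t * (b m).eval t) = a m / s m := by
    intro m
    refine tendsto_nhds_unique (f := fun N => bil T α (P N) (b m)) (l := atTop) ?_ ?_
    · rw [tendsto_iff_norm_sub_tendsto_zero]
      have h0 : Tendsto (fun N => √(∫ τ, wt T α τ * (p τ - (P N).eval τ) ^ 2)) atTop (𝓝 0) := by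
        simpa using hpt.sqrt
      refine squeeze_zero (fun _ => norm_nonneg _) (fun N => ?_) h0
      refine Real.le_sqrt_of_sq_le ?_
      have h := (sq_integral_wt_mul_le (hp.sub (hPm (P N))) (hPm (b m))).2
      have h1 : ∫ t, wt T α t * (b m).eval t ^ 2 = 1 := by
        have := hborth m m
        rw [if_pos rfl, bil] at this
        simpa only [sq] using this
      rw [h1, mul_one] at h
      refine le_trans (le_of_eq ?_) h
      rw [Real.norm_eq_abs, sq_abs, sub_sq_comm, bil, ← integral_sub
        (sq_integral_wt_mul_le hp (hPm (b m))).1 (bil_integrable hT hα0 _ _)]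
      congr 2; ext t; ring
    · refine tendsto_const_nhds.congr' ?_
      filter_upwards [eventually_gt_atTop m] with N hN
      have h1 : (b m) = ∑ k ∈ Finset.range N, (if k = m then (1 : ℝ) else 0) • b k := by
        simp [ite_smul, Finset.sum_ite_eq', hN]
      rw [h1, hP, bil_sum_sum hT hα0 hborth]
      simp [hN]
  set H : ℝ → ℝ := fun x => ∫ t in (0 : ℝ)..x, f (U t) with hH
  have hfU : Continuous fun t => f (U t) := hf.comp hUcont
  have hHcont : Continuous H := intervalIntegral.continuous_primitive
    (fun _ _ => hfU.intervalIntegrable _ _) 0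
  have hHi : ∀ q : ℝ[X], Integrable fun t => wt T α t * (q.eval t * H t) := fun q =>
    integrable_wt_mul hT hα0 (q.continuous.mul hHcont).continuousOn
  have hAi : ∀ q : ℝ[X], Integrable fun t => wt T α t * q.eval t *
      Aop α (fun s => wt T α s * p s) t := fun q => integrable_wt_Aop hα hp (hPm q)
  -- The Euler-Lagrange equation, rewritten as the moments of the primitive H of f(u); they are
  -- opposite to those of `Aop α u'` computed next.
  have hmomH : ∀ m, ∫ t, wt T α t * ((b m).eval t * H t) = -(2 * (s m * a m)) := by
    intro m
    have h := integral_wt_mul_primitive hT hα0 (hsl (m + 1)) hfU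
    have h2 : ∫ t in (0 : ℝ)..T, f (U t) * (sw T α t * (derivative (o (m + 1))).eval t) = d m := by
      rw [hd]
      refine intervalIntegral.integral_congr fun t ht => ?_
      rw [uIcc_of_le hT.le] at ht
      simp only [hUu t ht, hb]
    rw [h2] at h
    have h3 := had m
    have := (hs0 m).ne'; have := (hell m).ne'
    field_simp at h3
    refine mul_left_cancel₀ (hell m).ne' ?_
    rw [show (∫ t, wt T α t * ((b m).eval t * H t)) = _ from rfl]
    refine h.trans ?_
    linarith
  have hmomA : ∀ m, ∫ t, wt T α t * (b m).eval t * Aop α (fun s => wt T α s * p s) t =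
      2 * (s m * a m) := by
    intro m
    rw [Aop_symm hα hp (hPm (b m))]
    have h1 : ∫ t, wt T α t * p t * Aop α (fun s => wt T α s * (b m).eval s) t =
        2 * lam α (m + 1) * ∫ t, wt T α t * (p t * (b m).eval t) := by
      rw [← integral_const_mul]
      congr 1; ext t
      by_cases ht : t ∈ Ioo 0 T
      · rw [hAop (b m) t ht, hb, hK, eval_smul, smul_eq_mul]; ring
      · rw [wt_of_notMem ht]; ring
    rw [h1, hcoef, ← hss]
    have := (hs0 m).ne'
    field_simp
  have hb1 : ∀ m, bil T α (b m) 1 = 0 := fun m => bil_succ_one hT hα (hsl (m + 1))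
  -- All other o n are orthogonal to 1 and the family spans, so o 0 cannot be orthogonal to 1 as
  -- well.
  have ho1 : bil T α (o 0) 1 ≠ 0 := by
    intro h0
    have : ∀ q : ℝ[X], bil T α q 1 = 0 := by
      intro q
      have hq : q ∈ Submodule.span ℝ (range o) := hspan ▸ Submodule.mem_top
      induction hq using Submodule.span_induction with
      | mem x hx =>
        obtain ⟨n, rfl⟩ := hx
        cases n with
        | zero => exact h0
        | succ n => exact hb1 n
      | zero => simp [bil]
      | add x y _ _ hx hy => rw [bil_add_left hT hα0, hx, hy, add_zero]
      | smul r x _ hx => rw [bil_smul_left, hx, mul_zero]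
    exact one_ne_zero (eq_zero_of_bil_self hT hα0 (this 1))
  -- The integration constant is fixed by the one moment, against o 0, that the variational
  -- equations do not control.
  set c : ℝ := ((∫ t, wt T α t * (o 0).eval t * Aop α (fun s => wt T α s * p s) t) +
    ∫ t, wt T α t * ((o 0).eval t * H t)) / bil T α (o 0) 1 with hc
  set Z : ℝ → ℝ := fun t => wt T α t * (Aop α (fun s => wt T α s * p s) t + H t - c) with hZ
  have hZq : ∀ q : ℝ[X], (fun t => Z t * q.eval t) = fun t =>
      wt T α t * q.eval t * Aop α (fun s => wt T α s * p s) t +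
        wt T α t * (q.eval t * H t) - c * (wt T α t * (q.eval t * (1 : ℝ[X]).eval t)) := by
    intro q; ext t; simp only [hZ, eval_one]; ring
  have hZi : ∀ q : ℝ[X], Integrable fun t => Z t * q.eval t := by
    intro q
    rw [hZq]
    exact ((hAi q).add (hHi q)).sub ((bil_integrable hT hα0 q 1).const_mul c)
  have hZint : ∀ q : ℝ[X], ∫ t, Z t * q.eval t =
      (∫ t, wt T α t * q.eval t * Aop α (fun s => wt T α s * p s) t) +
        (∫ t, wt T α t * (q.eval t * H t)) - c * bil T α q 1 := by
    intro q
    have h := integral_sub ((hAi q).add (hHi q)) ((bil_integrable hT hα0 q 1).const_mul c)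
    simp only [Pi.add_apply] at h
    rw [hZq, h, integral_add (hAi q) (hHi q), integral_const_mul, bil]
  have hZ0 : Z =ᵐ[volume] 0 := by
    refine ae_eq_zero_of_moments (T := T) (by simpa using hZi 1) (fun t ht => ?_) fun q => ?_
    · rw [hZ]; dsimp only
      rw [wt_of_notMem fun h => ht (Ioo_subset_Icc_self h), zero_mul]
    · have hq : q ∈ Submodule.span ℝ (range o) := hspan ▸ Submodule.mem_top
      induction hq using Submodule.span_induction with
      | mem x hx =>
        obtain ⟨n, rfl⟩ := hx
        rw [hZint]
        cases n with
        | zero => rw [hc, div_mul_cancel₀ _ ho1, sub_self]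
        | succ n =>
          have h1 := hmomA n
          have h2 := hmomH n
          have h3 := hb1 n
          simp only [hb] at h1 h2 h3
          rw [h1, h2, h3]; ring
      | zero => simp
      | add x y _ _ hx hy =>
        simp only [eval_add, mul_add]
        rw [integral_add (hZi x) (hZi y), hx, hy, add_zero]
      | smul r x _ hx =>
        simp only [eval_smul, smul_eq_mul, mul_left_comm]
        rw [integral_const_mul, hx, mul_zero]
  refine ⟨p, b, fun m => a m / s m, hp, hborth, fun m => hsl (m + 1), hcsum, hpt, ?_, c, ?_⟩
  · rw [integral_eq_intervalIntegral_wt hT]; exact hUT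
  · filter_upwards [hZ0] with x hx hxm
    have h := (mul_eq_zero.1 hx).resolve_left (wt_pos hxm).ne'
    change _ = c - H x
    linarith

end Core

/-! ### Interior regularity of the Riesz potential -/

section Interior

open Polynomial

variable {T α : ℝ}

lemma intervalIntegral_wt_pos (hT : 0 < T) (hα : 0 < α) {a b : ℝ} (ha : 0 ≤ a) (hab : a < b)
    (hb : b ≤ T) : 0 < ∫ s in a..b, wt T α s :=
  intervalIntegral.intervalIntegral_pos_of_pos_on (integrable_wt hT hα).intervalIntegrable
    (fun _ hs => wt_pos ⟨ha.trans_lt hs.1, hs.2.trans_le hb⟩) hab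

/-- The Sonin argument: normalised eigenfunctions of the Sturm-Liouville operator are bounded in
the interior, uniformly in the eigenvalue. -/
lemma sq_eval_le_of_sl (hT : 0 < T) (hα : α ∈ Ioc (1 / 2 : ℝ) 1) {q : ℝ[X]} {l : ℝ} (hl : 0 < l)
    (hsl : sl T α q = l • q) (hq : bil T α q q = 1) {δ : ℝ} (hδ : 0 < δ) (hδT : 2 * δ ≤ T) {t : ℝ}
    (ht : t ∈ Icc δ (T - δ)) :
    q.eval t ^ 2 ≤ 2 / (∫ s in (0 : ℝ)..δ, wt T α s) + 2 / ∫ s in (T - δ)..T, wt T α s := by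
  have hα0 : 0 < α := by linarith [hα.1]
  set q' := derivative q with hq'
  -- Sonin's function. By the differential equation Φ' = (1-2α)(T-2t) q'²/l, so Φ decreases up to
  -- T/2 and increases afterwards.
  set Φ : ℝ → ℝ := fun t => q.eval t ^ 2 + t * (T - t) * q'.eval t ^ 2 / l with hΦ
  have hode : ∀ t, t * (T - t) * (derivative q').eval t =
      -(l * q.eval t) - α * ((T - 2 * t) * q'.eval t) := by
    intro t
    have h := congrArg (eval t) hsl
    rw [sl_apply] at h
    simp at h
    linarith
  have hder : ∀ t, HasDerivAt Φ ((1 - 2 * α) * (T - 2 * t) * q'.eval t ^ 2 / l) t := by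
    intro t
    have h1 : HasDerivAt (fun t : ℝ => t * (T - t)) (T - 2 * t) t :=
      ((hasDerivAt_id t).mul ((hasDerivAt_id t).const_sub T)).congr_deriv (by simp; ring)
    refine (((q.hasDerivAt t).pow 2).add
      ((h1.mul ((q'.hasDerivAt t).pow 2)).div_const l)).congr_deriv ?_
    have h2 := hode t
    push_cast
    simp only [Pi.pow_apply]
    rw [← hq']
    field_simp
    linear_combination (2 * q'.eval t) * h2
  have hΦc : Continuous Φ := continuous_iff_continuousAt.2 fun t => (hder t).continuousAt
  have hderiv : ∀ t, deriv Φ t = (1 - 2 * α) * (T - 2 * t) * q'.eval t ^ 2 / l :=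
    fun t => (hder t).deriv
  have hanti : AntitoneOn Φ (Iic (T / 2)) :=
    antitoneOn_of_deriv_nonpos (convex_Iic _) hΦc.continuousOn
      (fun t _ => (hder t).differentiableAt.differentiableWithinAt) fun t ht => by
        rw [interior_Iic] at ht
        have ht : t < T / 2 := ht
        rw [hderiv]
        refine div_nonpos_of_nonpos_of_nonneg (mul_nonpos_of_nonpos_of_nonneg
          (mul_nonpos_of_nonpos_of_nonneg ?_ ?_) (sq_nonneg _)) hl.le
        · linarith [hα.1]
        · linarith
  have hmono : MonotoneOn Φ (Ici (T / 2)) :=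
    monotoneOn_of_deriv_nonneg (convex_Ici _) hΦc.continuousOn
      (fun t _ => (hder t).differentiableAt.differentiableWithinAt) fun t ht => by
        rw [interior_Ici] at ht
        have ht : T / 2 < t := ht
        rw [hderiv]
        refine div_nonneg (mul_nonneg (mul_nonneg_of_nonpos_of_nonpos ?_ ?_) (sq_nonneg _)) hl.le
        · linarith [hα.1]
        · linarith
  have hwΦ : ∀ t, wt T α t * Φ t = wt T α t * (q.eval t * q.eval t) +
      (Ioo 0 T).indicator (fun t => sw T α t * (q'.eval t * q'.eval t)) t / l := by
    intro t
    by_cases ht : t ∈ Ioo 0 T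
    · have hX : 0 < t * (T - t) := mul_pos ht.1 (sub_pos.2 ht.2)
      have : sw T α t = wt T α t * (t * (T - t)) := by
        rw [wt_of_mem ht, sw, ← Real.rpow_add_one hX.ne', sub_add_cancel]
      rw [indicator_of_mem ht, this]
      simp only [hΦ]; ring
    · rw [indicator_of_notMem ht, wt_of_notMem ht]; simp
  have hΦ0 : ∀ t ∈ Icc 0 T, 0 ≤ Φ t := fun t ht =>
    add_nonneg (sq_nonneg _) (div_nonneg (mul_nonneg (mul_nonneg ht.1 (sub_nonneg.2 ht.2))
      (sq_nonneg _)) hl.le)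
  have hwi : ∀ a b, IntervalIntegrable (fun s => wt T α s * Φ s) volume a b := fun a b =>
    (integrable_wt_mul hT hα0 hΦc.continuousOn).intervalIntegrable
  -- Normalisation contributes 1, and the Dirichlet form divided by the eigenvalue contributes
  -- another 1.
  have htot : ∫ s in (0 : ℝ)..T, wt T α s * Φ s = 2 := by
    rw [← integral_eq_intervalIntegral_wt hT]
    simp_rw [hwΦ]
    have hc : Continuous fun t => sw T α t * (q'.eval t * q'.eval t) :=
      (continuous_sw hα0).mul (q'.continuous.mul q'.continuous)
    rw [integral_add (bil_integrable hT hα0 q q), integral_div,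
      integral_indicator measurableSet_Ioo, ← integral_Ioc_eq_integral_Ioo,
      ← intervalIntegral.integral_of_le hT.le, hq',
      ← bil_sl hα0 hT, hsl, bil_smul_left, hq, mul_one, div_self hl.ne']
    · rw [bil] at hq
      rw [hq]; norm_num
    · exact (((integrable_indicator_iff measurableSet_Ioo).2
        (hc.integrableOn_Icc.mono_set Ioo_subset_Icc_self)).div_const l)
  have hpart : ∀ a b, 0 ≤ a → a ≤ b → b ≤ T → ∫ s in a..b, wt T α s * Φ s ≤ 2 := by
    intro a b ha hab hb
    rw [← htot]
    refine intervalIntegral.integral_mono_interval ha hab hb ?_ (hwi 0 T)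
    filter_upwards [ae_restrict_mem measurableSet_Ioc] with s hs
    exact mul_nonneg (wt_nonneg s) (hΦ0 s (Ioc_subset_Icc_self hs))
  -- Where Φ(t) is the smaller value, it is at most the weighted average of Φ over [a,b]. By
  -- monotonicity this applies to an end interval of length δ, with a bound independent of l.
  have hkey : ∀ a b, 0 ≤ a → a < b → b ≤ T → (∀ s ∈ Icc a b, Φ t ≤ Φ s) →
      q.eval t ^ 2 ≤ 2 / ∫ s in a..b, wt T α s := by
    intro a b ha hab hb h
    rw [le_div_iff₀ (intervalIntegral_wt_pos hT hα0 ha hab hb)]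
    refine le_trans ?_ (hpart a b ha hab.le hb)
    rw [← intervalIntegral.integral_const_mul]
    refine intervalIntegral.integral_mono_on hab.le
      ((integrable_wt hT hα0).intervalIntegrable.const_mul _) (hwi a b) fun s hs => ?_
    rw [mul_comm]
    refine mul_le_mul_of_nonneg_left (le_trans ?_ (h s hs)) (wt_nonneg s)
    simp only [hΦ]
    have : 0 ≤ t * (T - t) * q'.eval t ^ 2 / l := by
      have h1 : 0 ≤ t := by linarith [ht.1]
      have h2 : 0 ≤ T - t := by linarith [ht.2]
      positivity
    linarith
  have hp1 := intervalIntegral_wt_pos hT hα0 le_rfl hδ (by linarith)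
  have hp2 := intervalIntegral_wt_pos (a := T - δ) hT hα0 (by linarith) (by linarith) le_rfl
  rcases le_total t (T / 2) with h | h
  · refine (hkey 0 δ le_rfl hδ (by linarith) fun s hs => ?_).trans
      (le_add_of_nonneg_right (by positivity))
    exact hanti (by simp only [mem_Iic]; linarith [hs.2]) h (hs.2.trans ht.1)
  · refine (hkey (T - δ) T (by linarith) (by linarith) le_rfl fun s hs => ?_).trans
      (le_add_of_nonneg_left (by positivity))
    exact hmono h (by simp only [mem_Ici]; linarith [hs.1]) (ht.2.trans hs.1)

/-- A function that is bounded in the interior and small in the weighted `L²` space has a small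
Riesz potential in the interior. -/
lemma riesz_abs_le (hT : 0 < T) (hα : α ∈ Ioo (1 / 2 : ℝ) 1) {δ W S ρ x : ℝ} (hρ : 0 < ρ)
    (hρδ : ρ ≤ δ) (hx : x ∈ Icc (2 * δ) (T - 2 * δ))
    (hW : ∀ t ∈ Icc δ (T - δ), wt T α t ≤ W)
    {p : ℝ → ℝ} (hp : Continuous p) (hS : ∀ t ∈ Icc δ (T - δ), |p t| ≤ S) :
    ∫ y, |x - y| ^ (1 - 2 * α) * (wt T α y * |p y|) ≤
      W * S * (2 * ρ ^ (2 - 2 * α) / (2 - 2 * α)) +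
        ρ ^ (1 - 2 * α) * √((∫ y, wt T α y) * ∫ y, wt T α y * p y ^ 2) := by
  have hα0 : 0 < α := by linarith [hα.1]
  have hx0 : x ∈ Ioo 0 T := ⟨by linarith [hx.1], by linarith [hx.2]⟩
  have hint := riesz_integrable_mul hα hx0 hp.abs
  have hW0 : 0 ≤ W := (wt_nonneg x).trans (hW x ⟨by linarith [hx.1], by linarith [hx.2]⟩)
  have hpm := MemWt.of_continuousOn hT hα0 hp
  have hpi := (MemWt.of_continuousOn hT hα0 hp.abs).integrable hT hα0
  have hfar : ∫ y, wt T α y * |p y| ≤ √((∫ y, wt T α y) * ∫ y, wt T α y * p y ^ 2) := by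
    refine Real.le_sqrt_of_sq_le ?_
    have h := (MemWt.of_continuousOn hT hα0 hp.abs).sq_primitive_le hT hα0 hT.le
    rw [← integral_eq_intervalIntegral_wt hT] at h
    simpa only [sq_abs] using h
  have hball : IntegrableOn (fun y => |x - y| ^ (1 - 2 * α)) (Ioo (x - ρ) (x + ρ)) ∧
      ∫ y in Ioo (x - ρ) (x + ρ), |x - y| ^ (1 - 2 * α) = 2 * ρ ^ (2 - 2 * α) / (2 - 2 * α) := by
    have h1 := integral_abs_rpow hα (x - ρ) (x + ρ) x
    have h2 : x + ρ - x = ρ := by ring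
    have h3 : x - ρ - x = -ρ := by ring
    rw [h2, h3, abs_neg, abs_of_pos hρ] at h1
    have h4 : ρ * ρ ^ (1 - 2 * α) = ρ ^ (2 - 2 * α) := by
      rw [← Real.rpow_one_add' hρ.le (by linarith [hα.2])]; congr 1; ring
    have h5 : ∀ y, |y - x| ^ (1 - 2 * α) = |x - y| ^ (1 - 2 * α) := fun y => by rw [abs_sub_comm]
    simp_rw [h5] at h1
    rw [intervalIntegral.integral_of_le (by linarith), integral_Ioc_eq_integral_Ioo] at h1
    constructor
    · have h6 := (integrableOn_abs_rpow (r := 1 - 2 * α) (by linarith [hα.2])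
        (by linarith [hα.1]) ρ)
      rw [← integrable_indicator_iff measurableSet_Ioo] at h6 ⊢
      refine (h6.comp_sub_left x).congr (.of_forall fun y => ?_)
      have : x - y ∈ Ioo (-ρ) ρ ↔ y ∈ Ioo (x - ρ) (x + ρ) := by
        simp only [mem_Ioo]; constructor <;> rintro ⟨a, b⟩ <;> constructor <;> linarith
      simp only [indicator, this]
    · rw [eq_div_iff (by linarith [hα.2])]
      linarith
  -- Within distance ρ of x the sup bounds W and S are used; farther away the kernel is at most
  -- ρ^(1-2α) and the weighted L² norm suffices.
  have hpt : ∀ y, |x - y| ^ (1 - 2 * α) * (wt T α y * |p y|) ≤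
      W * S * (Ioo (x - ρ) (x + ρ)).indicator (fun y => |x - y| ^ (1 - 2 * α)) y +
        ρ ^ (1 - 2 * α) * (wt T α y * |p y|) := by
    intro y
    have hw := wt_nonneg (T := T) (α := α) y
    by_cases hy : y ∈ Ioo (x - ρ) (x + ρ)
    · rw [indicator_of_mem hy]
      have hyδ : y ∈ Icc δ (T - δ) := ⟨by linarith [hy.1, hx.1], by linarith [hy.2, hx.2]⟩
      have h1 : wt T α y * |p y| ≤ W * S :=
        mul_le_mul (hW y hyδ) (hS y hyδ) (abs_nonneg _) hW0
      have h2 : 0 ≤ |x - y| ^ (1 - 2 * α) := by positivity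
      have h3 : 0 ≤ ρ ^ (1 - 2 * α) * (wt T α y * |p y|) := by positivity
      nlinarith [mul_le_mul_of_nonneg_left h1 h2]
    · rw [indicator_of_notMem hy, mul_zero, zero_add]
      refine mul_le_mul_of_nonneg_right ?_ (by positivity)
      refine Real.rpow_le_rpow_of_nonpos hρ ?_ (by linarith [hα.1])
      by_contra h
      have := abs_lt.1 (not_le.1 h)
      exact hy ⟨by linarith [this.2], by linarith [this.1]⟩
  have hi1 := (integrable_indicator_iff measurableSet_Ioo).2 hball.1
  refine (integral_mono hint ((hi1.const_mul (W * S)).add (hpi.const_mul _)) hpt).trans ?_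
  simp only [Pi.add_apply]
  rw [integral_add (hi1.const_mul (W * S)) (hpi.const_mul _), integral_const_mul,
    integral_const_mul, integral_indicator measurableSet_Ioo, hball.2]
  gcongr

end Interior

/-- Fatou's lemma. It transfers uniform bounds on partial sums to the a.e. limit and yields its
integrability at the same time. -/
lemma integrable_and_integral_le_of_tendsto {X : Type*} [MeasurableSpace X] {μ : Measure X}
    {F : ℕ → X → ℝ} {G : X → ℝ} {K : ℝ} (hF : ∀ i, Integrable (F i) μ) (hF0 : ∀ i x, 0 ≤ F i x)
    (hK : ∀ᶠ i in atTop, ∫ x, F i x ∂μ ≤ K) (hG : AEStronglyMeasurable G μ)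
    (hlim : ∀ᵐ x ∂μ, Tendsto (fun i => F i x) atTop (𝓝 (G x))) :
    Integrable G μ ∧ ∫ x, G x ∂μ ≤ K := by
  have hG0 : ∀ᵐ x ∂μ, 0 ≤ G x := by
    filter_upwards [hlim] with x hx
    exact ge_of_tendsto' hx fun i => hF0 i x
  have hle : ∫⁻ x, ENNReal.ofReal (G x) ∂μ ≤ ENNReal.ofReal K := by
    have h1 : ∫⁻ x, ENNReal.ofReal (G x) ∂μ =
        ∫⁻ x, liminf (fun i => ENNReal.ofReal (F i x)) atTop ∂μ := by
      refine lintegral_congr_ae ?_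
      filter_upwards [hlim] with x hx
      exact ((ENNReal.continuous_ofReal.tendsto _).comp hx).liminf_eq.symm
    rw [h1]
    refine (lintegral_liminf_le' fun i => (hF i).1.aemeasurable.ennreal_ofReal).trans ?_
    refine liminf_le_of_frequently_le' (Eventually.frequently ?_)
    filter_upwards [hK] with i hi
    rw [← ofReal_integral_eq_lintegral_ofReal (hF i) (.of_forall (hF0 i))]
    exact ENNReal.ofReal_le_ofReal hi
  have hGi : Integrable G μ := by
    refine ⟨hG, ?_⟩
    rw [hasFiniteIntegral_iff_ofReal hG0]
    exact hle.trans_lt ENNReal.ofReal_lt_top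
  refine ⟨hGi, ?_⟩
  rw [← ofReal_integral_eq_lintegral_ofReal hGi hG0] at hle
  obtain ⟨i, hi⟩ := hK.exists
  exact (ENNReal.ofReal_le_ofReal_iff ((integral_nonneg (hF0 i)).trans hi)).1 hle

lemma eLpNorm_two_eq {X : Type*} [MeasurableSpace X] {μ : Measure X} {F : X → ℝ}
    (hF : MemLp F 2 μ) : eLpNorm F 2 μ = ENNReal.ofReal (√(∫ x, F x ^ 2 ∂μ)) := by
  rw [MemLp.eLpNorm_eq_integral_rpow_norm two_ne_zero ENNReal.ofNat_ne_top hF, Real.sqrt_eq_rpow]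
  simp

section Interior

open Polynomial

variable {T α : ℝ}

/-- The Riesz potentials of the dyadic blocks decay geometrically in the interior. -/
lemma exists_riesz_block_le (hT : 0 < T) (hα : α ∈ Ioo (1 / 2 : ℝ) 1) {b : ℕ → ℝ[X]} {c : ℕ → ℝ}
    (hb : ∀ m n, bil T α (b m) (b n) = if m = n then 1 else 0)
    (hsl : ∀ m, sl T α (b m) = ell α (m + 1) • b m)
    (hc : Summable fun m => c m ^ 2 * ((m : ℝ) + 1) ^ (4 * α - 2)) {δ : ℝ} (hδ : 0 < δ)
    (hδT : 2 * δ ≤ T) :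
    ∃ C θ : ℝ, 0 < θ ∧ θ < 1 ∧ ∀ x ∈ Icc (2 * δ) (T - 2 * δ), ∀ k : ℕ,
      ∫ y, |x - y| ^ (1 - 2 * α) *
        (wt T α y * |(∑ m ∈ Finset.Ico (2 ^ k) (2 ^ (k + 1)), c m • b m).eval y|) ≤ C * θ ^ k := by
  have hα0 : 0 < α := by linarith [hα.1]
  have hα' : α ∈ Ioc (1 / 2 : ℝ) 1 := ⟨hα.1, hα.2.le⟩
  obtain ⟨M, hM⟩ : ∃ M, M = 2 / (∫ s in (0 : ℝ)..δ, wt T α s) +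
    2 / ∫ s in (T - δ)..T, wt T α s := ⟨_, rfl⟩
  have hbM : ∀ m, ∀ t ∈ Icc δ (T - δ), (b m).eval t ^ 2 ≤ M := fun m t ht => by
    rw [hM]
    exact sq_eval_le_of_sl hT hα' (lt_of_lt_of_le (by positivity) (ell_pos hα' m)) (hsl m)
      (by rw [hb, if_pos rfl]) hδ hδT ht
  have hM0 : 0 ≤ M := (sq_nonneg _).trans (hbM 0 δ ⟨le_rfl, by linarith⟩)
  obtain ⟨W, hW⟩ : ∃ W, ∀ t ∈ Icc δ (T - δ), wt T α t ≤ W := by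
    have hcont : ContinuousOn (wt T α) (Icc δ (T - δ)) := by
      have h : ContinuousOn (fun t : ℝ => (t * (T - t)) ^ (α - 1)) (Icc δ (T - δ)) := by
        refine ContinuousOn.rpow_const (by fun_prop) fun t ht => Or.inl (ne_of_gt ?_)
        exact mul_pos (by linarith [ht.1]) (by linarith [ht.2])
      exact h.congr fun t ht => wt_of_mem ⟨by linarith [ht.1], by linarith [ht.2]⟩
    obtain ⟨W, hW⟩ := isCompact_Icc.exists_bound_of_continuousOn hcont
    exact ⟨W, fun t ht => (le_abs_self _).trans (hW t ht)⟩
  set B : ℝ := ∑' m, c m ^ 2 * ((m : ℝ) + 1) ^ (4 * α - 2) with hB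
  have hB0 : 0 ≤ B := tsum_nonneg fun m => by positivity
  have hw0 : 0 ≤ ∫ y, wt T α y := integral_nonneg fun y => wt_nonneg y
  set ε : ℝ := (2 * α - 1) / 4 with hε
  have hε0 : 0 < ε := by rw [hε]; linarith [hα.1]
  set C₁ : ℝ := W * √(B * M) * (2 * δ ^ (2 - 2 * α) / (2 - 2 * α)) with hC₁
  set C₂ : ℝ := δ ^ (1 - 2 * α) * √((∫ y, wt T α y) * B) with hC₂
  have hW0 : 0 ≤ W := (wt_nonneg δ).trans (hW δ ⟨le_rfl, by linarith⟩)
  have hC₁0 : 0 ≤ C₁ := by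
    have : 0 < 2 - 2 * α := by linarith [hα.2]
    positivity
  refine ⟨C₁ + C₂, 2 ^ (-ε), by positivity, Real.rpow_lt_one_of_one_lt_of_neg one_lt_two
    (by linarith), fun x hx k => ?_⟩
  set q : ℝ[X] := ∑ m ∈ Finset.Ico (2 ^ k) (2 ^ (k + 1)), c m • b m with hq
  set R : ℝ := 2 ^ k with hR
  have hR0 : 0 < R := by positivity
  have hR1 : 1 ≤ R := one_le_pow₀ one_le_two
  have hθ : ((2 : ℝ) ^ (-ε)) ^ k = R ^ (-ε) := by
    rw [hR, ← Real.rpow_natCast, ← Real.rpow_natCast, ← Real.rpow_mul zero_le_two,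
      ← Real.rpow_mul zero_le_two, mul_comm]
  -- On the block m + 1 ≥ R = 2^k, so the weighted summability becomes decay R^(-(4α-2)).
  have hA : ∑ m ∈ Finset.Ico (2 ^ k) (2 ^ (k + 1)), c m ^ 2 ≤ B * R ^ (-(4 * α - 2)) := by
    have h1 : ∑ m ∈ Finset.Ico (2 ^ k) (2 ^ (k + 1)), c m ^ 2 * ((m : ℝ) + 1) ^ (4 * α - 2) ≤ B :=
      hc.sum_le_tsum _ fun m _ => by positivity
    rw [Real.rpow_neg hR0.le, ← div_eq_mul_inv, le_div_iff₀ (by positivity), Finset.sum_mul]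
    refine (Finset.sum_le_sum fun m hm => ?_).trans h1
    refine mul_le_mul_of_nonneg_left (Real.rpow_le_rpow hR0.le ?_ (by linarith [hα.1]))
      (sq_nonneg _)
    have : ((2 ^ k : ℕ) : ℝ) ≤ m := Nat.cast_le.2 (Finset.mem_Ico.1 hm).1
    push_cast at this
    linarith
  have hq2 : ∫ y, wt T α y * q.eval y ^ 2 ≤ B * R ^ (-(4 * α - 2)) := by
    have h := bil_sum_sum hT hα0 hb c c (Finset.Ico (2 ^ k) (2 ^ (k + 1)))
    rw [← hq, bil] at h
    simp only [← sq] at h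
    exact h.le.trans hA
  -- Cauchy-Schwarz over R terms, each polynomial bounded in the interior by Sonin's argument, gives
  -- √(R · R^(2-4α)) = R^(3/2-2α).
  have hqS : ∀ t ∈ Icc δ (T - δ), |q.eval t| ≤ √(B * M) * R ^ (3 / 2 - 2 * α) := by
    intro t ht
    have h1 : q.eval t ^ 2 ≤ B * R ^ (-(4 * α - 2)) * (R * M) := by
      have h2 : q.eval t = ∑ m ∈ Finset.Ico (2 ^ k) (2 ^ (k + 1)), c m * (b m).eval t := by
        rw [hq, eval_finsetSum]
        exact Finset.sum_congr rfl fun m _ => by rw [eval_smul, smul_eq_mul]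
      rw [h2]
      refine (Finset.sum_mul_sq_le_sq_mul_sq _ _ _).trans (mul_le_mul hA ?_
        (Finset.sum_nonneg fun m _ => sq_nonneg _) (by positivity))
      refine (Finset.sum_le_card_nsmul _ _ M fun m _ => hbM m t ht).trans (le_of_eq ?_)
      rw [nsmul_eq_mul, Nat.card_Ico, pow_succ, mul_two, Nat.add_sub_cancel]
      push_cast; rfl
    have h3 : B * R ^ (-(4 * α - 2)) * (R * M) = B * M * (R ^ (3 / 2 - 2 * α)) ^ 2 := by
      have : R ^ (-(4 * α - 2)) * R = (R ^ (3 / 2 - 2 * α)) ^ 2 := by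
        rw [← Real.rpow_add_one hR0.ne', ← Real.rpow_natCast, ← Real.rpow_mul hR0.le]
        congr 1; push_cast; ring
      rw [← this]; ring
    rw [h3] at h1
    refine abs_le_of_sq_le_sq ?_ (by positivity)
    rwa [mul_pow, Real.sq_sqrt (by positivity)]
  -- The cut-off radius δ R^(-3/4) balances both parts: the near one becomes R^(-α/2), the far one
  -- R^(-(2α-1)/4), so both are at most R^(-ε).
  have hρ0 : 0 < δ * R ^ (-(3 / 4) : ℝ) := by positivity
  have hρδ : δ * R ^ (-(3 / 4) : ℝ) ≤ δ :=
    mul_le_of_le_one_right hδ.le (Real.rpow_le_one_of_one_le_of_nonpos hR1 (by norm_num))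
  refine (riesz_abs_le hT hα hρ0 hρδ hx hW q.continuous hqS).trans ?_
  rw [hθ, add_mul]
  refine add_le_add ?_ ?_
  · have h1 : R ^ (3 / 2 - 2 * α) * (R ^ (-(3 / 4) : ℝ)) ^ (2 - 2 * α) = R ^ (-(α / 2)) := by
      rw [← Real.rpow_mul hR0.le, ← Real.rpow_add hR0]; congr 1; ring
    have h2 : R ^ (-(α / 2)) ≤ R ^ (-ε) :=
      Real.rpow_le_rpow_of_exponent_le hR1 (by rw [hε]; linarith)
    rw [Real.mul_rpow hδ.le (by positivity)]
    calc W * (√(B * M) * R ^ (3 / 2 - 2 * α)) *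
          (2 * (δ ^ (2 - 2 * α) * (R ^ (-(3 / 4) : ℝ)) ^ (2 - 2 * α)) / (2 - 2 * α)) =
        C₁ * (R ^ (3 / 2 - 2 * α) * (R ^ (-(3 / 4) : ℝ)) ^ (2 - 2 * α)) := by rw [hC₁]; ring
      _ ≤ C₁ * R ^ (-ε) := by rw [h1]; exact mul_le_mul_of_nonneg_left h2 hC₁0
  · have h1 : (R ^ (-(3 / 4) : ℝ)) ^ (1 - 2 * α) * R ^ (-(2 * α - 1)) = R ^ (-ε) := by
      rw [← Real.rpow_mul hR0.le, ← Real.rpow_add hR0]; congr 1; rw [hε]; ring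
    have h2 : √((∫ y, wt T α y) * ∫ y, wt T α y * q.eval y ^ 2) ≤
        √((∫ y, wt T α y) * B) * R ^ (-(2 * α - 1)) := by
      have h3 : √(R ^ (-(4 * α - 2))) = R ^ (-(2 * α - 1)) := by
        rw [Real.sqrt_eq_rpow, ← Real.rpow_mul hR0.le]; congr 1; ring
      rw [← h3, ← Real.sqrt_mul (by positivity)]
      refine Real.sqrt_le_sqrt ?_
      rw [mul_assoc]
      exact mul_le_mul_of_nonneg_left hq2 hw0
    rw [Real.mul_rpow hδ.le (by positivity)]
    calc _ ≤ δ ^ (1 - 2 * α) * (R ^ (-(3 / 4) : ℝ)) ^ (1 - 2 * α) *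
          (√((∫ y, wt T α y) * B) * R ^ (-(2 * α - 1))) := by gcongr
      _ = C₂ * ((R ^ (-(3 / 4) : ℝ)) ^ (1 - 2 * α) * R ^ (-(2 * α - 1))) := by rw [hC₂]; ring
      _ = C₂ * R ^ (-ε) := by rw [h1]

/-- Interior regularity: the Riesz potential of the solution converges absolutely at every
interior point and is continuous there. -/
theorem riesz_regular (hT : 0 < T) (hα : α ∈ Ioo (1 / 2 : ℝ) 1) {b : ℕ → ℝ[X]} {c : ℕ → ℝ}
    (hb : ∀ m n, bil T α (b m) (b n) = if m = n then 1 else 0)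
    (hsl : ∀ m, sl T α (b m) = ell α (m + 1) • b m)
    (hc : Summable fun m => c m ^ 2 * ((m : ℝ) + 1) ^ (4 * α - 2)) {p : ℝ → ℝ} (hp : MemWt T α p)
    (hpt : Tendsto (fun N => ∫ t, wt T α t *
      (p t - (∑ m ∈ Finset.range N, c m • b m).eval t) ^ 2) atTop (𝓝 0)) :
    (∀ x ∈ Ioo 0 T, Integrable fun y => |x - y| ^ (1 - 2 * α) * (wt T α y * p y)) ∧
      ContinuousOn (Aop α fun t => wt T α t * p t) (Ioo 0 T) := by
  have hα0 : 0 < α := by linarith [hα.1]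
  set P : ℕ → ℝ[X] := fun k => ∑ m ∈ Finset.range (2 ^ k), c m • b m with hP
  have hPm : ∀ q : ℝ[X], MemWt T α fun t => q.eval t := fun q =>
    MemWt.of_continuousOn hT hα0 q.continuous
  have hpow : Tendsto (fun k : ℕ => 2 ^ k) atTop atTop :=
    tendsto_pow_atTop_atTop_of_one_lt (α := ℕ) one_lt_two
  -- Weighted L² convergence gives a.e. convergence only along a subsequence, which is enough for
  -- Fatou.
  obtain ⟨ns, hns, hae⟩ : ∃ ns : ℕ → ℕ, StrictMono ns ∧ ∀ᵐ t, Tendsto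
      (fun i => √(wt T α t) * (p t - (P (ns i)).eval t)) atTop (𝓝 0) := by
    have hm : ∀ k, MemLp (fun t => √(wt T α t) * (p t - (P k).eval t)) 2 := fun k =>
      memLp_sqrt_wt _ (hp.sub (hPm _))
    refine (tendstoInMeasure_of_tendsto_eLpNorm (p := 2) two_ne_zero (fun k => (hm k).1)
      aestronglyMeasurable_const ?_).exists_seq_tendsto_ae
    have h1 : ∀ k, eLpNorm ((fun t => √(wt T α t) * (p t - (P k).eval t)) - fun _ => (0 : ℝ)) 2
        volume = ENNReal.ofReal (√(∫ t, wt T α t * (p t - (P k).eval t) ^ 2)) := by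
      intro k
      have h0 : ((fun t => √(wt T α t) * (p t - (P k).eval t)) - fun _ => (0 : ℝ)) =
          fun t => √(wt T α t) * (p t - (P k).eval t) := by ext t; simp
      rw [h0, eLpNorm_two_eq (hm k)]
      simp_rw [mul_pow, Real.sq_sqrt (wt_nonneg _)]
    simp_rw [h1]
    have h2 := (hpt.comp hpow).sqrt
    rw [Real.sqrt_zero] at h2
    simpa using ENNReal.tendsto_ofReal h2
  have hPint : ∀ x ∈ Ioo 0 T, ∀ q : ℝ[X],
      Integrable fun y => |x - y| ^ (1 - 2 * α) * (wt T α y * |q.eval y|) := fun x hx q =>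
    riesz_integrable_mul hα hx q.continuous.abs
  have key : ∀ δ, 0 < δ → 2 * δ ≤ T → ∃ C θ : ℝ, 0 < θ ∧ θ < 1 ∧
      ∀ x ∈ Icc (2 * δ) (T - 2 * δ), ∀ k,
        Integrable (fun y => |x - y| ^ (1 - 2 * α) * (wt T α y * |p y - (P k).eval y|)) ∧
        ∫ y, |x - y| ^ (1 - 2 * α) * (wt T α y * |p y - (P k).eval y|) ≤ C * θ ^ k := by
    intro δ hδ hδT
    obtain ⟨C, θ, hθ0, hθ1, h⟩ := exists_riesz_block_le hT hα hb hsl hc hδ hδT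
    refine ⟨C / (1 - θ), θ, hθ0, hθ1, fun x hx k => ?_⟩
    have hx0 : x ∈ Ioo 0 T := ⟨by linarith [hx.1], by linarith [hx.2]⟩
    have hC0 : 0 ≤ C := by
      refine le_trans ?_ ((h x hx 0).trans_eq (by rw [pow_zero, mul_one]))
      exact integral_nonneg fun y => mul_nonneg (by positivity)
        (mul_nonneg (wt_nonneg y) (abs_nonneg _))
    -- Differences of dyadic partial sums telescope into blocks, so their absolute potentials are
    -- bounded by a geometric sum.
    have htel : ∀ j, k ≤ j → ∫ y, |x - y| ^ (1 - 2 * α) *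
        (wt T α y * |(P j - P k).eval y|) ≤ ∑ i ∈ Finset.Ico k j, C * θ ^ i := by
      intro j hj
      induction j, hj using Nat.le_induction with
      | base => simp
      | succ j hj ih =>
        rw [Finset.sum_Ico_succ_top hj]
        refine le_trans ?_ (add_le_add ih (h x hx j))
        rw [← integral_add (hPint x hx0 _) (hPint x hx0 _)]
        refine integral_mono (hPint x hx0 _) ((hPint x hx0 _).add (hPint x hx0 _)) fun y => ?_
        dsimp only
        rw [← mul_add, ← mul_add]
        refine mul_le_mul_of_nonneg_left (mul_le_mul_of_nonneg_left ?_ (wt_nonneg y))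
          (by positivity)
        have h1 : P (j + 1) - P k = (P j - P k) +
            ∑ m ∈ Finset.Ico (2 ^ j) (2 ^ (j + 1)), c m • b m := by
          rw [Finset.sum_Ico_eq_sub _ (Nat.pow_le_pow_right two_pos (Nat.le_succ j))]
          simp only [hP]; abel
        rw [h1, eval_add]
        exact abs_add_le _ _
    refine integrable_and_integral_le_of_tendsto
      (F := fun i y => |x - y| ^ (1 - 2 * α) * (wt T α y * |(P (ns i) - P k).eval y|))
      (fun i => hPint x hx0 _) (fun i y => mul_nonneg (by positivity)
        (mul_nonneg (wt_nonneg y) (abs_nonneg _))) ?_ ?_ ?_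
    · filter_upwards [hns.tendsto_atTop.eventually_ge_atTop k] with i hi
      refine (htel _ hi).trans ?_
      rw [← Finset.mul_sum, div_mul_eq_mul_div, mul_div_assoc]
      exact mul_le_mul_of_nonneg_left (geom_sum_Ico_le_of_lt_one hθ0.le hθ1) hC0
    · have h1 : Measurable fun y => |x - y| ^ (1 - 2 * α) := by fun_prop
      exact h1.aestronglyMeasurable.mul (measurable_wt.aestronglyMeasurable.mul
        (hp.sub (hPm (P k))).1.norm)
    · filter_upwards [hae] with y hy
      by_cases hyT : y ∈ Ioo 0 T
      · have hw : 0 < √(wt T α y) := Real.sqrt_pos.2 (wt_pos hyT)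
        have h1 : Tendsto (fun i => (P (ns i)).eval y) atTop (𝓝 (p y)) := by
          have h2 := (hy.div_const (√(wt T α y))).const_sub (p y)
          rw [zero_div, sub_zero] at h2
          refine h2.congr fun i => ?_
          rw [mul_div_cancel_left₀ _ hw.ne']; ring
        simp only [eval_sub]
        exact ((h1.sub_const _).abs.const_mul _).const_mul _
      · simp [wt_of_notMem hyT]
  have hwin : ∀ x ∈ Ioo 0 T, ∃ δ, 0 < δ ∧ 2 * δ ≤ T ∧ Icc (2 * δ) (T - 2 * δ) ∈ 𝓝 x := by
    intro x hx
    have hm : 0 < min x (T - x) := lt_min hx.1 (by linarith [hx.2])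
    have h1 := min_le_left x (T - x)
    have h2 := min_le_right x (T - x)
    exact ⟨min x (T - x) / 4, by linarith, by linarith, Icc_mem_nhds (by linarith) (by linarith)⟩
  have hdiff : ∀ x (q : ℝ[X]), Integrable (fun y => |x - y| ^ (1 - 2 * α) *
      (wt T α y * |p y - q.eval y|)) → Integrable fun y => |x - y| ^ (1 - 2 * α) *
      (wt T α y * (p y - q.eval y)) := by
    intro x q h
    have h1 : Measurable fun y => |x - y| ^ (1 - 2 * α) := by fun_prop
    refine h.mono' (h1.aestronglyMeasurable.mul (measurable_wt.aestronglyMeasurable.mul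
        (hp.sub (hPm q)).1)) (.of_forall fun y => le_of_eq ?_)
    rw [norm_mul, norm_mul, Real.norm_of_nonneg (by positivity), Real.norm_of_nonneg (wt_nonneg y),
      Real.norm_eq_abs]
  have hPi : ∀ x ∈ Ioo 0 T, ∀ q : ℝ[X],
      Integrable fun y => |x - y| ^ (1 - 2 * α) * (wt T α y * q.eval y) := fun x hx q =>
    riesz_integrable_mul hα hx q.continuous
  have hpint : ∀ x ∈ Ioo 0 T,
      Integrable fun y => |x - y| ^ (1 - 2 * α) * (wt T α y * p y) := by
    intro x hx
    obtain ⟨δ, hδ, hδT, hn⟩ := hwin x hx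
    obtain ⟨C, θ, -, -, h⟩ := key δ hδ hδT
    refine ((hdiff x (P 0) (h x (mem_of_mem_nhds hn) 0).1).add (hPi x hx (P 0))).congr
      (.of_forall fun y => ?_)
    simp only [Pi.add_apply]; ring
  refine ⟨hpint, fun x hx => ContinuousAt.continuousWithinAt ?_⟩
  obtain ⟨δ, hδ, hδT, hn⟩ := hwin x hx
  obtain ⟨C, θ, hθ0, hθ1, h⟩ := key δ hδ hδT
  obtain ⟨K, -, hK⟩ := exists_Aop_poly ⟨hα.1, hα.2.le⟩ hT
  have hsub : Icc (2 * δ) (T - 2 * δ) ⊆ Ioo 0 T := fun y hy =>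
    ⟨by linarith [hy.1], by linarith [hy.2]⟩
  refine ContinuousOn.continuousAt (s := Icc (2 * δ) (T - 2 * δ)) ?_ hn
  -- On (0,T) the potentials of the partial sums are polynomials, and the geometric bound makes them
  -- converge uniformly on a neighbourhood of x.
  refine TendstoUniformlyOn.continuousOn (F := fun k y => 2 * (K (P k)).eval y) (p := atTop) ?_
    (.of_forall fun k => by have := (K (P k)).continuous; fun_prop)
  rw [Metric.tendstoUniformlyOn_iff]
  intro ε hε
  have hΓ : 0 < Real.Gamma (2 - 2 * α) := Real.Gamma_pos_of_pos (by linarith [hα.2])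
  have hlim : Tendsto (fun k => 1 / Real.Gamma (2 - 2 * α) * (C * θ ^ k)) atTop (𝓝 0) := by
    simpa using ((tendsto_pow_atTop_nhds_zero_of_lt_one hθ0.le hθ1).const_mul C).const_mul
      (1 / Real.Gamma (2 - 2 * α))
  filter_upwards [hlim.eventually (gt_mem_nhds hε)] with k hk y hy
  refine lt_of_le_of_lt ?_ hk
  rw [← hK (P k) y (hsub hy), Real.dist_eq, Aop, Aop, if_neg hα.2.ne, if_neg hα.2.ne, ← mul_sub,
    ← integral_sub (hpint y (hsub hy)) (hPi y (hsub hy) (P k)), abs_mul,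
    abs_of_pos (one_div_pos.2 hΓ)]
  refine mul_le_mul_of_nonneg_left ?_ (one_div_pos.2 hΓ).le
  refine (abs_integral_le_integral_abs).trans (le_trans (le_of_eq ?_) (h y hy k).2)
  congr 1; ext z
  rw [← mul_sub, ← mul_sub, abs_mul, abs_mul, abs_of_nonneg (wt_nonneg z),
    abs_of_nonneg (by positivity)]

end Interior

/-! ### Interval integrals in terms of kernels on the line -/

section Bridge

variable {T α γ t : ℝ} {w G : ℝ → ℝ}

/-- The derivative of u is known only a.e. on (0,T). That determines its fractional integrals at
every t, since the kernel cuts off s > t and G vanishes for s ≤ 0. -/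
lemma indicator_left_ae (ht : t ≤ T) (h : ∀ᵐ s, s ∈ Ioo 0 T → w s = G s)
    (hG : ∀ s ≤ 0, G s = 0) :
    (Ioo 0 t).indicator (fun s => (t - s) ^ (γ - 1) * w s) =ᵐ[volume]
      fun s => ker γ (t - s) * G s := by
  filter_upwards [h] with s hs
  by_cases h1 : s ∈ Ioo 0 t
  · rw [indicator_of_mem h1, hs ⟨h1.1, h1.2.trans_le ht⟩, ker_of_pos (by linarith [h1.2])]
  · rw [indicator_of_notMem h1]
    rcases le_or_gt s 0 with h2 | h2
    · rw [hG s h2, mul_zero]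
    · rw [ker_of_nonpos, zero_mul]
      by_contra h3
      exact h1 ⟨h2, by linarith⟩

lemma indicator_right_ae (ht : 0 ≤ t) (h : ∀ᵐ s, s ∈ Ioo 0 T → w s = G s)
    (hG : ∀ s, T ≤ s → G s = 0) :
    (Ioo t T).indicator (fun s => (s - t) ^ (γ - 1) * w s) =ᵐ[volume]
      fun s => ker γ (s - t) * G s := by
  filter_upwards [h] with s hs
  by_cases h1 : s ∈ Ioo t T
  · rw [indicator_of_mem h1, hs ⟨ht.trans_lt h1.1, h1.2⟩, ker_of_pos (by linarith [h1.1])]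
  · rw [indicator_of_notMem h1]
    rcases le_or_gt T s with h2 | h2
    · rw [hG s h2, mul_zero]
    · rw [ker_of_nonpos, zero_mul]
      by_contra h3
      exact h1 ⟨by linarith, h2⟩

lemma leftRL_eq (hγ : γ ≠ 0) (ht : t ∈ Icc 0 T) (h : ∀ᵐ s, s ∈ Ioo 0 T → w s = G s)
    (hG : ∀ s ≤ 0, G s = 0) :
    leftRL 0 γ w t = 1 / Real.Gamma γ * ∫ s, ker γ (t - s) * G s := by
  rw [leftRL, if_neg hγ, intervalIntegral.integral_of_le ht.1, integral_Ioc_eq_integral_Ioo,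
    ← integral_indicator measurableSet_Ioo, integral_congr_ae (indicator_left_ae ht.2 h hG)]

lemma rightRL_eq (hγ : γ ≠ 0) (ht : t ∈ Icc 0 T) (h : ∀ᵐ s, s ∈ Ioo 0 T → w s = G s)
    (hG : ∀ s, T ≤ s → G s = 0) :
    rightRL T γ w t = 1 / Real.Gamma γ * ∫ s, ker γ (s - t) * G s := by
  rw [rightRL, if_neg hγ, intervalIntegral.integral_of_le ht.2, integral_Ioc_eq_integral_Ioo,
    ← integral_indicator measurableSet_Ioo, integral_congr_ae (indicator_right_ae ht.1 h hG)]

lemma leftRLExists_of (ht : t ∈ Icc 0 T) (h : ∀ᵐ s, s ∈ Ioo 0 T → w s = G s)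
    (hG : ∀ s ≤ 0, G s = 0) (hi : Integrable fun s => ker γ (t - s) * G s) :
    LeftRLExists 0 γ w t := by
  right
  rw [intervalIntegrable_iff_integrableOn_Ioo_of_le ht.1,
    ← integrable_indicator_iff measurableSet_Ioo]
  exact hi.congr (indicator_left_ae ht.2 h hG).symm

lemma rightRLExists_of (ht : t ∈ Icc 0 T) (h : ∀ᵐ s, s ∈ Ioo 0 T → w s = G s)
    (hG : ∀ s, T ≤ s → G s = 0) (hi : Integrable fun s => ker γ (s - t) * G s) :
    RightRLExists T γ w t := by
  right
  rw [intervalIntegrable_iff_integrableOn_Ioo_of_le ht.2,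
    ← integrable_indicator_iff measurableSet_Ioo]
  exact hi.congr (indicator_right_ae ht.1 h hG).symm

lemma caputoLeft_eq (hα : α ≠ 1) {u g : ℝ → ℝ} (ht : t ∈ Icc 0 T)
    (h : ∀ᵐ s, s ∈ Ioo 0 T → deriv u s = g s) (hg : ∀ s ∉ Ioo 0 T, g s = 0) :
    caputoLeft 0 α u t = 1 / Real.Gamma (1 - α) * causal (1 - α) g t :=
  leftRL_eq (sub_ne_zero.2 hα.symm) ht h fun s hs => hg s fun h => (h.1.not_ge hs)

lemma caputoRight_eq (hα : α ≠ 1) {u g : ℝ → ℝ} (ht : t ∈ Icc 0 T)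
    (h : ∀ᵐ s, s ∈ Ioo 0 T → deriv u s = g s) (hg : ∀ s ∉ Ioo 0 T, g s = 0) :
    caputoRight T α u t = -(1 / Real.Gamma (1 - α) * anticausal (1 - α) g t) := by
  rw [caputoRight, rightRL_eq (sub_ne_zero.2 hα.symm) ht h
    fun s hs => hg s fun h => (h.2.not_ge hs)]
  rfl

/-- If the Riesz potential of the derivative of `u` converges at `t`, the flux is defined
at `t` and equals it. -/
lemma flux_eq_Aop (hα : α ∈ Ioo (1 / 2 : ℝ) 1) {u g : ℝ → ℝ} (ht : t ∈ Icc 0 T)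
    (h : ∀ᵐ s, s ∈ Ioo 0 T → deriv u s = g s) (hg : ∀ s ∉ Ioo 0 T, g s = 0)
    (hgm : AEStronglyMeasurable g) (hi : Integrable fun y => |t - y| ^ (1 - 2 * α) * g y) :
    LeftRLExists 0 (1 - α) (caputoLeft 0 α u) t ∧ RightRLExists T (1 - α) (caputoRight T α u) t ∧
      flux T α u t = Aop α g t := by
  have h1α : 0 < 1 - α := by linarith [hα.2]
  have hγ : 1 - α ≠ 0 := h1α.ne'
  have hα1 : α ≠ 1 := hα.2.ne
  have hsum : 1 - α + (1 - α) = 2 - 2 * α := by ring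
  set Γ := Real.Gamma (1 - α) with hΓ
  have hΓ0 : 0 < Γ := Real.Gamma_pos_of_pos h1α
  have hker : ∀ x, ker (2 - 2 * α) x ≤ |x| ^ (1 - 2 * α) := by
    intro x
    have h1 := ker_add_ker_neg (γ := 2 - 2 * α) (by linarith [hα.1]) x
    have h2 := ker_nonneg (2 - 2 * α) (-x)
    rw [show 2 - 2 * α - 1 = 1 - 2 * α by ring] at h1
    linarith
  have hkm := measurable_ker (2 - 2 * α)
  have hiL : Integrable fun s => ker (1 - α + (1 - α)) (t - s) * g s := by
    rw [hsum]
    have hm : Measurable fun s => ker (2 - 2 * α) (t - s) := by fun_prop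
    refine hi.mono (hm.aestronglyMeasurable.mul hgm) (.of_forall fun s => ?_)
    rw [norm_mul, norm_mul, Real.norm_of_nonneg (ker_nonneg _ _),
      Real.norm_of_nonneg (by positivity : 0 ≤ |t - s| ^ (1 - 2 * α))]
    exact mul_le_mul_of_nonneg_right (hker _) (norm_nonneg _)
  have hiR : Integrable fun s => ker (1 - α + (1 - α)) (s - t) * g s := by
    rw [hsum]
    have hm : Measurable fun s => ker (2 - 2 * α) (s - t) := by fun_prop
    refine hi.mono (hm.aestronglyMeasurable.mul hgm) (.of_forall fun s => ?_)
    rw [norm_mul, norm_mul, Real.norm_of_nonneg (ker_nonneg _ _),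
      Real.norm_of_nonneg (by positivity : 0 ≤ |t - s| ^ (1 - 2 * α)),
      abs_sub_comm t s]
    exact mul_le_mul_of_nonneg_right (hker _) (norm_nonneg _)
  obtain ⟨hL1, hL2⟩ := causal_comp h1α h1α hgm hiL
  obtain ⟨hR1, hR2⟩ := anticausal_comp h1α h1α hgm hiR
  have hcL : ∀ᵐ s, s ∈ Ioo 0 T → caputoLeft 0 α u s = 1 / Γ * causal (1 - α) g s :=
    .of_forall fun s hs => caputoLeft_eq hα1 (Ioo_subset_Icc_self hs) h hg
  have hcR : ∀ᵐ s, s ∈ Ioo 0 T → caputoRight T α u s = -(1 / Γ) * anticausal (1 - α) g s :=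
    .of_forall fun s hs => by
      rw [caputoRight_eq hα1 (Ioo_subset_Icc_self hs) h hg, neg_mul]
  have hcL0 : ∀ s ≤ 0, 1 / Γ * causal (1 - α) g s = 0 := fun s hs => by
    rw [causal_of_nonpos hg hs, mul_zero]
  have hcR0 : ∀ s, T ≤ s → -(1 / Γ) * anticausal (1 - α) g s = 0 := fun s hs => by
    rw [anticausal_of_le hg hs, mul_zero]
  have eL : (fun s => ker (1 - α) (t - s) * (1 / Γ * causal (1 - α) g s)) =
      fun s => 1 / Γ * (ker (1 - α) (t - s) * causal (1 - α) g s) := by ext s; ring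
  have eR : (fun s => ker (1 - α) (s - t) * (-(1 / Γ) * anticausal (1 - α) g s)) =
      fun s => -(1 / Γ) * (ker (1 - α) (s - t) * anticausal (1 - α) g s) := by ext s; ring
  refine ⟨leftRLExists_of ht hcL hcL0 (by rw [eL]; exact hL1.const_mul _),
    rightRLExists_of ht hcR hcR0 (by rw [eR]; exact hR1.const_mul _), ?_⟩
  rw [flux, leftRL_eq hγ ht hcL hcL0, rightRL_eq hγ ht hcR hcR0, eL, eR, integral_const_mul,
    integral_const_mul, hL2, hR2, Aop, if_neg hα1, hsum]
  rw [hsum] at hiL hiR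
  have h1 : ∫ y, |t - y| ^ (1 - 2 * α) * g y = (∫ s, ker (2 - 2 * α) (t - s) * g s) +
      ∫ s, ker (2 - 2 * α) (s - t) * g s := by
    rw [← integral_add hiL hiR]
    congr 1; ext s
    have h1 := ker_add_ker_neg (γ := 2 - 2 * α) (by linarith [hα.1]) (t - s)
    rw [show 2 - 2 * α - 1 = 1 - 2 * α by ring, neg_sub] at h1
    rw [← h1]; ring
  have hΓ2 : Real.Gamma (2 - 2 * α) ≠ 0 := (Real.Gamma_pos_of_pos (by linarith [hα.2])).ne'
  rw [h1, ProbabilityTheory.beta, hsum, ← hΓ]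
  field_simp
  ring

end Bridge

/-! ### Density of test functions and membership in E_0^α -/

section Density

open Polynomial

variable {T α : ℝ}

/-- The reciprocal of the weight. -/
noncomputable def recipWt (T α t : ℝ) : ℝ := |t * (T - t)| ^ (1 - α)

lemma continuous_recipWt (hα : α ≤ 1) : Continuous (recipWt T α) :=
  Continuous.rpow_const (by fun_prop) fun _ => Or.inr (by linarith)

lemma wt_mul_recipWt {t : ℝ} (ht : t ∈ Ioo 0 T) : wt T α t * recipWt T α t = 1 := by
  have h : 0 < t * (T - t) := mul_pos ht.1 (by linarith [ht.2])
  rw [wt_of_mem ht, recipWt, abs_of_pos h, ← Real.rpow_add h]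
  simp

/-- Dividing by the weight makes `wt` times the approximant a polynomial r, whose primitive is
smooth up to the end points. Density holds because a function orthogonal to all of these has
vanishing moments. -/
lemma exists_poly_approx (hT : 0 < T) (hα : α ∈ Ioc (1 / 2 : ℝ) 1) {p : ℝ → ℝ}
    (hp : MemWt T α p) {ε : ℝ} (hε : 0 < ε) :
    ∃ r : ℝ[X], ∫ t, wt T α t * (p t - recipWt T α t * r.eval t) ^ 2 < ε := by
  have hα0 : 0 < α := by linarith [hα.1]
  have hρ := continuous_recipWt (T := T) hα.2
  have hrm : ∀ r : ℝ[X], MemWt T α fun t => recipWt T α t * r.eval t := fun r =>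
    MemWt.of_continuousOn hT hα0 (hρ.mul r.continuous)
  have hmem : ∀ r : ℝ[X], MemLp (fun t => √(wt T α t) * (recipWt T α t * r.eval t)) 2 := fun r =>
    memLp_sqrt_wt _ (hrm r)
  let V : ℝ[X] →ₗ[ℝ] Lp ℝ 2 (volume : Measure ℝ) :=
    { toFun := fun r => (hmem r).toLp _
      map_add' := fun p q => by
        rw [← MemLp.toLp_add]
        congr 1; ext t; simp only [eval_add, Pi.add_apply]; ring
      map_smul' := fun a q => by
        simp only [RingHom.id_apply]
        rw [← MemLp.toLp_const_smul]
        congr 1; ext t; simp only [eval_smul, Pi.smul_apply, smul_eq_mul]; ring }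
  have hV : ∀ r, (V r : ℝ → ℝ) =ᵐ[volume] fun t => √(wt T α t) * (recipWt T α t * r.eval t) :=
    fun r => (hmem r).coeFn_toLp
  have hpm := memLp_sqrt_wt p hp
  set P : Lp ℝ 2 (volume : Measure ℝ) := hpm.toLp _ with hPdef
  have hP : (P : ℝ → ℝ) =ᵐ[volume] fun t => √(wt T α t) * p t := hpm.coeFn_toLp
  have hcl : P ∈ (LinearMap.range V).topologicalClosure := by
    rw [← Submodule.orthogonal_orthogonal_eq_closure, Submodule.mem_orthogonal]
    intro s hs
    rw [Submodule.mem_orthogonal] at hs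
    set Z : ℝ → ℝ := fun t => s t * (√(wt T α t) * recipWt T α t) with hZ
    have h1 : ∀ r : ℝ[X], ∫ t, Z t * r.eval t = 0 := by
      intro r
      rw [← hs _ (LinearMap.mem_range_self V r), L2.inner_def]
      refine integral_congr_ae ?_
      filter_upwards [hV r] with t ht
      rw [ht]
      simp only [RCLike.inner_apply, conj_trivial, hZ]
      ring
    have h2 : Integrable Z := by
      have h3 := (Lp.memLp s).integrable_mul (hmem 1)
      refine h3.congr (.of_forall fun t => ?_)
      simp [hZ]
    have h3 := ae_eq_zero_of_moments (T := T) h2 (fun t ht => by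
      simp [hZ, wt_of_notMem fun h => ht (Ioo_subset_Icc_self h)]) h1
    rw [L2.inner_def]
    refine integral_eq_zero_of_ae ?_
    filter_upwards [h3, hP] with t h4 h5
    rw [h5]
    simp only [RCLike.inner_apply, conj_trivial, Pi.zero_apply]
    by_cases ht : t ∈ Ioo 0 T
    · have hw := wt_pos (α := α) ht
      have h6 : recipWt T α t ≠ 0 := fun h0 => by
        have := wt_mul_recipWt (α := α) ht
        rw [h0, mul_zero] at this
        exact zero_ne_one this
      have : s t = 0 := (mul_eq_zero.1 h4).resolve_right
        (mul_ne_zero (Real.sqrt_pos.2 hw).ne' h6)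
      rw [this, mul_zero]
    · simp [wt_of_notMem ht]
  obtain ⟨y, ⟨r, rfl⟩, hr⟩ := Metric.mem_closure_iff.1 hcl (√ε) (Real.sqrt_pos.2 hε)
  refine ⟨r, ?_⟩
  rw [dist_eq_norm] at hr
  have h1 : ‖P - V r‖ ^ 2 = ∫ t, wt T α t * (p t - recipWt T α t * r.eval t) ^ 2 := by
    rw [← real_inner_self_eq_norm_sq, L2.inner_def]
    refine integral_congr_ae ?_
    filter_upwards [Lp.coeFn_sub P (V r), hV r, hP] with t h1 h2 h3
    rw [h1, Pi.sub_apply, h2, h3]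
    simp only [RCLike.inner_apply, conj_trivial]
    linear_combination (p t - recipWt T α t * r.eval t) ^ 2 *
      (Real.mul_self_sqrt (wt_nonneg (T := T) (α := α) t))
  rw [← h1, ← Real.sq_sqrt hε.le]
  exact pow_lt_pow_left₀ hr (norm_nonneg _) two_ne_zero

lemma wt_mul_recipWt_mul (r : ℝ → ℝ) {t : ℝ} (ht : t ∈ Icc 0 T) :
    ∫ s in (0 : ℝ)..t, wt T α s * (recipWt T α s * r s) = ∫ s in (0 : ℝ)..t, r s := by
  rw [intervalIntegral.integral_of_le ht.1, intervalIntegral.integral_of_le ht.1,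
    integral_Ioc_eq_integral_Ioo, integral_Ioc_eq_integral_Ioo]
  refine setIntegral_congr_fun measurableSet_Ioo fun s hs => ?_
  rw [← mul_assoc, wt_mul_recipWt ⟨hs.1, hs.2.trans_le ht.2⟩, one_mul]

/-- Subtract the mean of r. Since `wt` · p has mean zero, the mean of r is bounded by the
approximation error, so the correction is of the same order. -/
lemma exists_poly_approx_mean_zero (hT : 0 < T) (hα : α ∈ Ioc (1 / 2 : ℝ) 1) {p : ℝ → ℝ}
    (hp : MemWt T α p) (hp0 : ∫ t, wt T α t * p t = 0) {ε : ℝ} (hε : 0 < ε) :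
    ∃ r : ℝ[X], ∫ t in (0 : ℝ)..T, r.eval t = 0 ∧
      ∫ t, wt T α t * (p t - recipWt T α t * r.eval t) ^ 2 < ε := by
  have hα0 : 0 < α := by linarith [hα.1]
  have hρ := continuous_recipWt (T := T) hα.2
  have hrm : ∀ r : ℝ[X], MemWt T α fun t => recipWt T α t * r.eval t := fun r =>
    MemWt.of_continuousOn hT hα0 (hρ.mul r.continuous)
  have hρm : MemWt T α (recipWt T α) := MemWt.of_continuousOn hT hα0 hρ
  set w₀ := ∫ t, wt T α t with hw₀
  set w₁ := ∫ t, wt T α t * recipWt T α t ^ 2 with hw₁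
  have hw₀0 : 0 ≤ w₀ := integral_nonneg fun t => wt_nonneg t
  have hw₁0 : 0 ≤ w₁ := integral_nonneg fun t => mul_nonneg (wt_nonneg t) (sq_nonneg _)
  -- This factor is the total loss: 2e from the approximation and 2m²w₁ from the mean, with m² ≤
  -- w₀e/T².
  have hK : 0 < 2 + 2 * (w₀ * w₁ / T ^ 2) := by positivity
  obtain ⟨r, hr⟩ := exists_poly_approx hT hα hp (div_pos hε hK)
  set e := ∫ t, wt T α t * (p t - recipWt T α t * r.eval t) ^ 2 with he
  set m := (∫ t in (0 : ℝ)..T, r.eval t) / T with hm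
  have hd := hp.sub (hrm r)
  have hm2 : m ^ 2 ≤ w₀ * e / T ^ 2 := by
    have h1 := hd.sq_primitive_le hT hα0 hT.le
    have h2 : ∫ s in (0 : ℝ)..T, wt T α s * (p s - recipWt T α s * r.eval s) = -(m * T) := by
      simp_rw [mul_sub]
      rw [intervalIntegral.integral_sub (hp.integrable hT hα0).intervalIntegrable
        ((hrm r).integrable hT hα0).intervalIntegrable, ← integral_eq_intervalIntegral_wt hT, hp0,
        wt_mul_recipWt_mul _ ⟨hT.le, le_rfl⟩, hm, div_mul_cancel₀ _ hT.ne', zero_sub]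
    rw [h2, neg_sq, mul_pow] at h1
    rw [le_div_iff₀ (by positivity)]
    exact h1
  refine ⟨r - C m, ?_, ?_⟩
  · simp only [eval_sub, eval_C]
    rw [intervalIntegral.integral_sub (r.continuous.intervalIntegrable _ _)
      (continuous_const.intervalIntegrable _ _), intervalIntegral.integral_const, hm, sub_zero,
      smul_eq_mul, mul_div_cancel₀ _ hT.ne', sub_self]
  · have h1 : ∫ t, wt T α t * (p t - recipWt T α t * (r - C m).eval t) ^ 2 ≤
        2 * e + 2 * m ^ 2 * w₁ := by
      rw [he, hw₁, ← integral_const_mul, ← integral_const_mul,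
        ← integral_add (hd.2.const_mul 2) (hρm.2.const_mul _)]
      refine integral_mono (hp.sub (hrm _)).2 ((hd.2.const_mul 2).add (hρm.2.const_mul _))
        fun t => ?_
      simp only [eval_sub, eval_C]
      have h := wt_nonneg (T := T) (α := α) t
      nlinarith [mul_nonneg h (sq_nonneg (p t - recipWt T α t * r.eval t - m * recipWt T α t))]
    refine h1.trans_lt ?_
    rw [lt_div_iff₀ hK] at hr
    calc 2 * e + 2 * m ^ 2 * w₁ ≤ 2 * e + 2 * (w₀ * e / T ^ 2) * w₁ := by gcongr
      _ = e * (2 + 2 * (w₀ * w₁ / T ^ 2)) := by ring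
      _ < ε := hr

lemma tendsto_eLpNorm_two {X : Type*} [MeasurableSpace X] {μ : Measure X} {F : ℕ → X → ℝ}
    (hF : ∀ n, MemLp (F n) 2 μ) {e : ℕ → ℝ} (he : Tendsto e atTop (𝓝 0))
    (hle : ∀ n, ∫ x, F n x ^ 2 ∂μ ≤ e n) :
    Tendsto (fun n => eLpNorm (F n) 2 μ) atTop (𝓝 0) := by
  have h1 : Tendsto (fun n => ENNReal.ofReal (√(e n))) atTop (𝓝 0) := by
    have := ENNReal.tendsto_ofReal he.sqrt
    simpa using this
  refine tendsto_of_tendsto_of_tendsto_of_le_of_le tendsto_const_nhds h1 (fun _ => zero_le)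
    fun n => ?_
  rw [eLpNorm_two_eq (hF n)]
  exact ENNReal.ofReal_le_ofReal (Real.sqrt_le_sqrt (hle n))

/-- The convolution of two integrable functions converges a.e. The kernel is not integrable on the
line, but its part beyond T never meets the support of g when t ≤ T. -/
lemma ae_integrable_ker_mul {γ : ℝ} (hγ : 0 < γ) {g : ℝ → ℝ} (hg : Integrable g)
    (hg0 : ∀ s ∉ Ioo 0 T, g s = 0) :
    ∀ᵐ t, t ∈ Icc 0 T → Integrable fun s => ker γ (t - s) * g s := by
  have h1 : Integrable ((Iio T).indicator (ker γ)) :=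
    (integrable_indicator_iff measurableSet_Iio).2 (integrableOn_ker hγ T)
  filter_upwards [hg.ae_convolution_exists (ContinuousLinearMap.mul ℝ ℝ) h1] with t ht htT
  refine Integrable.congr ht (.of_forall fun s => ?_)
  simp only [ContinuousLinearMap.mul_apply']
  by_cases hs : s ∈ Ioo 0 T
  · rw [indicator_of_mem (by simp only [mem_Iio]; linarith [hs.1, htT.2]), mul_comm]
  · rw [hg0 s hs, mul_zero, zero_mul]

end Density

section Space

open Polynomial

variable {T α : ℝ}

/-- The energy identity turns the L² norm into a Riesz form, and the Schur test bounds that form by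
the weighted norm. -/
lemma causal_memLp (hα : α ∈ Ioo (1 / 2 : ℝ) 1) {p : ℝ → ℝ} (hp : MemWt T α p) :
    MemLp (causal (1 - α) fun t => wt T α t * p t) 2 ∧
      ∫ t, causal (1 - α) (fun t => wt T α t * p t) t ^ 2 ≤
        ProbabilityTheory.beta (2 * α - 1) (1 - α) * eqConst α * ∫ t, wt T α t * p t ^ 2 := by
  have hm : AEStronglyMeasurable fun t => wt T α t * p t :=
    measurable_wt.aestronglyMeasurable.mul hp.1
  have hR := integrable_riesz_pair hα hp hp
  obtain ⟨h1, h2⟩ := causal_sq hα hm hR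
  refine ⟨(memLp_two_iff_integrable_sq (aestronglyMeasurable_causal hm)).2 h1, ?_⟩
  rw [h2, mul_assoc]
  refine mul_le_mul_of_nonneg_left ?_
    (ProbabilityTheory.beta_pos (by linarith [hα.1]) (by linarith [hα.2])).le
  refine le_trans ?_ (integral_riesz_abs_le hα hp)
  refine integral_mono hR ?_ fun z => ?_
  · refine hR.norm.congr (.of_forall fun z => ?_)
    dsimp only
    rw [norm_mul, Real.norm_of_nonneg (by positivity : 0 ≤ |z.1 - z.2| ^ (1 - 2 * α)),
      Real.norm_eq_abs]
  · exact mul_le_mul_of_nonneg_left (le_abs_self _) (by positivity)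

lemma setIntegral_sq_le {F : ℝ → ℝ} (hF : MemLp F 2) (s : Set ℝ) :
    ∫ t in s, F t ^ 2 ≤ ∫ t, F t ^ 2 :=
  setIntegral_le_integral hF.integrable_sq (.of_forall fun _ => sq_nonneg _)

/-- The left Caputo derivative is bounded from the weighted space to `L²`. -/
lemma exists_caputo_bound (hT : 0 < T) (hα : α ∈ Ioc (1 / 2 : ℝ) 1) :
    ∃ K : ℝ, ∀ p q u v : ℝ → ℝ, MemWt T α p → MemWt T α q →
      (∀ᵐ s, s ∈ Ioo 0 T → deriv u s = wt T α s * p s) →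
      (∀ᵐ s, s ∈ Ioo 0 T → deriv v s = wt T α s * q s) →
      MemLp (fun t => caputoLeft 0 α u t - caputoLeft 0 α v t) 2 (volume.restrict (Icc 0 T)) ∧
      ∫ t in Icc 0 T, (caputoLeft 0 α u t - caputoLeft 0 α v t) ^ 2 ≤
        K * ∫ t, wt T α t * (p t - q t) ^ 2 := by
  have hα0 : 0 < α := by linarith [hα.1]
  -- F is the Caputo derivative of the difference, extended to the line. For α < 1 it equals the
  -- difference of the derivatives only where both integrals converge, that is a.e.
  suffices h : ∃ K : ℝ, ∀ p q u v : ℝ → ℝ, MemWt T α p → MemWt T α q →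
      (∀ᵐ s, s ∈ Ioo 0 T → deriv u s = wt T α s * p s) →
      (∀ᵐ s, s ∈ Ioo 0 T → deriv v s = wt T α s * q s) → ∃ F : ℝ → ℝ, MemLp F 2 ∧
      (∀ᵐ t, t ∈ Ioo 0 T → caputoLeft 0 α u t - caputoLeft 0 α v t = F t) ∧
      ∫ t, F t ^ 2 ≤ K * ∫ t, wt T α t * (p t - q t) ^ 2 by
    obtain ⟨K, hK⟩ := h
    refine ⟨K, fun p q u v hp hq hu hv => ?_⟩
    obtain ⟨F, hF, hFe, hFK⟩ := hK p q u v hp hq hu hv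
    have hae : (fun t => caputoLeft 0 α u t - caputoLeft 0 α v t) =ᵐ[volume.restrict (Icc 0 T)]
        F := by
      rw [← restrict_Ioo_eq_restrict_Icc]
      exact (ae_restrict_iff' measurableSet_Ioo).2 hFe
    refine ⟨(hF.restrict _).ae_eq hae.symm, ?_⟩
    rw [integral_congr_ae (hae.mono fun t ht => congrArg (· ^ 2) ht)]
    exact (setIntegral_sq_le hF _).trans hFK
  by_cases h : α = 1
  · subst h
    refine ⟨1, fun p q u v hp hq hu hv => ⟨fun t => √(wt T 1 t) * (p t - q t),
      memLp_sqrt_wt _ (hp.sub hq), ?_, ?_⟩⟩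
    · filter_upwards [hu, hv] with t h1 h2 ht
      simp only [caputoLeft, leftRL, sub_self, if_pos]
      rw [h1 ht, h2 ht, wt_of_mem ht]
      simp
    · rw [one_mul]
      simp_rw [mul_pow, Real.sq_sqrt (wt_nonneg _)]
      exact le_rfl
  · have hα' : α ∈ Ioo (1 / 2 : ℝ) 1 := ⟨hα.1, lt_of_le_of_ne hα.2 h⟩
    have h1α : 0 < 1 - α := by linarith [hα'.2]
    refine ⟨(1 / Real.Gamma (1 - α)) ^ 2 * (ProbabilityTheory.beta (2 * α - 1) (1 - α) * eqConst α),
      fun p q u v hp hq hu hv => ⟨fun t => 1 / Real.Gamma (1 - α) *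
        causal (1 - α) (fun t => wt T α t * (p t - q t)) t,
      (causal_memLp hα' (hp.sub hq)).1.const_mul _, ?_, ?_⟩⟩
    · have h0 : ∀ (p : ℝ → ℝ), ∀ s ∉ Ioo 0 T, wt T α s * p s = 0 := fun p s hs => by
        rw [wt_of_notMem hs, zero_mul]
      filter_upwards [ae_integrable_ker_mul h1α (hp.integrable hT hα0) (h0 p),
        ae_integrable_ker_mul h1α (hq.integrable hT hα0) (h0 q)] with t h1 h2 ht
      have ht' := Ioo_subset_Icc_self ht
      rw [caputoLeft_eq h ht' hu (h0 p), caputoLeft_eq h ht' hv (h0 q), ← mul_sub, causal, causal,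
        causal, ← integral_sub (h1 ht') (h2 ht')]
      congr 2; ext s; ring
    · simp_rw [mul_pow]
      rw [integral_const_mul, mul_assoc]
      exact mul_le_mul_of_nonneg_left (causal_memLp hα' (hp.sub hq)).2 (sq_nonneg _)

/-- Primitives of weighted `L²` functions that vanish at the right end belong to the fractional
derivative space. -/
theorem memE0_primitive (hT : 0 < T) (hα : α ∈ Ioc (1 / 2 : ℝ) 1) {p : ℝ → ℝ}
    (hp : MemWt T α p) (hp0 : ∫ t, wt T α t * p t = 0) :
    MemE0 T α fun t => ∫ s in (0 : ℝ)..t, wt T α s * p s := by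
  have hα0 : 0 < α := by linarith [hα.1]
  have hρ := continuous_recipWt (T := T) hα.2
  have hpi := hp.integrable hT hα0
  have hrm : ∀ r : ℝ[X], MemWt T α fun t => recipWt T α t * r.eval t := fun r =>
    MemWt.of_continuousOn hT hα0 (hρ.mul r.continuous)
  set u : ℝ → ℝ := fun t => ∫ s in (0 : ℝ)..t, wt T α s * p s with hu
  have hucont : Continuous u := intervalIntegral.continuous_primitive
    (fun _ _ => hpi.intervalIntegrable) 0
  have hu' : ∀ᵐ s, s ∈ Ioo 0 T → deriv u s = wt T α s * p s :=
    (LocallyIntegrable.ae_hasDerivAt_integral hpi.locallyIntegrable).mono fun s hs _ => (hs 0).deriv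
  have hcontLp : ∀ F : ℝ → ℝ, Continuous F → MemLp F 2 (volume.restrict (Icc 0 T)) := by
    intro F hF
    rw [memLp_two_iff_integrable_sq hF.aestronglyMeasurable]
    exact (hF.pow 2).integrableOn_Icc
  obtain ⟨K, hK⟩ := exists_caputo_bound hT hα
  choose r hr0 hr using fun n : ℕ => exists_poly_approx_mean_zero hT hα hp hp0
    (ε := 1 / ((n : ℝ) + 1)) (by positivity)
  set e : ℕ → ℝ := fun n => ∫ t, wt T α t * (p t - recipWt T α t * (r n).eval t) ^ 2 with he
  have he0 : Tendsto e atTop (𝓝 0) :=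
    squeeze_zero (fun n => integral_nonneg fun t => mul_nonneg (wt_nonneg t) (sq_nonneg _))
      (fun n => (hr n).le) tendsto_one_div_add_atTop_nhds_zero_nat
  -- The antiderivative normalised to vanish at 0; the zero mean of r n makes it vanish at T as
  -- well.
  set φ : ℕ → ℝ → ℝ := fun n t => (polyPrim (r n) - C ((polyPrim (r n)).eval 0)).eval t with hφ
  have hφ' : ∀ n t, HasDerivAt (φ n) ((r n).eval t) t := fun n t =>
    ((polyPrim (r n) - C ((polyPrim (r n)).eval 0)).hasDerivAt t).congr_deriv (by
      rw [derivative_sub, derivative_C, sub_zero, derivative_polyPrim])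
  have hφ0 : ∀ n, φ n 0 = 0 := fun n => by simp [hφ]
  have hφi : ∀ n t, φ n t = ∫ s in (0 : ℝ)..t, (r n).eval s := fun n t => by
    rw [intervalIntegral.integral_eq_sub_of_hasDerivAt (fun s _ => hφ' n s)
      ((r n).continuous.intervalIntegrable _ _), hφ0, sub_zero]
  have hφc : ∀ n, Continuous (φ n) := fun n => Polynomial.continuous _
  have hφd : ∀ n, ∀ᵐ s, s ∈ Ioo 0 T → deriv (φ n) s =
      wt T α s * (recipWt T α s * (r n).eval s) := fun n => .of_forall fun s hs => by
    rw [(hφ' n s).deriv, ← mul_assoc, wt_mul_recipWt hs, one_mul]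
  have hsymm : ∀ n, ∫ t, wt T α t * (recipWt T α t * (r n).eval t - p t) ^ 2 = e n := fun n => by
    rw [he]; congr 1; ext t; ring
  refine ⟨hcontLp u hucont, caputoLeft 0 α u, ?_, φ, fun n => ⟨?_, hφ0 n, ?_⟩, ?_, ?_⟩
  · have h0 : MemWt T α fun _ => (0 : ℝ) := MemWt.of_continuousOn hT hα0 continuous_const
    have h1 := (hK p (fun _ => 0) u (fun _ => 0) hp h0 hu'
      (.of_forall fun s _ => by simp)).1
    refine h1.ae_eq (.of_forall fun t => ?_)
    have : caputoLeft 0 α (fun _ => 0) t = 0 := by simp [caputoLeft, leftRL]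
    simp only [this, sub_zero]
  · exact (Polynomial.contDiff_aeval _ _).contDiffOn
  · rw [hφi, hr0]
  · refine tendsto_eLpNorm_two (e := fun n => T * ((∫ s, wt T α s) * e n))
      (fun n => hcontLp _ ((hφc n).sub hucont)) (by simpa using (he0.const_mul _).const_mul T)
      fun n => ?_
    have hb : ∀ t ∈ Icc 0 T, (φ n t - u t) ^ 2 ≤ (∫ s, wt T α s) * e n := by
      intro t ht
      refine le_trans (le_of_eq ?_) ((hp.sub (hrm (r n))).sq_primitive_le hT hα0 ht.1)
      simp_rw [mul_sub]
      rw [intervalIntegral.integral_sub hpi.intervalIntegrable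
        ((hrm (r n)).integrable hT hα0).intervalIntegrable, wt_mul_recipWt_mul _ ht, ← hφi,
        sub_sq_comm]
    refine (setIntegral_mono_on (((hφc n).sub hucont).pow 2).integrableOn_Icc
      (continuous_const.integrableOn_Icc) measurableSet_Icc hb).trans (le_of_eq ?_)
    rw [setIntegral_const, Real.volume_real_Icc_of_le hT.le, sub_zero, smul_eq_mul]
  · refine tendsto_eLpNorm_two (e := fun n => K * e n)
      (fun n => (hK _ _ _ _ (hrm (r n)) hp (hφd n) hu').1) (by simpa using he0.const_mul K)
      fun n => ?_
    rw [← hsymm]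
    exact (hK _ _ _ _ (hrm (r n)) hp (hφd n) hu').2

end Space

/-! ### The weak and the classical equation -/

section Solution

variable {T α : ℝ}

lemma integral_mul_Aop (hα : α ∈ Ioo (1 / 2 : ℝ) 1) {p q : ℝ → ℝ}
    (hp : MemWt T α p) (hq : MemWt T α q) :
    ∫ t, (wt T α t * q t) * Aop α (fun s => wt T α s * p s) t =
      1 / Real.Gamma (2 - 2 * α) * ∫ z : ℝ × ℝ, |z.1 - z.2| ^ (1 - 2 * α) *
        ((wt T α z.1 * p z.1) * (wt T α z.2 * q z.2)) := by
  have h := Aop_symm (α := α) ⟨hα.1, hα.2.le⟩ hp hq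
  rw [h, Measure.volume_eq_prod, integral_prod _ (integrable_riesz_pair hα hp hq),
    ← integral_const_mul]
  congr 1; ext t
  rw [Aop, if_neg hα.2.ne, mul_left_comm, ← integral_const_mul (wt T α t * p t)]
  congr 2; ext s; ring

/-- The bilinear form of the weak formulation in terms of the principal operator. -/
lemma weak_form_eq (hT : 0 < T) (hα : α ∈ Ioc (1 / 2 : ℝ) 1) {p q u v : ℝ → ℝ}
    (hp : MemWt T α p) (hq : MemWt T α q)
    (hu : ∀ᵐ s, s ∈ Ioo 0 T → deriv u s = wt T α s * p s)
    (hv : ∀ᵐ s, s ∈ Ioo 0 T → deriv v s = wt T α s * q s) :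
    -∫ t in (0 : ℝ)..T, (caputoLeft 0 α u t * caputoRight T α v t
        + caputoRight T α u t * caputoLeft 0 α v t) =
      ∫ t, (wt T α t * q t) * Aop α (fun s => wt T α s * p s) t := by
  rw [intervalIntegral.integral_of_le hT.le, integral_Ioc_eq_integral_Ioo, ← integral_neg,
    ← integral_indicator measurableSet_Ioo]
  by_cases h : α = 1
  · subst h
    refine integral_congr_ae ?_
    filter_upwards [hu, hv] with t h1 h2
    by_cases ht : t ∈ Ioo 0 T
    · rw [indicator_of_mem ht]
      simp only [caputoLeft, caputoRight, leftRL, rightRL, sub_self, if_pos, Aop]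
      rw [h1 ht, h2 ht]; ring
    · rw [indicator_of_notMem ht, wt_of_notMem ht]; ring
  · have hα' : α ∈ Ioo (1 / 2 : ℝ) 1 := ⟨hα.1, lt_of_le_of_ne hα.2 h⟩
    have h1α : 0 < 1 - α := by linarith [hα'.2]
    have hm : ∀ {p : ℝ → ℝ}, MemWt T α p → AEStronglyMeasurable fun t => wt T α t * p t :=
      fun hp => measurable_wt.aestronglyMeasurable.mul hp.1
    have h0 : ∀ (p : ℝ → ℝ), ∀ s ∉ Ioo 0 T, wt T α s * p s = 0 := fun p s hs => by
      rw [wt_of_notMem hs, zero_mul]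
    obtain ⟨i1, i2, h3⟩ := causal_anticausal_pair hα' (hm hp) (hm hq)
      (integrable_riesz_pair hα' hp hq)
    set Γ := Real.Gamma (1 - α) with hΓ
    have hΓ0 : 0 < Γ := Real.Gamma_pos_of_pos h1α
    -- The indicator can be dropped: to the left of 0 the causal factors vanish, to the right of T
    -- the anticausal ones.
    have e : (Ioo 0 T).indicator (fun t => -(caputoLeft 0 α u t * caputoRight T α v t
        + caputoRight T α u t * caputoLeft 0 α v t)) = fun t => (1 / Γ) ^ 2 *
        (causal (1 - α) (fun t => wt T α t * p t) t *
          anticausal (1 - α) (fun t => wt T α t * q t) t +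
        anticausal (1 - α) (fun t => wt T α t * p t) t *
          causal (1 - α) (fun t => wt T α t * q t) t) := by
      ext t
      by_cases ht : t ∈ Ioo 0 T
      · have ht' := Ioo_subset_Icc_self ht
        rw [indicator_of_mem ht, caputoLeft_eq h ht' hu (h0 p), caputoLeft_eq h ht' hv (h0 q),
          caputoRight_eq h ht' hu (h0 p), caputoRight_eq h ht' hv (h0 q)]
        ring
      · rw [indicator_of_notMem ht]
        rcases le_or_gt t 0 with h4 | h4
        · rw [causal_of_nonpos (h0 p) h4, causal_of_nonpos (h0 q) h4]; ring
        · have h5 : T ≤ t := by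
            by_contra h6
            exact ht ⟨h4, not_le.1 h6⟩
          rw [anticausal_of_le (h0 p) h5, anticausal_of_le (h0 q) h5]; ring
    rw [e, integral_const_mul, integral_add i1 i2, h3, integral_mul_Aop hα' hp hq,
      ProbabilityTheory.beta, ← hΓ, show 1 - α + (1 - α) = 2 - 2 * α by ring]
    have hΓ2 : Real.Gamma (2 - 2 * α) ≠ 0 := (Real.Gamma_pos_of_pos (by linarith [hα'.2])).ne'
    field_simp

/-- The derivative of a test function, written in weighted form. -/
lemma exists_weighted_derivative (hT : 0 < T) (hα : α ∈ Ioc (1 / 2 : ℝ) 1) {v : ℝ → ℝ}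
    (hv : IsTest T v) : ∃ d q : ℝ → ℝ, ContinuousOn d (Icc 0 T) ∧ MemWt T α q ∧
      (∀ t ∈ Ioo 0 T, HasDerivAt v (d t) t) ∧ ∀ t ∈ Ioo 0 T, wt T α t * q t = d t := by
  have hud : UniqueDiffOn ℝ (Icc 0 T) := uniqueDiffOn_Icc hT
  have hd := hv.1.continuousOn_derivWithin hud (by norm_num)
  have hρ := continuous_recipWt (T := T) hα.2
  set d := derivWithin v (Icc 0 T)
  have hmul : ∀ t ∈ Ioo 0 T, wt T α t * (recipWt T α t * (Ioo 0 T).indicator d t) = d t :=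
    fun t ht => by rw [← mul_assoc, wt_mul_recipWt ht, one_mul, indicator_of_mem ht]
  refine ⟨d, fun t => recipWt T α t * (Ioo 0 T).indicator d t, hd, ⟨?_, ?_⟩, fun t ht => ?_, hmul⟩
  · refine hρ.aestronglyMeasurable.mul ((aestronglyMeasurable_indicator_iff measurableSet_Ioo).2 ?_)
    exact (hd.mono Ioo_subset_Icc_self).aestronglyMeasurable measurableSet_Ioo
  · have h1 : IntegrableOn (fun t => recipWt T α t * d t ^ 2) (Ioo 0 T) :=
      ((hρ.continuousOn.mul (hd.pow 2)).integrableOn_Icc).mono_set Ioo_subset_Icc_self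
    refine ((integrable_indicator_iff measurableSet_Ioo).2 h1).congr (.of_forall fun t => ?_)
    by_cases ht : t ∈ Ioo 0 T
    · have := hmul t ht
      simp only [indicator_of_mem ht] at this ⊢
      linear_combination (-(recipWt T α t * d t)) * this
    · simp only [indicator_of_notMem ht, wt_of_notMem ht, zero_mul]
  · have hn := Icc_mem_nhds ht.1 ht.2
    have hdt := hv.1.differentiableOn (by norm_num) t (Ioo_subset_Icc_self ht)
    exact hdt.hasDerivWithinAt.hasDerivAt hn

/-- The bilinear form is ∫ v' · `Aop α u'` = ∫ v' (c - H) with H' = f(u). Integrating by parts gives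
∫ f(u) v, as v vanishes at both ends. -/
theorem isWeakSolution_primitive (hT : 0 < T) (hα : α ∈ Ioc (1 / 2 : ℝ) 1) {f p : ℝ → ℝ}
    (hf : Continuous f) (hp : MemWt T α p) {c : ℝ}
    (hc : ∀ᵐ x, x ∈ Ioo 0 T → Aop α (fun t => wt T α t * p t) x =
        c - ∫ s in (0 : ℝ)..x, f (∫ τ in (0 : ℝ)..s, wt T α τ * p τ)) :
    IsWeakSolution T α f fun t => ∫ s in (0 : ℝ)..t, wt T α s * p s := by
  have hα0 : 0 < α := by linarith [hα.1]
  have hpi := hp.integrable hT hα0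
  set u : ℝ → ℝ := fun t => ∫ s in (0 : ℝ)..t, wt T α s * p s with hu
  have hucont : Continuous u := intervalIntegral.continuous_primitive
    (fun _ _ => hpi.intervalIntegrable) 0
  have hu' : ∀ᵐ s, s ∈ Ioo 0 T → deriv u s = wt T α s * p s :=
    (LocallyIntegrable.ae_hasDerivAt_integral hpi.locallyIntegrable).mono
      fun s hs _ => (hs 0).deriv
  have hfu : Continuous fun t => f (u t) := hf.comp hucont
  set H : ℝ → ℝ := fun x => ∫ s in (0 : ℝ)..x, f (u s) with hH
  have hH' : ∀ t, HasDerivAt H (f (u t)) t := fun t =>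
    (hfu.integral_hasStrictDerivAt 0 t).hasDerivAt
  have hHc : Continuous H := continuous_iff_continuousAt.2 fun t => (hH' t).continuousAt
  intro v hv
  obtain ⟨d, q, hd, hq, hvd, hqd⟩ := exists_weighted_derivative hT hα hv
  rw [weak_form_eq hT hα hp hq hu' (.of_forall fun s hs => by rw [(hvd s hs).deriv, hqd s hs])]
  have h1 : ∫ t, (wt T α t * q t) * Aop α (fun s => wt T α s * p s) t =
      ∫ t in (0 : ℝ)..T, d t * (c - H t) := by
    rw [intervalIntegral.integral_of_le hT.le, integral_Ioc_eq_integral_Ioo,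
      ← integral_indicator measurableSet_Ioo]
    refine integral_congr_ae ?_
    filter_upwards [hc] with t h2
    by_cases ht : t ∈ Ioo 0 T
    · rw [indicator_of_mem ht, h2 ht, hqd t ht]
    · rw [indicator_of_notMem ht, wt_of_notMem ht, zero_mul, zero_mul]
  have hvc : ContinuousOn v (Icc 0 T) := hv.1.continuousOn
  have i1 : IntervalIntegrable (fun t => d t * (c - H t)) volume 0 T :=
    (hd.mul (by fun_prop)).intervalIntegrable_of_Icc hT.le
  have i2 : IntervalIntegrable (fun t => f (u t) * v t) volume 0 T :=
    (hfu.continuousOn.mul hvc).intervalIntegrable_of_Icc hT.le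
  have h2 := intervalIntegral.integral_eq_sub_of_hasDerivAt_of_le hT.le
    (f := fun t => v t * (c - H t)) (f' := fun t => d t * (c - H t) - f (u t) * v t)
    (hvc.mul (by fun_prop))
    (fun t ht => ((hvd t ht).mul ((hH' t).const_sub c)).congr_deriv (by ring)) (i1.sub i2)
  rw [intervalIntegral.integral_sub i1 i2, hv.2.1, hv.2.2] at h2
  rw [h1]
  linarith

/-- If the Riesz potential of the derivative of `u` is regular in the interior, the flux is
the antiderivative of the nonlinearity at every interior point. -/
lemma flux_eq (hT : 0 < T) (hα : α ∈ Ioc (1 / 2 : ℝ) 1) {p h : ℝ → ℝ} (hp : MemWt T α p)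
    (hh : Continuous h)
    (hreg : α < 1 → (∀ x ∈ Ioo 0 T, Integrable fun y => |x - y| ^ (1 - 2 * α) *
      (wt T α y * p y)) ∧ ContinuousOn (Aop α fun t => wt T α t * p t) (Ioo 0 T))
    (hc : ∀ᵐ x, x ∈ Ioo 0 T → Aop α (fun t => wt T α t * p t) x = h x)
    {u : ℝ → ℝ} (hu : u = fun t => ∫ s in (0 : ℝ)..t, wt T α s * p s) {t : ℝ} (ht : t ∈ Ioo 0 T) :
    LeftRLExists 0 (1 - α) (caputoLeft 0 α u) t ∧ RightRLExists T (1 - α) (caputoRight T α u) t ∧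
      flux T α u t = h t := by
  have hα0 : 0 < α := by linarith [hα.1]
  have hpi := hp.integrable hT hα0
  by_cases h1 : α = 1
  · subst h1
    refine ⟨Or.inl (sub_self _), Or.inl (sub_self _), ?_⟩
    have h2 : flux T 1 u t = 2 * deriv u t := by
      simp only [flux, caputoLeft, caputoRight, leftRL, rightRL, sub_self, if_pos]; ring
    -- For α = 1 the a.e. identity makes u locally a primitive of the continuous function h/2, so u
    -- is differentiable with derivative h/2 at every interior point.
    have h3 : u =ᶠ[𝓝 t] fun x => ∫ s in (0 : ℝ)..x, h s / 2 := by
      filter_upwards [Ioo_mem_nhds ht.1 ht.2] with x hx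
      rw [hu]
      dsimp only
      rw [intervalIntegral.integral_of_le hx.1.le, intervalIntegral.integral_of_le hx.1.le,
        integral_Ioc_eq_integral_Ioo, integral_Ioc_eq_integral_Ioo]
      refine setIntegral_congr_ae measurableSet_Ioo ?_
      filter_upwards [hc] with s hs hsx
      have := hs ⟨hsx.1, hsx.2.trans hx.2⟩
      rw [Aop, if_pos rfl] at this
      linarith
    rw [h2, h3.deriv_eq, ((by fun_prop : Continuous fun s => h s / 2).integral_hasStrictDerivAt
      0 t).hasDerivAt.deriv]
    ring
  · have hα' : α ∈ Ioo (1 / 2 : ℝ) 1 := ⟨hα.1, lt_of_le_of_ne hα.2 h1⟩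
    obtain ⟨hi, hcont⟩ := hreg hα'.2
    have hu' : ∀ᵐ s, s ∈ Ioo 0 T → deriv u s = wt T α s * p s :=
      (LocallyIntegrable.ae_hasDerivAt_integral hpi.locallyIntegrable).mono
        fun s hs _ => by rw [hu]; exact (hs 0).deriv
    obtain ⟨hL, hR, hfl⟩ := flux_eq_Aop hα' (Ioo_subset_Icc_self ht) hu'
      (fun s hs => by rw [wt_of_notMem hs, zero_mul])
      (measurable_wt.aestronglyMeasurable.mul hp.1) (hi t ht)
    refine ⟨hL, hR, hfl.trans ?_⟩
    -- Two functions continuous on an open set and equal a.e. there are equal; this is where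
    -- interior regularity pays off.
    exact Measure.eqOn_open_of_ae_eq ((ae_restrict_iff' measurableSet_Ioo).2 hc) isOpen_Ioo hcont
      hh.continuousOn ht

/-- The flux equals c - ∫ f(u) at every interior point, so it can be differentiated classically
there; the right boundary value is the mean-zero condition on `wt` · p. -/
theorem isSolution_primitive (hT : 0 < T) (hα : α ∈ Ioc (1 / 2 : ℝ) 1) {f p : ℝ → ℝ}
    (hf : Continuous f) (hp : MemWt T α p) (hp0 : ∫ t, wt T α t * p t = 0)
    (hreg : α < 1 → (∀ x ∈ Ioo 0 T, Integrable fun y => |x - y| ^ (1 - 2 * α) *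
      (wt T α y * p y)) ∧ ContinuousOn (Aop α fun t => wt T α t * p t) (Ioo 0 T)) {c : ℝ}
    (hc : ∀ᵐ x, x ∈ Ioo 0 T → Aop α (fun t => wt T α t * p t) x =
        c - ∫ s in (0 : ℝ)..x, f (∫ τ in (0 : ℝ)..s, wt T α τ * p τ)) :
    IsSolution T α f fun t => ∫ s in (0 : ℝ)..t, wt T α s * p s := by
  have hα0 : 0 < α := by linarith [hα.1]
  have hpi := hp.integrable hT hα0
  set u : ℝ → ℝ := fun t => ∫ s in (0 : ℝ)..t, wt T α s * p s with hu
  have hucont : Continuous u := intervalIntegral.continuous_primitive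
    (fun _ _ => hpi.intervalIntegrable) 0
  have hfu : Continuous fun t => f (u t) := hf.comp hucont
  have hH' : ∀ t, HasDerivAt (fun x => c - ∫ s in (0 : ℝ)..x, f (u s)) (-f (u t)) t := fun t =>
    ((hfu.integral_hasStrictDerivAt 0 t).hasDerivAt).const_sub c
  have hHc : Continuous fun x => c - ∫ s in (0 : ℝ)..x, f (u s) :=
    continuous_iff_continuousAt.2 fun t => (hH' t).continuousAt
  have key := fun t ht => flux_eq hT hα hp hHc hreg hc hu (t := t) ht
  refine ⟨hpi.intervalIntegrable.absolutelyContinuousOnInterval_intervalIntegral (by simp), ?_,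
    by simp [hu], ?_⟩
  · rw [← restrict_Ioo_eq_restrict_Icc]
    filter_upwards [ae_restrict_mem measurableSet_Ioo] with t ht
    have hn := Ioo_mem_nhds ht.1 ht.2
    have hd : HasDerivAt (flux T α u) (-f (u t)) t := (hH' t).congr_of_eventuallyEq (by
      filter_upwards [hn] with s hs using (key s hs).2.2)
    refine ⟨?_, hd.differentiableAt, by rw [hd.deriv, neg_add_cancel]⟩
    filter_upwards [hn] with s hs using ⟨(key s hs).1, (key s hs).2.1⟩
  · rw [hu]
    dsimp only
    rw [← integral_eq_intervalIntegral_wt hT, hp0]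

end Solution

end FracBVP

theorem theorem3p1 (T α : ℝ) (hT : 0 < T) (hα : α ∈ Set.Ioc (1 / 2 : ℝ) 1)
    (f : ℝ → ℝ) (hf : Continuous f)
    (hSG : FracBVP.growthSup f > ENNReal.ofReal (FracBVP.kappa T α)) :
    ∃ u : ℝ → ℝ, FracBVP.MemE0 T α u ∧ FracBVP.IsSolution T α f u ∧
      FracBVP.IsWeakSolution T α f u := by
  obtain ⟨p, b, c, hp, hb, hsl, hcs, hpt, hp0, k, hk⟩ :=
    FracBVP.exists_weighted_solution hT hα hf hSG
  exact ⟨fun t => ∫ s in (0 : ℝ)..t, FracBVP.wt T α s * p s, FracBVP.memE0_primitive hT hα hp hp0,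
    FracBVP.isSolution_primitive hT hα hf hp hp0
      (fun h1 => FracBVP.riesz_regular hT ⟨hα.1, h1⟩ hb hsl hcs hp hpt) hk,
    FracBVP.isWeakSolution_primitive hT hα hf hp hk⟩
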